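/- Let $G$ be a group, let $R$ be a commutative ring, and let $\mathcal F$ be a family of finite subgroups of $G$ that is closed under conjugation and under taking subgroups. For a small preadditive category $\mathcal C$, a $\mathcal C$-module is a contravariant additive functor from $\mathcal C$ to $R$-modules; it is finitely generated if it is a quotient of a finite direct sum of modules $R[-,x]_{\mathcal C}=R\otimes_{\mathbb Z}[-,x]_{\mathcal C}$, and, for $n\in\mathbb N\cup\{\infty\}$, it is of type $\mathrm{FP}_n$ if it has a resolution $\cdots\to P_1\to P_0$ by projective $\mathcal C$-modules with $P_i$ finitely generated for all $i\le n$. The orbit category $\mathcal O_{\mathcal F}$ has as objects the $G$-sets $G/H$ with $H\in\mathcal F$, and $[G/H,G/K]_{\mathcal O_{\mathcal F}}$ is the free abelian group on the $G$-maps $G/H\to G/K$. The group $G$ is $\mathcal O_{\mathcal F}\mathrm{FP}_n$ over $R$ if the constant $\mathcal O_{\mathcal F}$-module $\underline R$ (with value $R$, every $G$-map acting as the identity) is of type $\mathrm{FP}_n$. The Mackey category $\mathcal M_{\mathcal F}$ has the same objects, and $[G/H,G/K]_{\mathcal M_{\mathcal F}}$ is the free abelian group on the basic morphisms, which are the diagrams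 of $G$-maps $G/H\leftarrow G/L\to G/K$ with $L\in\mathcal F$, up to isomorphism of $G/L$ compatible with both maps. Composition is bilinear, and the composite of two basic morphisms is the sum of the basic morphisms given by the $G$-orbits of the pullback. The Burnside functor $B^G=R[-,G/G]$ is the $\mathcal M_{\mathcal F}$-module whose value at $G/H$ is the free $R$-module on the equivalence classes of diagrams $G/H\leftarrow G/L\to G/G$ with $L\in\mathcal F$, morphisms acting by precomposition. The group $G$ is $\mathcal M_{\mathcal F}\mathrm{FP}_n$ over $R$ if $B^G$ is of type $\mathrm{FP}_n$. Then, for every $n\in\mathbb N\cup\{\infty\}$, the group $G$ is $\mathcal M_{\mathcal F}\mathrm{FP}_n$ over $R$ if and only if it is $\mathcal O_{\mathcal F}\mathrm{FP}_n$ over $R$. -/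

import Mathlib

open CategoryTheory CategoryTheory.Limits Opposite
open scoped TensorProduct

universe u

noncomputable section

/-! ### Families of finite subgroups -/

/-- A family of finite subgroups of `G` that is closed under conjugation and under taking
subgroups. -/
structure FiniteSubgroupFamily (G : Type u) [Group G] where
  /-- The set of members of the family. -/
  carrier : Set (Subgroup G)
  finite_of_mem : ∀ {H : Subgroup G}, H ∈ carrier → Finite H
  conj_mem : ∀ {H : Subgroup G}, H ∈ carrier → ∀ g : G,
    H.map (MulAut.conj g).toMonoidHom ∈ carrier
  mem_of_le : ∀ {H L : Subgroup G}, H ∈ carrier → L ≤ H → L ∈ carrier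

/-! ### Modules over a small preadditive category -/

section Modules

variable (R : Type u) [CommRing R] (C : Type u) [Category.{u} C] [Preadditive C]

/-- The category of contravariant `C`-modules over `R`: contravariant additive functors from `C`
to `R`-modules, with natural transformations as morphisms. -/
abbrev CatModule := Cᵒᵖ ⥤+ ModuleCat.{u} R

variable {C}

/-- The free module `R[-, x]_C`, which sends `y` to `R ⊗_ℤ [y, x]_C` and acts on morphisms by
precomposition. -/
def freeFunctor (x : C) : Cᵒᵖ ⥤ ModuleCat.{u} R where
  obj y := ModuleCat.of R (R ⊗[ℤ] (y.unop ⟶ x))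
  map {y z} f := ModuleCat.ofHom
    (((Preadditive.leftComp x f.unop).toIntLinearMap :
      (y.unop ⟶ x) →ₗ[ℤ] (z.unop ⟶ x)).baseChange R)
  map_id y := by
    ext
    simp [Preadditive.leftComp]
  map_comp f g := by
    ext
    simp [Preadditive.leftComp]

variable {R}

/-- A `C`-module is finitely generated if it receives an epimorphism from a finite direct sum of
modules `R[-, x]_C`. The direct sum and the epimorphism are taken in the category of all functors;
both are computed objectwise, so that a direct sum of additive functors is again additive. -/
def CatModule.IsFG (M : CatModule R C) : Prop :=
  ∃ (I : Type) (_ : Finite I) (x : I → C) (p : (∐ fun i => freeFunctor R (x i)) ⟶ M.obj), Epi p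

/-- A `C`-module `M` is of type `FP_n`, where `n` is a natural number or `∞`, if there is an exact
sequence `⋯ ⟶ P 2 ⟶ P 1 ⟶ P 0 ⟶ M ⟶ 0` of `C`-modules in which every `P i` is projective and
`P i` is finitely generated for all `i ≤ n`. Exactness is objectwise. -/
def CatModule.IsFP (n : ℕ∞) (M : CatModule R C) : Prop :=
  ∃ (P : ℕ → CatModule R C) (d : ∀ i, P (i + 1) ⟶ P i) (ε : P 0 ⟶ M),
    (∀ i, Projective (P i)) ∧
    (∀ i : ℕ, (i : ℕ∞) ≤ n → (P i).IsFG) ∧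
    (∀ x, Function.Surjective (ε.hom.app x)) ∧
    (∀ x, Function.Exact ((d 0).hom.app x) (ε.hom.app x)) ∧
    (∀ i x, Function.Exact ((d (i + 1)).hom.app x) ((d i).hom.app x))

end Modules

variable {G : Type u} [Group G] (F : FiniteSubgroupFamily G)

/-! ### The orbit category and Bredon modules -/

/-- The transitive `G`-sets `G/H` with `H` in the family. -/
structure TransitiveGSet where
  /-- The stabiliser `H` of the `G`-set `G/H`. -/
  subgroup : Subgroup G
  mem : subgroup ∈ F.carrier

/-- The category of the `G`-sets `G/H`, with `H` in the family, and all `G`-maps. -/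
instance : Category.{u} (TransitiveGSet F) where
  Hom H K := (G ⧸ H.subgroup) →[G] (G ⧸ K.subgroup)
  id _ := MulActionHom.id G
  comp f g := MulActionHom.comp g f

/-- The orbit category: its morphisms are the formal integral linear combinations of `G`-maps. -/
abbrev OrbitCategory := Free ℤ (TransitiveGSet F)

/-- The augmentation on the morphism groups of the orbit category, with `ε (∑ mᵢ αᵢ) = ∑ mᵢ`. -/
def OrbitCategory.augmentation (H K : OrbitCategory F) : (H ⟶ K) →+ ℤ :=
  Finsupp.liftAddHom (M := ℤ) fun _ : (show TransitiveGSet F from H) ⟶ K => AddMonoidHom.id ℤ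

lemma OrbitCategory.augmentation_id (H : OrbitCategory F) :
    OrbitCategory.augmentation F H H (𝟙 H) = 1 :=
  Finsupp.liftAddHom_apply_single _ _ _

lemma OrbitCategory.augmentation_comp {H K L : OrbitCategory F} (f : H ⟶ K) (g : K ⟶ L) :
    OrbitCategory.augmentation F H L (f ≫ g) =
      OrbitCategory.augmentation F H K f * OrbitCategory.augmentation F K L g := by
  have h₀ : ∀ A B : OrbitCategory F, OrbitCategory.augmentation F A B 0 = 0 := fun A B => map_zero _
  have hs : ∀ (A B : TransitiveGSet F) (a : A ⟶ B) (r : ℤ),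
      OrbitCategory.augmentation F A B (Finsupp.single a r) = r :=
    fun A B a r => Finsupp.liftAddHom_apply_single _ _ _
  induction f using Finsupp.induction_linear with
  | zero =>
    change OrbitCategory.augmentation F H L ((0 : H ⟶ K) ≫ g) =
      OrbitCategory.augmentation F H K 0 * _
    rw [zero_comp, h₀, h₀, zero_mul]
  | add f₁ f₂ h₁ h₂ =>
    erw [Preadditive.add_comp, map_add, map_add, h₁, h₂, add_mul]
  | single a r =>
    induction g using Finsupp.induction_linear with
    | zero =>
      change OrbitCategory.augmentation F H L ((Finsupp.single a r : H ⟶ K) ≫ (0 : K ⟶ L)) =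
        _ * OrbitCategory.augmentation F K L 0
      rw [comp_zero, h₀, h₀, mul_zero]
    | add g₁ g₂ h₁ h₂ =>
      erw [Preadditive.comp_add, map_add, map_add, h₁, h₂, mul_add]
    | single b s =>
      erw [Free.single_comp_single, hs, hs, hs]

/-- The constant Bredon module, with value `R` at every `G/H`, on which every `G`-map acts as the
identity. -/
def constantBredonModule (R : Type u) [CommRing R] : CatModule R (OrbitCategory F) where
  obj :=
    { obj := fun _ => ModuleCat.of R R
      map := fun {H K} f =>
        OrbitCategory.augmentation F K.unop H.unop f.unop • 𝟙 (ModuleCat.of R R)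
      map_id := fun H => by
        rw [unop_id, OrbitCategory.augmentation_id, one_smul]
      map_comp := fun f g => by
        rw [unop_comp, OrbitCategory.augmentation_comp, Preadditive.zsmul_comp,
          Preadditive.comp_zsmul, smul_smul, Category.comp_id, mul_comm] }
  property :=
    { map_add := fun {_ _ f g} => by
        change OrbitCategory.augmentation F _ _ (f.unop + g.unop) • 𝟙 (ModuleCat.of R R) = _
        rw [map_add, add_smul] }

/-- `G` is of type `FP_n` over `R` for Bredon modules with respect to the family `F`. -/
def IsBredonFP (R : Type u) [CommRing R] (n : ℕ∞) : Prop :=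
  (constantBredonModule F R).IsFP n

/-! ### Basic spans and their composition -/

section Spans

/-- A basic span `X ⟵ G/L ⟶ Y` of `G`-sets, with `L` in the family. -/
structure BasicSpan (X Y : Type u) [MulAction G X] [MulAction G Y] where
  /-- The stabiliser `L` of the apex `G/L`. -/
  apex : Subgroup G
  mem : apex ∈ F.carrier
  /-- The left leg. -/
  left : (G ⧸ apex) →[G] X
  /-- The right leg. -/
  right : (G ⧸ apex) →[G] Y

variable {X Y Z W T S : Type u} [MulAction G X] [MulAction G Y] [MulAction G Z] [MulAction G W]
  [MulAction G T] [MulAction G S]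

/-- Two basic spans are equivalent if there is a bijective `G`-map between their apexes that is
compatible with both legs. -/
instance BasicSpan.setoid (X Y : Type u) [MulAction G X] [MulAction G Y] :
    Setoid (BasicSpan F X Y) where
  r A B := ∃ σ : (G ⧸ A.apex) →[G] (G ⧸ B.apex), Function.Bijective σ ∧
    (∀ t, B.left (σ t) = A.left t) ∧ ∀ t, B.right (σ t) = A.right t
  iseqv :=
    { refl := fun _ => ⟨MulActionHom.id G, Function.bijective_id, fun _ => rfl, fun _ => rfl⟩
      symm := by
        rintro A B ⟨σ, hσ, hl, hr⟩
        obtain ⟨τ, h₁, h₂⟩ := Function.bijective_iff_has_inverse.1 hσ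
        refine ⟨σ.inverse τ h₁ h₂, ⟨h₂.injective, h₁.surjective⟩, fun t => ?_, fun t => ?_⟩
        · rw [← hl]; exact congrArg _ (h₂ t)
        · rw [← hr]; exact congrArg _ (h₂ t)
      trans := by
        rintro A B C ⟨σ, hσ, hl, hr⟩ ⟨τ, hτ, hl', hr'⟩
        exact ⟨τ.comp σ, hτ.comp hσ, fun t => (hl' _).trans (hl t),
          fun t => (hr' _).trans (hr t)⟩ }

/-- The basic morphisms from `X` to `Y`: equivalence classes of basic spans. -/
abbrev BasicMorphism (X Y : Type u) [MulAction G X] [MulAction G Y] :=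
  Quotient (BasicSpan.setoid F X Y)

/-- The free abelian group on the basic morphisms from `X` to `Y`. -/
abbrev SpanHom (X Y : Type u) [MulAction G X] [MulAction G Y] :=
  BasicMorphism F X Y →₀ ℤ

/-- The pullback `T ×_Y S` of two `G`-maps, as a set. -/
def FiberProd (r : T →[G] Y) (l : S →[G] Y) : Type u :=
  {p : T × S // r p.1 = l p.2}

instance (r : T →[G] Y) (l : S →[G] Y) : MulAction G (FiberProd r l) where
  smul g p := ⟨(g • p.1.1, g • p.1.2), by rw [map_smul, map_smul, p.2]⟩
  one_smul p := Subtype.ext (one_smul G p.1)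
  mul_smul g h p := Subtype.ext (mul_smul g h p.1)

/-- The first projection of the pullback. -/
def FiberProd.fst (r : T →[G] Y) (l : S →[G] Y) : FiberProd r l →[G] T where
  toFun p := p.1.1
  map_smul' _ _ := rfl

/-- The second projection of the pullback. -/
def FiberProd.snd (r : T →[G] Y) (l : S →[G] Y) : FiberProd r l →[G] S where
  toFun p := p.1.2
  map_smul' _ _ := rfl

/-- All stabilisers of points of `T` are in the family. -/
def HasIsotropyIn (T : Type u) [MulAction G T] : Prop :=
  ∀ t : T, MulAction.stabilizer G t ∈ F.carrier

variable {F}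

lemma HasIsotropyIn.of_map (hS : HasIsotropyIn F S) (f : T →[G] S) : HasIsotropyIn F T :=
  fun t => F.mem_of_le (hS (f t)) fun g hg => by
    rw [MulAction.mem_stabilizer_iff] at hg ⊢
    rw [← map_smul, hg]

lemma hasIsotropyIn_quotient {H : Subgroup G} (hH : H ∈ F.carrier) :
    HasIsotropyIn F (G ⧸ H) := by
  intro t
  obtain ⟨g, rfl⟩ := QuotientGroup.mk_surjective t
  have h : (g : G ⧸ H) = g • ((1 : G) : G ⧸ H) := by
    rw [MulAction.Quotient.smul_coe, smul_eq_mul, mul_one]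
  rw [h, MulAction.stabilizer_smul_eq_stabilizer_map_conj, MulAction.stabilizer_quotient]
  exact F.conj_mem hH g

/-- The `G`-map `G/G_t ⟶ T` that sends the base point to `t`. -/
def orbitMap (t : T) : (G ⧸ MulAction.stabilizer G t) →[G] T where
  toFun := MulAction.ofQuotientStabilizer G t
  map_smul' g x := MulAction.ofQuotientStabilizer_smul G t g x

lemma orbitMap_mk (t : T) (g : G) :
    orbitMap t (g : G ⧸ MulAction.stabilizer G t) = g • t := rfl

lemma orbitMap_one (t : T) :
    orbitMap t ((1 : G) : G ⧸ MulAction.stabilizer G t) = t := one_smul G t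

lemma orbitMap_injective (t : T) : Function.Injective (orbitMap (G := G) t) :=
  MulAction.injective_ofQuotientStabilizer G t

/-- For a span `X ⟵ T ⟶ Y` of `G`-sets and a point `t` of `T`, the basic span that is obtained by
restriction to the orbit of `t`, which is identified with `G/G_t`. -/
def BasicSpan.ofPoint (hT : HasIsotropyIn F T) (l : T →[G] X) (r : T →[G] Y) (t : T) :
    BasicSpan F X Y where
  apex := MulAction.stabilizer G t
  mem := hT t
  left := l.comp (orbitMap t)
  right := r.comp (orbitMap t)

lemma BasicSpan.equiv_of_injective (A B : BasicSpan F X Y) (l : T →[G] X) (r : T →[G] Y)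
    (f : (G ⧸ A.apex) →[G] T) (f' : (G ⧸ B.apex) →[G] T)
    (hf : Function.Injective f) (hf' : Function.Injective f')
    (hAl : ∀ t, l (f t) = A.left t) (hAr : ∀ t, r (f t) = A.right t)
    (hBl : ∀ t, l (f' t) = B.left t) (hBr : ∀ t, r (f' t) = B.right t)
    (h : ∃ a b, f a = f' b) : A ≈ B := by
  obtain ⟨a, b, hab⟩ := h
  have key : ∀ x, ∃ y, f' y = f x := fun x => by
    obtain ⟨g, rfl⟩ := MulAction.exists_smul_eq G a x
    exact ⟨g • b, by rw [map_smul, map_smul, hab]⟩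
  have key' : ∀ y, ∃ x, f' y = f x := fun y => by
    obtain ⟨g, rfl⟩ := MulAction.exists_smul_eq G b y
    exact ⟨g • a, by rw [map_smul, map_smul, hab]⟩
  choose σ hσ using key
  refine ⟨⟨σ, fun g x => hf' ?_⟩, ⟨fun x y hxy => hf ?_, fun y => ?_⟩, fun t => ?_, fun t => ?_⟩
  · rw [hσ, map_smul, id, map_smul, hσ]
  · have : σ x = σ y := hxy
    rw [← hσ, ← hσ, this]
  · obtain ⟨x, hx⟩ := key' y
    exact ⟨x, hf' ((hσ x).trans hx.symm)⟩
  · rw [← hBl, ← hAl]; exact congrArg l (hσ t)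
  · rw [← hBr, ← hAr]; exact congrArg r (hσ t)

/-- The basic morphism given by an orbit of a span `X ⟵ T ⟶ Y` of `G`-sets. -/
def orbitClass (hT : HasIsotropyIn F T) (l : T →[G] X) (r : T →[G] Y) :
    MulAction.orbitRel.Quotient G T → BasicMorphism F X Y :=
  Quotient.lift (fun t => (⟦BasicSpan.ofPoint hT l r t⟧ : BasicMorphism F X Y)) fun t t' h => by
    obtain ⟨g, hg⟩ : t ∈ MulAction.orbit G t' := h
    refine Quotient.sound (BasicSpan.equiv_of_injective _ _ l r (orbitMap t) (orbitMap t')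
      (orbitMap_injective t) (orbitMap_injective t') (fun _ => rfl) (fun _ => rfl)
      (fun _ => rfl) (fun _ => rfl) ⟨((1 : G) : G ⧸ _), (g : G ⧸ _), ?_⟩)
    exact (orbitMap_one t).trans hg.symm

/-- The class of a span `X ⟵ T ⟶ Y` of `G`-sets, where `T` has finitely many orbits and isotropy in
the family: the sum of the basic morphisms given by the orbits of `T`. -/
def spanClass (hT : HasIsotropyIn F T) (l : T →[G] X) (r : T →[G] Y) : SpanHom F X Y :=
  ∑ᶠ o : MulAction.orbitRel.Quotient G T, Finsupp.single (orbitClass hT l r o) 1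

lemma BasicSpan.isotropy (A : BasicSpan F X Y) : HasIsotropyIn F (G ⧸ A.apex) :=
  hasIsotropyIn_quotient A.mem

/-- The composition of two basic spans `X ⟵ G/L ⟶ Y` and `Y ⟵ G/S ⟶ Z`: the sum of the orbits of
the pullback `G/L ×_Y G/S`. -/
def BasicSpan.comp (A : BasicSpan F X Y) (B : BasicSpan F Y Z) : SpanHom F X Z :=
  spanClass (A.isotropy.of_map (FiberProd.fst A.right B.left))
    (A.left.comp (FiberProd.fst A.right B.left)) (B.right.comp (FiberProd.snd A.right B.left))

/-- A pullback of transitive `G`-sets over a `G`-set with isotropy in the family has finitely many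
orbits, so that the sum in `BasicSpan.comp` is finite. -/
lemma BasicSpan.finite_orbits (hY : HasIsotropyIn F Y) (A : BasicSpan F X Y)
    (B : BasicSpan F Y Z) :
    Finite (MulAction.orbitRel.Quotient G (FiberProd A.right B.left)) := by
  rcases isEmpty_or_nonempty (FiberProd A.right B.left) with h | ⟨⟨⟨a, b⟩, hab⟩⟩
  · exact Quotient.finite _
  have hfin : Finite (MulAction.stabilizer G (A.right a)) := F.finite_of_mem (hY _)
  have hab : A.right a = B.left b := hab
  have hk : ∀ k : MulAction.stabilizer G (A.right a), A.right a = B.left ((k : G) • b) := by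
    intro k
    rw [map_smul, ← hab]
    exact (MulAction.mem_stabilizer_iff.1 k.2).symm
  refine Finite.of_surjective (fun k : MulAction.stabilizer G (A.right a) =>
    (Quotient.mk _ (⟨(a, (k : G) • b), hk k⟩ : FiberProd A.right B.left) :
      MulAction.orbitRel.Quotient G (FiberProd A.right B.left))) fun o => ?_
  obtain ⟨⟨⟨a', b'⟩, h'⟩, rfl⟩ := Quotient.exists_rep o
  have h' : A.right a' = B.left b' := h'
  obtain ⟨g, rfl⟩ := MulAction.exists_smul_eq G a a'
  obtain ⟨k, rfl⟩ := MulAction.exists_smul_eq G b b'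
  have hmem : g⁻¹ * k ∈ MulAction.stabilizer G (A.right a) := by
    rw [MulAction.mem_stabilizer_iff, mul_smul, hab, ← map_smul, ← h', map_smul, inv_smul_smul, hab]
  refine ⟨⟨g⁻¹ * k, hmem⟩, Quotient.sound ?_⟩
  refine ⟨g⁻¹, Subtype.ext (Prod.ext ?_ ?_)⟩
  · exact inv_smul_smul g a
  · exact (mul_smul g⁻¹ k b).symm

/-- If the `G`-set `T` is a finite disjoint union of `G`-sets `U i` with finitely many orbits, then
`T` has finitely many orbits and its class is the sum of the classes of the `U i`. -/
lemma spanClass_sigma {ι : Type u} [Finite ι] {U : ι → Type u} [∀ i, MulAction G (U i)]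
    (hU : ∀ i, HasIsotropyIn F (U i)) (hT : HasIsotropyIn F T) (l : T →[G] X) (r : T →[G] Y)
    (j : ∀ i, U i →[G] T) (hj : Function.Bijective fun x : (i : ι) × U i => j x.1 x.2)
    (hfin : ∀ i, Finite (MulAction.orbitRel.Quotient G (U i))) :
    Finite (MulAction.orbitRel.Quotient G T) ∧
      spanClass hT l r = ∑ᶠ i, spanClass (hU i) (l.comp (j i)) (r.comp (j i)) := by
  let Φ : ((i : ι) × MulAction.orbitRel.Quotient G (U i)) → MulAction.orbitRel.Quotient G T :=
    fun x => Quotient.map (j x.1) (by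
      rintro _ b ⟨g, rfl⟩
      exact ⟨g, (map_smul (j x.1) g b).symm⟩) x.2
  have hΦ : Function.Bijective Φ := by
    constructor
    · rintro ⟨i, o⟩ ⟨i', o'⟩ h
      induction o using Quotient.inductionOn with | _ t
      induction o' using Quotient.inductionOn with | _ t'
      obtain ⟨g, hg⟩ := Quotient.exact h
      have hg : j i' (g • t') = j i t := (map_smul (j i') g t').trans hg
      have := hj.1 (a₁ := ⟨i', g • t'⟩) (a₂ := ⟨i, t⟩) hg
      obtain rfl : i' = i := congrArg Sigma.fst this
      obtain rfl : g • t' = t := eq_of_heq (Sigma.mk.inj this).2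
      congr 1
      exact Quotient.sound ⟨g, rfl⟩
    · intro o
      induction o using Quotient.inductionOn with | _ t
      obtain ⟨⟨i, u⟩, rfl⟩ := hj.2 t
      exact ⟨⟨i, ⟦u⟧⟩, rfl⟩
  have hfT : Finite (MulAction.orbitRel.Quotient G T) := Finite.of_surjective Φ hΦ.2
  refine ⟨hfT, ?_⟩
  have hcls : ∀ x, orbitClass (hU x.1) (l.comp (j x.1)) (r.comp (j x.1)) x.2 =
      orbitClass hT l r (Φ x) := by
    rintro ⟨i, o⟩
    induction o using Quotient.inductionOn with | _ t
    have hji : Function.Injective (j i) := fun a b hab =>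
      eq_of_heq (Sigma.mk.inj (hj.1 (a₁ := ⟨i, a⟩) (a₂ := ⟨i, b⟩) hab)).2
    refine Quotient.sound (BasicSpan.equiv_of_injective _ _ l r ((j i).comp (orbitMap t))
      (orbitMap (j i t)) (hji.comp (orbitMap_injective t)) (orbitMap_injective _)
      (fun _ => rfl) (fun _ => rfl) (fun _ => rfl) (fun _ => rfl)
      ⟨((1 : G) : G ⧸ _), ((1 : G) : G ⧸ _), ?_⟩)
    exact (congrArg (j i) (orbitMap_one t)).trans (orbitMap_one (j i t)).symm
  unfold spanClass
  rw [← finsum_eq_of_bijective Φ hΦ (f := fun x => Finsupp.single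
    (orbitClass (hU x.1) (l.comp (j x.1)) (r.comp (j x.1)) x.2) (1 : ℤ)) (fun x => by rw [hcls x])]
  cases nonempty_fintype ι
  have := fun i => Fintype.ofFinite (MulAction.orbitRel.Quotient G (U i))
  simp only [finsum_eq_sum_of_fintype]
  exact Fintype.sum_sigma _

/-- The class of a span only depends on its isomorphism class. -/
lemma spanClass_congr (hS : HasIsotropyIn F S) (hT : HasIsotropyIn F T) (e : S →[G] T)
    (he : Function.Bijective e) (l : S →[G] X) (r : S →[G] Y) (l' : T →[G] X) (r' : T →[G] Y)
    (hl : ∀ s, l' (e s) = l s) (hr : ∀ s, r' (e s) = r s) :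
    spanClass hS l r = spanClass hT l' r' := by
  obtain rfl : l'.comp e = l := MulActionHom.ext hl
  obtain rfl : r'.comp e = r := MulActionHom.ext hr
  have hΦ : Function.Bijective (Quotient.map e (by
      rintro _ b ⟨g, rfl⟩
      exact ⟨g, (map_smul e g b).symm⟩) :
      MulAction.orbitRel.Quotient G S → MulAction.orbitRel.Quotient G T) := by
    constructor
    · intro o o' h
      induction o using Quotient.inductionOn with | _ t
      induction o' using Quotient.inductionOn with | _ t'
      obtain ⟨g, hg⟩ := Quotient.exact h
      exact Quotient.sound ⟨g, he.1 ((map_smul e g t').trans hg)⟩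
    · intro o
      induction o using Quotient.inductionOn with | _ t
      obtain ⟨u, rfl⟩ := he.2 t
      exact ⟨⟦u⟧, rfl⟩
  refine finsum_eq_of_bijective _ hΦ fun o => ?_
  induction o using Quotient.inductionOn with | _ t
  congr 1
  refine Quotient.sound (BasicSpan.equiv_of_injective _ _ l' r' (e.comp (orbitMap t))
      (orbitMap (e t)) (he.1.comp (orbitMap_injective t)) (orbitMap_injective _)
      (fun _ => rfl) (fun _ => rfl) (fun _ => rfl) (fun _ => rfl)
      ⟨((1 : G) : G ⧸ _), ((1 : G) : G ⧸ _), ?_⟩)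
  exact (congrArg e (orbitMap_one t)).trans (orbitMap_one (e t)).symm

/-- The map of pullbacks induced by maps over the base. -/
def FiberProd.map {T' S' : Type u} [MulAction G T'] [MulAction G S']
    (r : T →[G] Y) (l : S →[G] Y) (r' : T' →[G] Y) (l' : S' →[G] Y)
    (f : T →[G] T') (g : S →[G] S') (hf : ∀ t, r' (f t) = r t) (hg : ∀ s, l' (g s) = l s) :
    FiberProd r l →[G] FiberProd r' l' where
  toFun p := ⟨(f p.1.1, g p.1.2), by rw [hf, hg]; exact p.2⟩
  map_smul' c p := Subtype.ext (Prod.ext (map_smul f c p.1.1) (map_smul g c p.1.2))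

lemma FiberProd.map_bijective {T' S' : Type u} [MulAction G T'] [MulAction G S']
    (r : T →[G] Y) (l : S →[G] Y) (r' : T' →[G] Y) (l' : S' →[G] Y)
    (f : T →[G] T') (g : S →[G] S') (hf : ∀ t, r' (f t) = r t) (hg : ∀ s, l' (g s) = l s)
    (hf' : Function.Bijective f) (hg' : Function.Bijective g) :
    Function.Bijective (FiberProd.map r l r' l' f g hf hg) := by
  constructor
  · rintro ⟨⟨a, b⟩, h⟩ ⟨⟨a', b'⟩, h'⟩ e
    have e := Prod.ext_iff.1 (Subtype.ext_iff.1 e)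
    exact Subtype.ext (Prod.ext (hf'.1 e.1) (hg'.1 e.2))
  · rintro ⟨⟨a, b⟩, h⟩
    obtain ⟨a, rfl⟩ := hf'.2 a
    obtain ⟨b, rfl⟩ := hg'.2 b
    exact ⟨⟨(a, b), by rw [← hf, ← hg]; exact h⟩, rfl⟩

lemma orbitMap_out_bijective :
    Function.Bijective fun x : (o : MulAction.orbitRel.Quotient G T) ×
      (G ⧸ MulAction.stabilizer G o.out) => orbitMap x.1.out x.2 := by
  constructor
  · rintro ⟨o, a⟩ ⟨o', a'⟩ e
    have e : orbitMap o.out a = orbitMap o'.out a' := e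
    obtain rfl : o = o' := by
      obtain ⟨g, rfl⟩ := QuotientGroup.mk_surjective a
      obtain ⟨g', rfl⟩ := QuotientGroup.mk_surjective a'
      rw [orbitMap_mk, orbitMap_mk] at e
      rw [← Quotient.out_eq o, ← Quotient.out_eq o']
      refine Quotient.sound ⟨g⁻¹ * g', ?_⟩
      change (g⁻¹ * g') • o'.out = o.out
      rw [mul_smul, ← e, inv_smul_smul]
    obtain rfl : a = a' := orbitMap_injective _ e
    rfl
  · intro t
    obtain ⟨g, hg⟩ : (⟦t⟧ : MulAction.orbitRel.Quotient G T).out ∈ MulAction.orbit G t :=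
      Quotient.exact (Quotient.out_eq (⟦t⟧ : MulAction.orbitRel.Quotient G T))
    have hg : g • t = _ := hg
    refine ⟨⟨⟦t⟧, ((g⁻¹ : G) : G ⧸ _)⟩, ?_⟩
    change orbitMap _ _ = t
    rw [orbitMap_mk, ← hg, inv_smul_smul]

lemma FiberProd.sigma_left_bijective {ι : Type u} {U : ι → Type u} [∀ i, MulAction G (U i)]
    (r : T →[G] Y) (l : S →[G] Y) (j : ∀ i, U i →[G] T)
    (hj : Function.Bijective fun x : (i : ι) × U i => j x.1 x.2) :
    Function.Bijective fun x : (i : ι) × FiberProd (r.comp (j i)) l =>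
      FiberProd.map (r.comp (j x.1)) l r l (j x.1) (MulActionHom.id G)
        (fun _ => rfl) (fun _ => rfl) x.2 := by
  constructor
  · rintro ⟨i, ⟨⟨a, b⟩, h⟩⟩ ⟨i', ⟨⟨a', b'⟩, h'⟩⟩ e
    have e := Prod.ext_iff.1 (Subtype.ext_iff.1 e)
    have e₁ := hj.1 (a₁ := ⟨i, a⟩) (a₂ := ⟨i', a'⟩) e.1
    obtain rfl : b = b' := e.2
    cases e₁
    rfl
  · rintro ⟨⟨t, b⟩, h⟩
    obtain ⟨⟨i, a⟩, rfl⟩ := hj.2 t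
    exact ⟨⟨i, ⟨(a, b), h⟩⟩, rfl⟩

lemma FiberProd.sigma_right_bijective {ι : Type u} {U : ι → Type u} [∀ i, MulAction G (U i)]
    (r : S →[G] Y) (l : T →[G] Y) (j : ∀ i, U i →[G] T)
    (hj : Function.Bijective fun x : (i : ι) × U i => j x.1 x.2) :
    Function.Bijective fun x : (i : ι) × FiberProd r (l.comp (j i)) =>
      FiberProd.map r (l.comp (j x.1)) r l (MulActionHom.id G) (j x.1)
        (fun _ => rfl) (fun _ => rfl) x.2 := by
  constructor
  · rintro ⟨i, ⟨⟨b, a⟩, h⟩⟩ ⟨i', ⟨⟨b', a'⟩, h'⟩⟩ e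
    have e := Prod.ext_iff.1 (Subtype.ext_iff.1 e)
    have e₁ := hj.1 (a₁ := ⟨i, a⟩) (a₂ := ⟨i', a'⟩) e.2
    obtain rfl : b = b' := e.1
    cases e₁
    rfl
  · rintro ⟨⟨b, t⟩, h⟩
    obtain ⟨⟨i, a⟩, rfl⟩ := hj.2 t
    exact ⟨⟨i, ⟨(b, a), h⟩⟩, rfl⟩

/-- The composition of two basic morphisms. -/
def BasicMorphism.comp (a : BasicMorphism F X Y) (b : BasicMorphism F Y Z) : SpanHom F X Z :=
  Quotient.liftOn₂ a b BasicSpan.comp (by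
    rintro A B A' B' ⟨σ, hσ, hσl, hσr⟩ ⟨τ, hτ, hτl, hτr⟩
    refine spanClass_congr _ _
      (FiberProd.map A.right B.left A'.right B'.left σ τ hσr hτl)
      (FiberProd.map_bijective A.right B.left A'.right B'.left σ τ hσr hτl hσ hτ) _ _ _ _
      (fun s => hσl _) (fun s => hτr _))

/-- The composition of integral combinations of basic morphisms, in diagrammatic order: the
bilinear extension of the composition of basic morphisms. -/
def spanComp : SpanHom F X Y →ₗ[ℤ] SpanHom F Y Z →ₗ[ℤ] SpanHom F X Z :=
  Finsupp.linearCombination ℤ fun a => Finsupp.linearCombination ℤ fun b => a.comp b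

lemma spanComp_add_left (f f' : SpanHom F X Y) (g : SpanHom F Y Z) :
    spanComp (f + f') g = spanComp f g + spanComp f' g := by
  rw [map_add, LinearMap.add_apply]

lemma spanComp_add_right (f : SpanHom F X Y) (g g' : SpanHom F Y Z) :
    spanComp f (g + g') = spanComp f g + spanComp f g' :=
  map_add _ _ _

lemma spanComp_single (A : BasicSpan F X Y) (B : BasicSpan F Y Z) :
    spanComp (Finsupp.single (⟦A⟧ : BasicMorphism F X Y) 1)
      (Finsupp.single (⟦B⟧ : BasicMorphism F Y Z) 1) = A.comp B := by
  rw [spanComp, Finsupp.linearCombination_single, one_smul, Finsupp.linearCombination_single,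
    one_smul]
  rfl

/-- Composition of the class of an arbitrary span with a basic morphism is by pullback. -/
lemma spanComp_spanClass_left (hY : HasIsotropyIn F Y) (hT : HasIsotropyIn F T)
    [Finite (MulAction.orbitRel.Quotient G T)] (l : T →[G] X) (r : T →[G] Y)
    (B : BasicSpan F Y Z) :
    spanComp (spanClass hT l r) (Finsupp.single (⟦B⟧ : BasicMorphism F Y Z) 1) =
      spanClass (hT.of_map (FiberProd.fst r B.left)) (l.comp (FiberProd.fst r B.left))
        (B.right.comp (FiberProd.snd r B.left)) := by
  have hcls : ∀ o : MulAction.orbitRel.Quotient G T,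
      orbitClass hT l r o = ⟦BasicSpan.ofPoint hT l r o.out⟧ := fun o => by
    conv_lhs => rw [← Quotient.out_eq o]
    rfl
  have hb := FiberProd.sigma_left_bijective r B.left
    (fun o : MulAction.orbitRel.Quotient G T => orbitMap o.out) orbitMap_out_bijective
  have hU : ∀ o : MulAction.orbitRel.Quotient G T,
      HasIsotropyIn F (FiberProd (r.comp (orbitMap o.out)) B.left) := fun o =>
    (hT.of_map (orbitMap o.out)).of_map (FiberProd.fst (r.comp (orbitMap o.out)) B.left)
  have hfin : ∀ o : MulAction.orbitRel.Quotient G T, Finite (MulAction.orbitRel.Quotient G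
      (FiberProd (r.comp (orbitMap o.out)) B.left)) := fun o =>
    BasicSpan.finite_orbits hY (BasicSpan.ofPoint hT l r o.out) B
  rw [(spanClass_sigma hU (hT.of_map (FiberProd.fst r B.left)) (l.comp (FiberProd.fst r B.left))
    (B.right.comp (FiberProd.snd r B.left))
    (fun o => FiberProd.map (r.comp (orbitMap o.out)) B.left r B.left (orbitMap o.out)
      (MulActionHom.id G) (fun _ => rfl) (fun _ => rfl)) hb hfin).2]
  have : Fintype (MulAction.orbitRel.Quotient G T) := Fintype.ofFinite _
  rw [spanClass, finsum_eq_sum_of_fintype, finsum_eq_sum_of_fintype, map_sum, LinearMap.sum_apply]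
  refine Finset.sum_congr rfl fun o _ => ?_
  rw [hcls, spanComp_single]
  rfl

/-- Composition of a basic morphism with the class of an arbitrary span is by pullback. -/
lemma spanComp_spanClass_right (hY : HasIsotropyIn F Y) (hT : HasIsotropyIn F T)
    [Finite (MulAction.orbitRel.Quotient G T)] (l : T →[G] Y) (r : T →[G] Z)
    (A : BasicSpan F X Y) :
    spanComp (Finsupp.single (⟦A⟧ : BasicMorphism F X Y) 1) (spanClass hT l r) =
      spanClass (hT.of_map (FiberProd.snd A.right l)) (A.left.comp (FiberProd.fst A.right l))
        (r.comp (FiberProd.snd A.right l)) := by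
  have hcls : ∀ o : MulAction.orbitRel.Quotient G T,
      orbitClass hT l r o = ⟦BasicSpan.ofPoint hT l r o.out⟧ := fun o => by
    conv_lhs => rw [← Quotient.out_eq o]
    rfl
  have hb := FiberProd.sigma_right_bijective A.right l
    (fun o : MulAction.orbitRel.Quotient G T => orbitMap o.out) orbitMap_out_bijective
  have hU : ∀ o : MulAction.orbitRel.Quotient G T,
      HasIsotropyIn F (FiberProd A.right (l.comp (orbitMap o.out))) := fun o =>
    (hT.of_map (orbitMap o.out)).of_map (FiberProd.snd A.right (l.comp (orbitMap o.out)))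
  have hfin : ∀ o : MulAction.orbitRel.Quotient G T, Finite (MulAction.orbitRel.Quotient G
      (FiberProd A.right (l.comp (orbitMap o.out)))) := fun o =>
    BasicSpan.finite_orbits hY A (BasicSpan.ofPoint hT l r o.out)
  rw [(spanClass_sigma hU (hT.of_map (FiberProd.snd A.right l))
    (A.left.comp (FiberProd.fst A.right l)) (r.comp (FiberProd.snd A.right l))
    (fun o => FiberProd.map A.right (l.comp (orbitMap o.out)) A.right l (MulActionHom.id G)
      (orbitMap o.out) (fun _ => rfl) (fun _ => rfl)) hb hfin).2]
  have : Fintype (MulAction.orbitRel.Quotient G T) := Fintype.ofFinite _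
  rw [spanClass, finsum_eq_sum_of_fintype, finsum_eq_sum_of_fintype, map_sum]
  refine Finset.sum_congr rfl fun o _ => ?_
  rw [hcls, spanComp_single]
  rfl

lemma spanComp_assoc (hY : HasIsotropyIn F Y) (hZ : HasIsotropyIn F Z) (f : SpanHom F X Y)
    (g : SpanHom F Y Z) (h : SpanHom F Z W) :
    spanComp (spanComp f g) h = spanComp f (spanComp g h) := by
  induction f using Finsupp.induction_linear with
  | zero => simp
  | add f₁ f₂ h₁ h₂ => simp only [map_add, LinearMap.add_apply, h₁, h₂]
  | single a m =>
  induction g using Finsupp.induction_linear with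
  | zero => simp
  | add f₁ f₂ h₁ h₂ => simp only [map_add, LinearMap.add_apply, h₁, h₂]
  | single b n =>
  induction h using Finsupp.induction_linear with
  | zero => simp
  | add f₁ f₂ h₁ h₂ => simp only [map_add, h₁, h₂]
  | single c k =>
  induction a using Quotient.inductionOn with | _ A
  induction b using Quotient.inductionOn with | _ B
  induction c using Quotient.inductionOn with | _ C
  rw [← mul_one m, ← mul_one n, ← mul_one k, ← smul_eq_mul, ← smul_eq_mul, ← smul_eq_mul,
    ← Finsupp.smul_single, ← Finsupp.smul_single, ← Finsupp.smul_single]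
  simp only [map_smul, LinearMap.smul_apply]
  congr 3
  rw [spanComp_single, spanComp_single]
  have := BasicSpan.finite_orbits hY A B
  have := BasicSpan.finite_orbits hZ B C
  unfold BasicSpan.comp
  rw [spanComp_spanClass_left hZ, spanComp_spanClass_right hY]
  refine spanClass_congr _ _
    { toFun := fun p => ⟨(p.1.1.1.1, ⟨(p.1.1.1.2, p.1.2), p.2⟩), p.1.1.2⟩
      map_smul' := fun _ _ => rfl } ⟨?_, ?_⟩ _ _ _ _ (fun _ => rfl) (fun _ => rfl)
  · rintro ⟨⟨⟨⟨a, b⟩, h⟩, c⟩, h'⟩ ⟨⟨⟨⟨a', b'⟩, h₁⟩, c'⟩, h₁'⟩ e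
    have e := Prod.ext_iff.1 (Subtype.ext_iff.1 e)
    obtain rfl : a = a' := e.1
    have e := Prod.ext_iff.1 (Subtype.ext_iff.1 e.2)
    obtain rfl : b = b' := e.1
    obtain rfl : c = c' := e.2
    rfl
  · rintro ⟨⟨a, ⟨⟨b, c⟩, h⟩⟩, h'⟩
    exact ⟨⟨(⟨(a, b), h'⟩, c), h⟩, rfl⟩

/-- The class of a basic span, regarded as a span of `G`-sets, is the basic morphism it represents. -/
lemma spanClass_basic (A : BasicSpan F X Y) :
    spanClass A.isotropy A.left A.right = Finsupp.single (⟦A⟧ : BasicMorphism F X Y) 1 := by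
  let : Unique (MulAction.orbitRel.Quotient G (G ⧸ A.apex)) :=
    { default := ⟦((1 : G) : G ⧸ A.apex)⟧
      uniq := fun o => by
        induction o using Quotient.inductionOn with | _ t
        exact Quotient.sound (MulAction.exists_smul_eq G ((1 : G) : G ⧸ A.apex) t) }
  unfold spanClass
  rw [finsum_unique]
  congr 1
  exact Quotient.sound (BasicSpan.equiv_of_injective _ _ A.left A.right
    (orbitMap ((1 : G) : G ⧸ A.apex)) (MulActionHom.id G) (orbitMap_injective _)
    Function.injective_id (fun _ => rfl) (fun _ => rfl) (fun _ => rfl) (fun _ => rfl)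
    ⟨((1 : G) : G ⧸ _), ((1 : G) : G ⧸ _), one_smul G _⟩)

/-- The identity basic span of `G/H`, with both legs the identity. -/
def BasicSpan.refl {H : Subgroup G} (hH : H ∈ F.carrier) : BasicSpan F (G ⧸ H) (G ⧸ H) where
  apex := H
  mem := hH
  left := MulActionHom.id G
  right := MulActionHom.id G

lemma spanComp_refl_left {H : Subgroup G} (hH : H ∈ F.carrier) (f : SpanHom F (G ⧸ H) X) :
    spanComp (Finsupp.single (⟦BasicSpan.refl hH⟧ : BasicMorphism F (G ⧸ H) (G ⧸ H)) 1) f = f := by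
  induction f using Finsupp.induction_linear with
  | zero => simp
  | add f₁ f₂ h₁ h₂ => rw [map_add, h₁, h₂]
  | single b n =>
  induction b using Quotient.inductionOn with | _ B
  rw [← mul_one n, ← smul_eq_mul, ← Finsupp.smul_single, map_smul, spanComp_single,
    ← spanClass_basic]
  congr 1
  refine spanClass_congr _ _ (FiberProd.snd (BasicSpan.refl hH).right B.left)
    ⟨?_, fun b => ⟨⟨(B.left b, b), rfl⟩, rfl⟩⟩
    _ _ _ _ (fun p => p.2.symm) (fun _ => rfl)
  rintro ⟨⟨a, b⟩, h⟩ ⟨⟨a', b'⟩, h'⟩ e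
  have h : a = B.left b := h
  have h' : a' = B.left b' := h'
  obtain rfl : b = b' := e
  exact Subtype.ext (Prod.ext (h.trans h'.symm) rfl)

lemma spanComp_refl_right {H : Subgroup G} (hH : H ∈ F.carrier) (f : SpanHom F X (G ⧸ H)) :
    spanComp f (Finsupp.single (⟦BasicSpan.refl hH⟧ : BasicMorphism F (G ⧸ H) (G ⧸ H)) 1) = f := by
  induction f using Finsupp.induction_linear with
  | zero => simp
  | add f₁ f₂ h₁ h₂ => rw [map_add, LinearMap.add_apply, h₁, h₂]
  | single b n =>
  induction b using Quotient.inductionOn with | _ B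
  rw [← mul_one n, ← smul_eq_mul, ← Finsupp.smul_single, map_smul, LinearMap.smul_apply,
    spanComp_single, ← spanClass_basic]
  congr 1
  refine spanClass_congr _ _ (FiberProd.fst B.right (BasicSpan.refl hH).left)
    ⟨?_, fun b => ⟨⟨(b, B.right b), rfl⟩, rfl⟩⟩
    _ _ _ _ (fun _ => rfl) (fun p => p.2)
  rintro ⟨⟨b, a⟩, h⟩ ⟨⟨b', a'⟩, h'⟩ e
  have h : B.right b = a := h
  have h' : B.right b' = a' := h'
  obtain rfl : b = b' := e
  exact Subtype.ext (Prod.ext rfl (h.symm.trans h'))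

end Spans

/-! ### The Mackey category and Mackey functors -/

/-- The objects of the Mackey category: the transitive `G`-sets `G/H` with `H` in the family. -/
structure MackeyCategory where
  /-- The stabiliser `H` of the `G`-set `G/H`. -/
  subgroup : Subgroup G
  mem : subgroup ∈ F.carrier

/-- The Mackey category: morphisms from `G/H` to `G/K` are the integral linear combinations of
basic morphisms, and composition is by pullback. -/
instance : Category.{u} (MackeyCategory F) where
  Hom H K := SpanHom F (G ⧸ H.subgroup) (G ⧸ K.subgroup)
  id H := Finsupp.single ⟦BasicSpan.refl H.mem⟧ 1
  comp f g := spanComp f g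
  id_comp {H _} f := spanComp_refl_left H.mem f
  comp_id {_ K} f := spanComp_refl_right K.mem f
  assoc {_ K L _} f g h :=
    spanComp_assoc (hasIsotropyIn_quotient K.mem) (hasIsotropyIn_quotient L.mem) f g h

instance : Preadditive (MackeyCategory F) where
  homGroup H K :=
    inferInstanceAs (AddCommGroup (SpanHom F (G ⧸ H.subgroup) (G ⧸ K.subgroup)))
  add_comp _ _ _ f f' g := spanComp_add_left f f' g
  comp_add _ _ _ f g g' := spanComp_add_right f g g'

/-- Precomposition with a morphism of the Mackey category, on the integral combinations of basic
morphisms to an arbitrary `G`-set `X`. -/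
def precomp {H K : MackeyCategory F} (f : H ⟶ K) (X : Type u) [MulAction G X] :
    SpanHom F (G ⧸ K.subgroup) X →ₗ[ℤ] SpanHom F (G ⧸ H.subgroup) X :=
  spanComp (show SpanHom F (G ⧸ H.subgroup) (G ⧸ K.subgroup) from f)

lemma precomp_id (H : MackeyCategory F) (X : Type u) [MulAction G X] :
    precomp F (𝟙 H) X = LinearMap.id :=
  LinearMap.ext fun b => spanComp_refl_left H.mem b

lemma precomp_comp {H K L : MackeyCategory F} (f : H ⟶ K) (g : K ⟶ L) (X : Type u)
    [MulAction G X] : precomp F (f ≫ g) X = precomp F f X ∘ₗ precomp F g X :=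
  LinearMap.ext fun b => spanComp_assoc (hasIsotropyIn_quotient K.mem)
    (hasIsotropyIn_quotient L.mem) _ _ b

lemma precomp_add {H K : MackeyCategory F} (f g : H ⟶ K) (X : Type u) [MulAction G X] :
    precomp F (f + g) X = precomp F f X + precomp F g X :=
  LinearMap.ext fun b => spanComp_add_left _ _ b

/-- The Burnside functor `B^G = R[-, G/G]`: its value at `G/H` is the free `R`-module on the basic
morphisms `G/H ⟵ G/L ⟶ G/G`, with `L` in the family, and it acts on morphisms by
precomposition. (The subgroup `G` itself need not be in the family.) -/
def burnsideFunctor (R : Type u) [CommRing R] : CatModule R (MackeyCategory F) where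
  obj :=
    { obj := fun H =>
        ModuleCat.of R (R ⊗[ℤ] SpanHom F (G ⧸ H.unop.subgroup) (G ⧸ (⊤ : Subgroup G)))
      map := fun f => ModuleCat.ofHom ((precomp F f.unop (G ⧸ (⊤ : Subgroup G))).baseChange R)
      map_id := fun H => by
        rw [unop_id, precomp_id, LinearMap.baseChange_id]
        rfl
      map_comp := fun f g => by
        rw [unop_comp, precomp_comp, LinearMap.baseChange_comp]
        rfl }
  property :=
    { map_add := fun {_ _ f g} => by
        change ModuleCat.ofHom ((precomp F (f.unop + g.unop) _).baseChange R) = _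
        rw [precomp_add, LinearMap.baseChange_add]
        rfl }

/-- `G` is of type `FP_n` over `R` for Mackey functors with respect to the family `F`. -/
def IsMackeyFP (R : Type u) [CommRing R] (n : ℕ∞) : Prop :=
  (burnsideFunctor F R).IsFP n

end

/-!
Both sides are equivalent to the same condition: the family has only finitely many members up to
conjugation (`FiniteUpToIso`), and for every object `x = G/H` the trivial module `R` over the group
algebra of `Aut x`, the Weyl group of `H`, is of type `FP_k` for every natural number `k ≤ n`. (Over
the zero ring all modules vanish and there is nothing to prove.)

For Bredon modules this is elementary. Evaluation at `x` is exact, it sends the free module on `G/K`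
to the permutation module on the `G`-maps `G/H → G/K`, and it detects finite generation if there are
only finitely many objects up to isomorphism. The permutation module has finitely many orbits and
finite stabilisers, and such modules are of type `FP_k` for all `k`, whatever the ring `R`: they are
induced from finite subgroups, and generators can be chosen so that the kernel is again induced from
the same subgroups (`InducedFromFinite.moduleFP`). A dimension shift along syzygies then compares
the finiteness properties (`CatModule.isFP_iff_moduleFP`).

For Mackey functors evaluation is replaced by the Brauer quotient, the value at `x` modulo the
images of all proper transfers. It sends free modules to the same permutation modules
(`MackeyCategory.brauerBasis`), it sends the Burnside functor to the trivial module `R`, and it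
detects finite generation, by induction on the order of the isotropy groups. It is only right exact,
and the point is to see that it is exact on the short exact sequences that occur in a projective
resolution of the Burnside functor. This holds because they split after restriction to every `H` in
the family: the restriction of the Burnside functor to `H` is representable, and so projective. The
restriction to `H` is modelled by the transitive `G`-sets over `G/H` and the basic spans over `G/H`
(`LocalHom`). The resulting local retractions commute with transfers, which is all that the Brauer
quotient needs (`MackeyCategory.brauerRep_map_kerIncl_injective`). The class of locally projective
Mackey functors contains the projective ones and the Burnside functor, and it is closed under
kernels of surjections, so that the dimension shift applies as before.

Finally, either side forces the family to be finite up to conjugation already for `n = 0`, since the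
values, or the Brauer quotients, are nonzero everywhere.
-/

noncomputable section

/-! ### Finiteness properties of modules over a ring -/

/-- The finiteness property `FP_n` of a module over a ring `A`, in inductive form: `FP_0` means
finitely generated, and `M` is `FP_{n+1}` if some finitely generated free module surjects onto it
with a kernel that is `FP_n`. -/
def ModuleFP (A : Type u) [Ring A] : ∀ (_ : ℕ) (M : Type u) [AddCommGroup M] [Module A M], Prop
  | 0, M, _, _ => Module.Finite A M
  | n + 1, M, _, _ => ∃ (k : ℕ) (f : (Fin k → A) →ₗ[A] M),
      Function.Surjective f ∧ ModuleFP A n (LinearMap.ker f)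

namespace ModuleFP

variable {A : Type u} [Ring A] {X Y Z : Type u} [AddCommGroup X] [AddCommGroup Y] [AddCommGroup Z]
  [Module A X] [Module A Y] [Module A Z]

lemma finite {n : ℕ} (h : ModuleFP A n X) : Module.Finite A X := by
  cases n with
  | zero => exact h
  | succ n =>
    obtain ⟨k, f, hf, -⟩ := h
    exact Module.Finite.of_surjective f hf

lemma of_succ {n : ℕ} : ∀ {X : Type u} [AddCommGroup X] [Module A X],
    ModuleFP A (n + 1) X → ModuleFP A n X := by
  induction n with
  | zero => exact fun h => h.finite
  | succ n ih =>
    rintro X _ _ ⟨k, f, hf, h⟩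
    exact ⟨k, f, hf, ih h⟩

lemma of_equiv {n : ℕ} (e : X ≃ₗ[A] Y) (h : ModuleFP A n X) : ModuleFP A n Y := by
  cases n with
  | zero => exact @Module.Finite.equiv _ _ _ _ _ _ _ _ h e
  | succ n =>
    obtain ⟨k, f, hf, h⟩ := h
    refine ⟨k, e.toLinearMap ∘ₗ f, e.surjective.comp hf, ?_⟩
    rwa [LinearEquiv.ker_comp]

lemma of_subsingleton [Subsingleton X] (n : ℕ) : ModuleFP A n X := by
  induction n generalizing X with
  | zero => exact Module.Finite.of_finite
  | succ n ih => exact ⟨0, 0, fun x => ⟨0, Subsingleton.elim _ _⟩, ih⟩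

lemma pi_fin (k n : ℕ) : ModuleFP A n (Fin k → A) := by
  cases n with
  | zero => exact inferInstanceAs (Module.Finite A (Fin k → A))
  | succ n =>
    refine ⟨k, LinearMap.id, Function.surjective_id, ?_⟩
    rw [LinearMap.ker_id]
    exact of_subsingleton n

/-- `FP_n` modules are closed under extensions. -/
lemma of_extension {n : ℕ} : ∀ {X Y Z : Type u} [AddCommGroup X] [AddCommGroup Y] [AddCommGroup Z]
    [Module A X] [Module A Y] [Module A Z] {i : X →ₗ[A] Y} {p : Y →ₗ[A] Z},
    Function.Injective i → Function.Exact i p → Function.Surjective p →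
    ModuleFP A n X → ModuleFP A n Z → ModuleFP A n Y := by
  induction n with
  | zero =>
    intro X Y Z _ _ _ _ _ _ i p hi hip hp hX hZ
    have hX : Module.Finite A X := hX
    have hZ : Module.Finite A Z := hZ
    refine ⟨Submodule.fg_of_fg_map_of_fg_inf_ker p ?_ ?_⟩
    · rw [Submodule.map_top, LinearMap.range_eq_top.2 hp]
      exact hZ.fg_top
    · rw [top_inf_eq, LinearMap.exact_iff.1 hip, LinearMap.range_eq_map]
      exact hX.fg_top.map i
  | succ n ih =>
    rintro X Y Z _ _ _ _ _ _ i p hi hip hp ⟨k, f, hf, hfk⟩ ⟨l, g, hg, hgk⟩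
    obtain ⟨g', hg'⟩ := Module.projective_lifting_property p g hp
    have hg' : ∀ x, p (g' x) = g x := fun x => LinearMap.congr_fun hg' x
    have hpi : ∀ x, p (i x) = 0 := fun x => (hip _).2 ⟨x, rfl⟩
    -- A lift of the cover `g` along `p` combines with `i ∘ f` to a cover of `Y`, as in the
    -- horseshoe lemma; its kernel is an extension of the kernel of `g` by the kernel of `f`.
    let e : (Fin (k + l) → A) ≃ₗ[A] (Fin k → A) × (Fin l → A) :=
      LinearEquiv.funCongrLeft A A finSumFinEquiv ≪≫ₗ
        LinearEquiv.sumArrowLequivProdArrow (Fin k) (Fin l) A A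
    let φ : (Fin k → A) × (Fin l → A) →ₗ[A] Y := (i ∘ₗ f).coprod g'
    have hφ : Function.Surjective φ := by
      intro y
      obtain ⟨b, hb⟩ := hg (p y)
      obtain ⟨x, hx⟩ := (hip (y - g' b)).1 (by rw [map_sub, hg', hb, sub_self])
      obtain ⟨a, ha⟩ := hf x
      exact ⟨(a, b), by simp [φ, ha, hx]⟩
    have hφp : ∀ w, p (φ w) = g w.2 := fun w => by simp [φ, hpi, hg']
    have key : ModuleFP A n (LinearMap.ker φ) := by
      refine ih (X := LinearMap.ker f) (Z := LinearMap.ker g)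
        (i := (LinearMap.inl A _ _).restrict (p := LinearMap.ker f) (q := LinearMap.ker φ) ?_)
        (p := (LinearMap.snd A _ _).restrict (p := LinearMap.ker φ) (q := LinearMap.ker g) ?_)
        ?_ ?_ ?_ hfk hgk
      · intro x hx
        have hx : f x = 0 := hx
        simp [φ, hx]
      · intro w hw
        have hw : φ w = 0 := hw
        rw [LinearMap.snd_apply, LinearMap.mem_ker, ← hφp, hw, map_zero]
      · intro a b h
        exact Subtype.ext (LinearMap.inl_injective (Subtype.ext_iff.1 h))
      · rintro ⟨⟨a, b⟩, hw⟩
        constructor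
        · intro h
          obtain rfl : b = 0 := Subtype.ext_iff.1 h
          have hw : φ (a, 0) = 0 := hw
          refine ⟨⟨a, hi ?_⟩, rfl⟩
          simpa [φ] using hw
        · rintro ⟨a', h⟩
          exact Subtype.ext (congrArg Prod.snd (Subtype.ext_iff.1 h)).symm
      · rintro ⟨b, hb⟩
        obtain ⟨x, hx⟩ := (hip (- g' b)).1 (by
          rw [map_neg, hg', LinearMap.mem_ker.1 hb, neg_zero])
        obtain ⟨a, ha⟩ := hf x
        refine ⟨⟨(a, b), ?_⟩, rfl⟩
        simp [φ, ha, hx]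
    refine ⟨k + l, φ ∘ₗ e.toLinearMap, hφ.comp e.surjective, ?_⟩
    refine key.of_equiv (LinearEquiv.symm ?_)
    rw [LinearMap.ker_comp]
    exact LinearEquiv.ofSubmodule' e _

/-- A quotient of an `FP_{n+1}` module by an `FP_n` submodule is `FP_{n+1}`. -/
lemma of_quotient {n : ℕ} {i : X →ₗ[A] Y} {p : Y →ₗ[A] Z} (hi : Function.Injective i)
    (hip : Function.Exact i p) (hp : Function.Surjective p) (hX : ModuleFP A n X)
    (hY : ModuleFP A (n + 1) Y) : ModuleFP A (n + 1) Z := by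
  obtain ⟨k, f, hf, h⟩ := hY
  refine ⟨k, p ∘ₗ f, hp.comp hf, ?_⟩
  have hle : LinearMap.ker f ≤ LinearMap.ker (p ∘ₗ f) := LinearMap.ker_le_ker_comp f p
  let q : LinearMap.ker (p ∘ₗ f) →ₗ[A] LinearMap.range i :=
    f.restrict fun x hx => (hip (f x)).1 hx
  refine of_extension (i := Submodule.inclusion hle) (p := q)
    (Submodule.inclusion_injective hle) ?_ ?_ h (hX.of_equiv (LinearEquiv.ofInjective i hi))
  · rintro ⟨x, hx⟩
    constructor
    · intro h
      exact ⟨⟨x, Subtype.ext_iff.1 h⟩, rfl⟩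
    · rintro ⟨⟨y, hy⟩, h⟩
      obtain rfl : y = x := Subtype.ext_iff.1 h
      exact Subtype.ext hy
  · rintro ⟨_, x, rfl⟩
    obtain ⟨y, hy⟩ := hf (i x)
    exact ⟨⟨y, by rw [LinearMap.mem_ker, LinearMap.comp_apply, hy]; exact (hip _).2 ⟨x, rfl⟩⟩,
      Subtype.ext hy⟩

/-- The kernel of a surjection from an `FP_n` module onto an `FP_{n+1}` module is `FP_n`. -/
lemma of_kernel {n : ℕ} {i : X →ₗ[A] Y} {p : Y →ₗ[A] Z} (hi : Function.Injective i)
    (hip : Function.Exact i p) (hp : Function.Surjective p) (hY : ModuleFP A n Y)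
    (hZ : ModuleFP A (n + 1) Z) : ModuleFP A n X := by
  obtain ⟨k, f, hf, h⟩ := hZ
  obtain ⟨f', hf'⟩ := Module.projective_lifting_property p f hp
  have hf' : ∀ x, p (f' x) = f x := fun x => LinearMap.congr_fun hf' x
  have hpi : ∀ x, p (i x) = 0 := fun x => (hip _).2 ⟨x, rfl⟩
  -- The pullback of `p` along the free cover `f` is `X × (Fin k → A)`; it is an extension of `Y`
  -- by the kernel of `f`.
  let φ : X × (Fin k → A) →ₗ[A] Y := i.coprod f'
  have hφp : ∀ w, p (φ w) = f w.2 := fun w => by simp [φ, hpi, hf']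
  have hφ : Function.Surjective φ := by
    intro y
    obtain ⟨b, hb⟩ := hf (p y)
    obtain ⟨x, hx⟩ := (hip (y - f' b)).1 (by rw [map_sub, hf', hb, sub_self])
    exact ⟨(x, b), by simp [φ, hx]⟩
  have hker : ModuleFP A n (LinearMap.ker φ) := by
    refine h.of_equiv (LinearEquiv.symm (LinearEquiv.ofBijective
      ((LinearMap.snd A X (Fin k → A)).restrict (p := LinearMap.ker φ) (q := LinearMap.ker f)
        fun w hw => ?_) ⟨?_, ?_⟩))
    · rw [LinearMap.snd_apply, LinearMap.mem_ker, ← hφp, LinearMap.mem_ker.1 hw, map_zero]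
    · rw [← LinearMap.ker_eq_bot, LinearMap.ker_eq_bot']
      rintro ⟨⟨a, b⟩, hw⟩ h
      obtain rfl : b = 0 := Subtype.ext_iff.1 h
      have hw : φ (a, 0) = 0 := hw
      obtain rfl : a = 0 := hi (by simpa [φ] using hw)
      rfl
    · rintro ⟨b, hb⟩
      obtain ⟨x, hx⟩ := (hip (- f' b)).1 (by
        rw [map_neg, hf', LinearMap.mem_ker.1 hb, neg_zero])
      exact ⟨⟨(x, b), by simp [φ, hx]⟩, rfl⟩
  have hW : ModuleFP A n (X × (Fin k → A)) :=
    of_extension (LinearMap.ker φ).injective_subtype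
      (LinearMap.exact_subtype_ker_map φ) hφ hker hY
  cases n with
  | zero =>
    have : Module.Finite A (X × (Fin k → A)) := hW
    exact Module.Finite.of_surjective (LinearMap.fst A X (Fin k → A)) LinearMap.fst_surjective
  | succ n =>
    exact of_quotient (i := LinearMap.inr A X (Fin k → A)) (p := LinearMap.fst A X (Fin k → A))
      LinearMap.inr_injective Function.Exact.inr_fst LinearMap.fst_surjective (pi_fin k n) hW

/-- `FP_n` modules are closed under retracts. -/
lemma of_retract {n : ℕ} (i : X →ₗ[A] Y) (r : Y →ₗ[A] X) (h : ∀ x, r (i x) = x)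
    (hY : ModuleFP A n Y) : ModuleFP A n X := by
  have hr : Function.Surjective r := fun x => ⟨i x, h x⟩
  induction n generalizing X with
  | zero =>
    have : Module.Finite A Y := hY
    exact Module.Finite.of_surjective r hr
  | succ n ih =>
    let s : Y →ₗ[A] LinearMap.ker r := (LinearMap.id - i ∘ₗ r).codRestrict _ fun y => by
      simp [h]
    have hK : ModuleFP A n (LinearMap.ker r) := by
      refine ih (LinearMap.ker r).subtype s (fun y => Subtype.ext ?_) hY.of_succ
        (fun y => ⟨y, Subtype.ext ?_⟩) <;>
      simp [s, LinearMap.mem_ker.1 y.2]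
    exact of_quotient (LinearMap.ker r).injective_subtype (LinearMap.exact_subtype_ker_map r) hr
      hK hY

lemma pi {n : ℕ} {ι : Type} [Finite ι] {V : ι → Type u} [∀ i, AddCommGroup (V i)]
    [∀ i, Module A (V i)] (h : ∀ i, ModuleFP A n (V i)) : ModuleFP A n (∀ i, V i) := by
  suffices H : ∀ (k : ℕ) (W : Fin k → Type u) [∀ i, AddCommGroup (W i)] [∀ i, Module A (W i)],
      (∀ i, ModuleFP A n (W i)) → ModuleFP A n (∀ i, W i) by
    obtain ⟨k, ⟨e⟩⟩ := Finite.exists_equiv_fin ι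
    exact (H k (fun j => V (e.symm j)) fun j => h _).of_equiv
      (LinearEquiv.piCongrLeft A V e.symm)
  intro k
  induction k with
  | zero => exact fun W _ _ _ => of_subsingleton n
  | succ k ih =>
    intro W _ _ hW
    refine of_extension (i := LinearMap.single A W 0)
      (p := LinearMap.pi fun i : Fin k => LinearMap.proj i.succ) ?_ ?_ ?_ (hW 0)
      (ih (fun i => W i.succ) fun i => hW _)
    · exact Pi.single_injective 0
    · intro w
      constructor
      · intro hw
        refine ⟨w 0, funext fun i => ?_⟩
        refine Fin.cases ?_ (fun i => ?_) i
        · simp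
        · simpa using (congrFun hw i).symm
      · rintro ⟨x, rfl⟩
        ext i
        simp
    · intro w
      exact ⟨Fin.cons 0 w, funext fun i => by simp⟩

end ModuleFP

/-! ### Permutation modules with finite stabilisers -/

lemma ModuleFP.succ_of_finite {A : Type u} [Ring A] {V : Type u} [AddCommGroup V] [Module A V]
    {I : Type} [Finite I] {n : ℕ} (f : (I → A) →ₗ[A] V) (hf : Function.Surjective f)
    (h : ModuleFP A n (LinearMap.ker f)) : ModuleFP A (n + 1) V := by
  obtain ⟨k, ⟨e⟩⟩ := Finite.exists_equiv_fin I
  let E : (Fin k → A) ≃ₗ[A] (I → A) := LinearEquiv.funCongrLeft A A e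
  refine ⟨k, f ∘ₗ E.toLinearMap, hf.comp E.surjective, h.of_equiv (LinearEquiv.symm ?_)⟩
  rw [LinearMap.ker_comp]
  exact LinearEquiv.ofSubmodule' E _

section Induced

variable {R : Type u} [CommRing R] {N : Type u} [Group N]

/-- The element `g` of the group algebra. -/
abbrev grp (R : Type u) [CommRing R] {N : Type u} [Group N] (g : N) : MonoidAlgebra R N :=
  MonoidAlgebra.single g 1

lemma grp_mul (g h : N) : grp R (g * h) = grp R g * grp R h := by
  simp [grp, MonoidAlgebra.single_mul_single]

lemma grp_one : grp R (1 : N) = 1 := rfl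

lemma grp_smul_smul {V : Type u} [AddCommGroup V]
    [Module (MonoidAlgebra R N) V] (g h : N) (v : V) :
    grp R g • grp R h • v = grp R (g * h) • v := by
  rw [grp_mul, mul_smul]

variable {V : Type u} [AddCommGroup V] [Module R V] [Module (MonoidAlgebra R N) V]
  [IsScalarTower R (MonoidAlgebra R N) V]

/-- Data exhibiting a module `V` over the group algebra of `N` as a finite direct sum of modules
induced from finite subgroups `S j`, the modules being finitely generated projective over `R`: the
map `e j` is the `R`-linear projection of `V` onto the summand `range (e j)`, and `V` is the direct
sum of the translates of these summands, one for each coset of `S j`. -/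
structure InducedFromFinite {J : Type} (S : J → Subgroup N) (e : J → V →ₗ[R] V) : Prop where
  finite : ∀ j, Finite (S j)
  idem : ∀ j v, e j (e j v) = e j v
  equivariant : ∀ j, ∀ s ∈ S j, ∀ v, e j (grp R s • v) = grp R s • e j v
  ortho : ∀ j i g v, (i = j → g ∉ S j) → e i (grp R g • e j v) = 0
  span : ∀ v, v ∈ Submodule.span R {x | ∃ (j : J) (g : N) (w : V), x = grp R g • e j w}
  range_finite : ∀ j, Module.Finite R (LinearMap.range (e j))
  range_projective : ∀ j, Module.Projective R (LinearMap.range (e j))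

namespace InducedFromFinite

variable {J : Type} {S : J → Subgroup N} {e : J → V →ₗ[R] V}

/-- The decomposition of an element into its components in the translates of the summands. -/
lemma exists_sum (H : InducedFromFinite S e) (v : V) :
    ∃ c : Finset ((j : J) × (N ⧸ S j)),
      v = ∑ t ∈ c, grp R t.2.out • e t.1 (grp R t.2.out⁻¹ • v) := by
  classical
  suffices h : ∃ c : Finset ((j : J) × (N ⧸ S j)), ∀ c', c ⊆ c' →
      v = ∑ t ∈ c', grp R t.2.out • e t.1 (grp R t.2.out⁻¹ • v) from
    ⟨h.choose, h.choose_spec _ subset_rfl⟩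
  induction H.span v using Submodule.span_induction with
  | mem x hx =>
    obtain ⟨j, g, w, rfl⟩ := hx
    refine ⟨{⟨j, (g : N ⧸ S j)⟩}, fun c' hc' => ?_⟩
    rw [Finset.sum_eq_single_of_mem ⟨j, (g : N ⧸ S j)⟩ (hc' (Finset.mem_singleton_self _))]
    · obtain ⟨s, hs⟩ := QuotientGroup.mk_out_eq_mul (S j) g
      dsimp only
      rw [hs, grp_smul_smul, mul_inv_rev, inv_mul_cancel_right,
        H.equivariant j _ (inv_mem s.2), H.idem, grp_smul_smul, mul_inv_cancel_right]
    · rintro ⟨i, t⟩ - hne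
      dsimp only
      rw [grp_smul_smul, H.ortho, smul_zero]
      rintro rfl hmem
      refine hne ?_
      rw [← QuotientGroup.out_eq' t, QuotientGroup.eq.2 hmem]
  | zero => exact ⟨∅, fun c' _ => by simp⟩
  | add x y _ _ hx hy =>
    obtain ⟨c, hc⟩ := hx
    obtain ⟨d, hd⟩ := hy
    refine ⟨c ∪ d, fun c' hc' => ?_⟩
    simp only [smul_add, map_add, Finset.sum_add_distrib]
    rw [← hc c' (Finset.union_subset_left hc'), ← hd c' (Finset.union_subset_right hc')]
  | smul r x _ hx =>
    obtain ⟨c, hc⟩ := hx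
    refine ⟨c, fun c' hc' => ?_⟩
    have : ∀ t : (j : J) × (N ⧸ S j), grp R t.2.out • e t.1 (grp R t.2.out⁻¹ • r • x) =
        r • grp R t.2.out • e t.1 (grp R t.2.out⁻¹ • x) := fun t => by
      rw [smul_comm _ r, map_smul, smul_comm _ r]
    simp only [this]
    rw [← Finset.smul_sum, ← hc c' hc']

open Classical in
/-- The projection of the group algebra onto the span of a subset of the group. -/
def restrictTo (R : Type u) [CommRing R] (T : Set N) : MonoidAlgebra R N →ₗ[R] MonoidAlgebra R N :=
  (MonoidAlgebra.basis N R).constr R fun g => if g ∈ T then grp R g else 0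

open Classical in
lemma restrictTo_grp (T : Set N) (g : N) :
    restrictTo R T (grp R g) = if g ∈ T then grp R g else 0 := by
  have h := (MonoidAlgebra.basis N R).constr_basis R (fun g => if g ∈ T then grp R g else 0) g
  rwa [MonoidAlgebra.basis_apply] at h

lemma restrictTo_mem (T : Set N) (x : MonoidAlgebra R N) :
    restrictTo R T x ∈ Submodule.span R (grp R '' T) := by
  classical
  suffices h : LinearMap.range (restrictTo R T) ≤ Submodule.span R (grp R '' T) from h ⟨x, rfl⟩
  rw [restrictTo, Module.Basis.constr_range, Submodule.span_le]
  rintro _ ⟨g, rfl⟩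
  by_cases hg : g ∈ T
  · simp only [hg, if_true]
    exact Submodule.subset_span ⟨g, hg, rfl⟩
  · simp only [hg, if_false]
    exact zero_mem _

lemma restrictTo_idem (T : Set N) (x : MonoidAlgebra R N) :
    restrictTo R T (restrictTo R T x) = restrictTo R T x := by
  classical
  rw [← LinearMap.comp_apply]
  congr 1
  refine (MonoidAlgebra.basis N R).ext fun g => ?_
  rw [LinearMap.comp_apply, MonoidAlgebra.basis_apply, restrictTo_grp]
  split_ifs with h
  · rw [restrictTo_grp, if_pos h]
  · rw [map_zero]

lemma restrictTo_grp_mul (S : Subgroup N) {s : N} (hs : s ∈ S) (x : MonoidAlgebra R N) :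
    restrictTo R S (grp R s * x) = grp R s * restrictTo R S x := by
  classical
  suffices h : restrictTo R S ∘ₗ LinearMap.mulLeft R (grp R s) =
      LinearMap.mulLeft R (grp R s) ∘ₗ restrictTo R S from LinearMap.congr_fun h x
  refine (MonoidAlgebra.basis N R).ext fun g => ?_
  rw [LinearMap.comp_apply, LinearMap.comp_apply, MonoidAlgebra.basis_apply,
    LinearMap.mulLeft_apply, ← grp_mul, restrictTo_grp, restrictTo_grp, LinearMap.mulLeft_apply]
  simp only [SetLike.mem_coe, Subgroup.mul_mem_cancel_left S hs]
  split_ifs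
  · exact grp_mul _ _
  · rw [mul_zero]

lemma restrictTo_ortho (S : Subgroup N) {g : N} (hg : g ∉ S) (x : MonoidAlgebra R N) :
    restrictTo R S (grp R g * restrictTo R S x) = 0 := by
  classical
  suffices h : restrictTo R S ∘ₗ LinearMap.mulLeft R (grp R g) ∘ₗ restrictTo R S = 0 from
    LinearMap.congr_fun h x
  refine (MonoidAlgebra.basis N R).ext fun h => ?_
  rw [LinearMap.comp_apply, LinearMap.comp_apply, MonoidAlgebra.basis_apply, restrictTo_grp,
    LinearMap.zero_apply]
  split_ifs with hh
  · rw [LinearMap.mulLeft_apply, ← grp_mul, restrictTo_grp, if_neg]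
    exact fun h' => hg ((Subgroup.mul_mem_cancel_right S hh).1 h')
  · rw [map_zero, map_zero]

variable {I : Type} (c : I → J)

open Classical in
/-- The projections of a finitely generated free module over the group algebra, whose basis is
indexed over `J`. -/
def freeProj (R : Type u) [CommRing R] (S : J → Subgroup N) (c : I → J) (j : J) :
    (I → MonoidAlgebra R N) →ₗ[R] (I → MonoidAlgebra R N) :=
  LinearMap.pi fun i => if c i = j then restrictTo R (S j) ∘ₗ LinearMap.proj i else 0

open Classical in
lemma freeProj_apply (j : J) (w : I → MonoidAlgebra R N) (i : I) :
    freeProj R S c j w i = if c i = j then restrictTo R (S j) (w i) else 0 := by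
  simp only [freeProj, LinearMap.pi_apply]
  split_ifs <;> rfl

lemma freeProj_idem (j : J) (w : I → MonoidAlgebra R N) :
    freeProj R S c j (freeProj R S c j w) = freeProj R S c j w := by
  funext i
  simp only [freeProj_apply]
  split_ifs with h
  · exact restrictTo_idem _ _
  · rfl

lemma span_grp_smul_single [Finite I] [DecidableEq I] :
    Submodule.span R {x : I → MonoidAlgebra R N | ∃ (i : I) (g : N),
      x = grp R g • (Pi.single i 1 : I → MonoidAlgebra R N)} = ⊤ := by
  rw [eq_top_iff]
  rintro w -
  have := Fintype.ofFinite I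
  rw [← Finset.univ_sum_single w]
  refine sum_mem fun i _ => ?_
  suffices h : LinearMap.range (LinearMap.single R (fun _ => MonoidAlgebra R N) i) ≤ _ from
    h ⟨w i, rfl⟩
  rw [LinearMap.range_eq_map, ← (MonoidAlgebra.basis N R).span_eq, Submodule.map_span,
    Submodule.span_le]
  rintro _ ⟨_, ⟨g, rfl⟩, rfl⟩
  refine Submodule.subset_span ⟨i, g, ?_⟩
  rw [MonoidAlgebra.basis_apply, LinearMap.single_apply, ← Pi.single_smul, smul_eq_mul, mul_one]

lemma freeProj_single [DecidableEq I] (i : I) :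
    freeProj R S c (c i) (Pi.single i 1) = Pi.single i (1 : MonoidAlgebra R N) := by
  classical
  funext i'
  rw [freeProj_apply]
  by_cases h : i' = i
  · subst h
    rw [if_pos rfl, Pi.single_eq_same, ← grp_one, restrictTo_grp, if_pos]
    exact one_mem (S (c i'))
  · rw [Pi.single_eq_of_ne h, map_zero, ite_self]

lemma free [Finite I] (hS : ∀ j, Finite (S j)) :
    InducedFromFinite S (freeProj R S c) where
  finite := hS
  idem j v := freeProj_idem c j v
  equivariant j s hs v := by
    funext i
    simp only [freeProj_apply, Pi.smul_apply, smul_eq_mul]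
    split_ifs with h
    · exact restrictTo_grp_mul _ hs _
    · rw [mul_zero]
  ortho j i g v hg := by
    funext l
    simp only [freeProj_apply, Pi.smul_apply, smul_eq_mul, Pi.zero_apply]
    split_ifs with h h'
    · obtain rfl : i = j := h.symm.trans h'
      exact restrictTo_ortho _ (hg rfl) _
    · rw [mul_zero, map_zero]
    · rfl
  span v := by
    classical
    have hv : v ∈ (⊤ : Submodule R (I → MonoidAlgebra R N)) := trivial
    rw [← span_grp_smul_single] at hv
    refine Submodule.span_mono ?_ hv
    rintro _ ⟨i, g, rfl⟩
    exact ⟨c i, g, Pi.single i 1, by rw [freeProj_single]⟩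
  range_finite j := by
    classical
    have := hS j
    have hfin : (⋃ i : I, (LinearMap.single R (fun _ => MonoidAlgebra R N) i) ''
        (grp R '' (S j : Set N))).Finite :=
      Set.finite_iUnion fun i => ((Set.toFinite _).image _).image _
    have := Fintype.ofFinite I
    have hle : LinearMap.range (freeProj R S c j) ≤ Submodule.span R
        (⋃ i : I, (LinearMap.single R (fun _ => MonoidAlgebra R N) i) ''
          (grp R '' (S j : Set N))) := by
      rintro _ ⟨w, rfl⟩
      rw [← Finset.univ_sum_single (freeProj R S c j w)]
      refine sum_mem fun i _ => ?_
      refine Submodule.span_mono (Set.subset_iUnion _ i) ?_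
      rw [← Submodule.map_span]
      refine ⟨freeProj R S c j w i, ?_, rfl⟩
      rw [freeProj_apply]
      split_ifs
      · exact restrictTo_mem _ _
      · exact zero_mem _
    have : Module.Finite R (Submodule.span R (⋃ i : I,
        (LinearMap.single R (fun _ => MonoidAlgebra R N) i) '' (grp R '' (S j : Set N)))) :=
      Module.Finite.span_of_finite R hfin
    refine Module.Finite.of_surjective ((freeProj R S c j).rangeRestrict ∘ₗ
      (Submodule.span R (⋃ i : I, (LinearMap.single R (fun _ => MonoidAlgebra R N) i) ''
        (grp R '' (S j : Set N)))).subtype) ?_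
    rintro ⟨_, w, rfl⟩
    exact ⟨⟨_, hle ⟨w, rfl⟩⟩, Subtype.ext (freeProj_idem c j w)⟩
  range_projective j := by
    have : Module.Projective R (MonoidAlgebra R N) :=
      Module.Projective.of_basis (MonoidAlgebra.basis N R)
    have := Fintype.ofFinite I
    have : Module.Projective R (I → MonoidAlgebra R N) := inferInstance
    refine Module.Projective.of_split (LinearMap.range (freeProj R S c j)).subtype
      (freeProj R S c j).rangeRestrict ?_
    refine LinearMap.ext fun y => Subtype.ext ?_
    obtain ⟨_, w, rfl⟩ := y
    exact freeProj_idem c j w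

/-- A module induced from finite subgroups, with modules that are finitely generated projective over
`R`, has type `FP_n` for all `n`: generators of the summands give a cover by a finitely generated
free module that respects the projections, so the kernel is a module of the same kind. -/
lemma moduleFP [Finite J] (n : ℕ) : ∀ {V : Type u} [AddCommGroup V] [Module R V]
    [Module (MonoidAlgebra R N) V] [IsScalarTower R (MonoidAlgebra R N) V]
    {e : J → V →ₗ[R] V}, InducedFromFinite S e → ModuleFP (MonoidAlgebra R N) n V := by
  classical
  suffices key : ∀ {V : Type u} [AddCommGroup V] [Module R V]
    [Module (MonoidAlgebra R N) V] [IsScalarTower R (MonoidAlgebra R N) V]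
    {e : J → V →ₗ[R] V}, InducedFromFinite S e → ∃ (I : Type) (_ : Finite I)
      (f : (I → MonoidAlgebra R N) →ₗ[MonoidAlgebra R N] V) (_ : Function.Surjective f)
      (e' : J → LinearMap.ker f →ₗ[R] LinearMap.ker f), InducedFromFinite S e' by
    induction n with
    | zero =>
      intro V _ _ _ _ e H
      obtain ⟨I, _, f, hf, -⟩ := key H
      exact Module.Finite.of_surjective f hf
    | succ n ih =>
      intro V _ _ _ _ e H
      obtain ⟨I, _, f, hf, e', H'⟩ := key H
      exact ModuleFP.succ_of_finite f hf (ih H')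
  intro V _ _ _ _ e H
  have hgen : ∀ j, ∃ (k : ℕ) (v : Fin k → V), Submodule.span R (Set.range v) =
      LinearMap.range (e j) := fun j => by
    have := H.range_finite j
    exact Submodule.fg_iff_exists_fin_generating_family.1
      (Module.Finite.iff_fg.1 (H.range_finite j))
  choose k v hv using hgen
  let I := (j : J) × Fin (k j)
  let c : I → J := Sigma.fst
  let w : I → V := fun i => v i.1 i.2
  have := Fintype.ofFinite I
  have hw : ∀ i, e (c i) (w i) = w i := fun i => by
    have : w i ∈ LinearMap.range (e (c i)) := by
      rw [← hv]
      exact Submodule.subset_span ⟨i.2, rfl⟩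
    obtain ⟨x, hx⟩ := this
    rw [← hx, H.idem]
  let f : (I → MonoidAlgebra R N) →ₗ[MonoidAlgebra R N] V :=
    Fintype.linearCombination (MonoidAlgebra R N) w
  have hf1 : ∀ i, f (Pi.single i 1) = w i := fun i => by
    simp [f, Fintype.linearCombination_apply_single]
  have hf : Function.Surjective f := by
    rw [← LinearMap.range_eq_top, eq_top_iff]
    rintro x -
    have hle : Submodule.span R {x | ∃ (j : J) (g : N) (w : V), x = grp R g • e j w} ≤
        (LinearMap.range f).restrictScalars R := by
      rw [Submodule.span_le]
      rintro _ ⟨j, g, y, rfl⟩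
      refine Submodule.smul_mem (LinearMap.range f) _ ?_
      have : e j y ∈ Submodule.span R (Set.range (v j)) := by
        rw [hv]
        exact ⟨y, rfl⟩
      have hle : Submodule.span R (Set.range (v j)) ≤ (LinearMap.range f).restrictScalars R := by
        rw [Submodule.span_le]
        rintro _ ⟨l, rfl⟩
        exact ⟨_, hf1 ⟨j, l⟩⟩
      exact hle this
    exact hle (H.span x)
  have F := free (R := R) (S := S) c H.finite
  have hcomm : ∀ j x, f (freeProj R S c j x) = e j (f x) := fun j x => by
    suffices h : (f.restrictScalars R) ∘ₗ freeProj R S c j = e j ∘ₗ f.restrictScalars R from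
      LinearMap.congr_fun h x
    refine LinearMap.ext_on span_grp_smul_single ?_
    rintro _ ⟨i, g, rfl⟩
    have hfi : f (grp R g • Pi.single i 1) = grp R g • w i := by rw [map_smul, hf1]
    simp only [LinearMap.comp_apply, LinearMap.restrictScalars_apply]
    rw [hfi]
    by_cases h : c i = j ∧ g ∈ S j
    · obtain ⟨rfl, hg⟩ := h
      rw [F.equivariant _ _ hg, H.equivariant _ _ hg, freeProj_single, hfi, hw]
    · have h' : j = c i → g ∉ S (c i) := by
        rintro rfl hg
        exact h ⟨rfl, hg⟩
      rw [← freeProj_single (R := R) (S := S) c i, F.ortho _ _ _ _ h', map_zero, ← hw i,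
        H.ortho _ _ _ _ h']
  let e' : J → LinearMap.ker f →ₗ[R] LinearMap.ker f := fun j =>
    (freeProj R S c j).restrict (p := (LinearMap.ker f).restrictScalars R)
      (q := (LinearMap.ker f).restrictScalars R) fun x hx => by
        have hx : f x = 0 := hx
        change f _ = 0
        rw [hcomm, hx, map_zero]
  have he' : ∀ j x, (e' j x : I → MonoidAlgebra R N) = freeProj R S c j x := fun j x => rfl
  -- The range of `e' j` is a retract of the range of the projection of the free module.
  have hretract : ∀ j, ∃ (i : LinearMap.range (e' j) →ₗ[R] LinearMap.range (freeProj R S c j))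
      (r : LinearMap.range (freeProj R S c j) →ₗ[R] LinearMap.range (e' j)),
      r ∘ₗ i = LinearMap.id := by
    intro j
    let q : LinearMap.range (freeProj R S c j) →ₗ[R] LinearMap.range (e j) :=
      (f.restrictScalars R).restrict fun x hx => by
        obtain ⟨x, rfl⟩ := hx
        exact ⟨f x, (hcomm j x).symm⟩
    have hq : Function.Surjective q := by
      rintro ⟨_, x, rfl⟩
      obtain ⟨y, rfl⟩ := hf x
      exact ⟨⟨_, y, rfl⟩, Subtype.ext (hcomm j y)⟩
    have := H.range_projective j
    obtain ⟨s, hs⟩ := Module.projective_lifting_property q LinearMap.id hq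
    have hs : ∀ y, q (s y) = y := fun y => LinearMap.congr_fun hs y
    have hfix : ∀ x ∈ LinearMap.range (freeProj R S c j), freeProj R S c j x = x := by
      rintro _ ⟨x, rfl⟩
      exact F.idem j x
    let i : LinearMap.range (e' j) →ₗ[R] LinearMap.range (freeProj R S c j) :=
      ((LinearMap.ker f).restrictScalars R).subtype.restrict fun x hx => by
        obtain ⟨x, rfl⟩ := hx
        exact ⟨x, rfl⟩
    let d : LinearMap.range (freeProj R S c j) →ₗ[R] LinearMap.range (freeProj R S c j) :=
      LinearMap.id - s ∘ₗ q
    have hd : ∀ x, f (d x) = 0 := fun x => by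
      have : q (d x) = 0 := by simp [d, hs]
      exact Subtype.ext_iff.1 this
    let r : LinearMap.range (freeProj R S c j) →ₗ[R] LinearMap.range (e' j) :=
      { toFun := fun x => ⟨⟨d x, hd x⟩, ⟨d x, hd x⟩, Subtype.ext (hfix _ (d x).2)⟩
        map_add' := fun x y => Subtype.ext (Subtype.ext (by simp))
        map_smul' := fun a x => Subtype.ext (Subtype.ext (by simp)) }
    refine ⟨i, r, LinearMap.ext fun x => Subtype.ext (Subtype.ext ?_)⟩
    have hx : q (i x) = 0 := Subtype.ext x.1.2
    change ((d (i x) : LinearMap.range (freeProj R S c j)) : I → MonoidAlgebra R N) = x.1.1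
    simp only [d, LinearMap.sub_apply, LinearMap.comp_apply, hx, map_zero, sub_zero]
    rfl
  refine ⟨I, inferInstance, f, hf, e', ⟨H.finite, ?_, ?_, ?_, ?_, ?_, ?_⟩⟩
  · exact fun j x => Subtype.ext (F.idem j x)
  · exact fun j s hs x => Subtype.ext (F.equivariant j s hs x)
  · exact fun j i g x h => Subtype.ext (F.ortho j i g x h)
  · intro x
    obtain ⟨t, ht⟩ := F.exists_sum x.1
    have : x = ∑ a ∈ t, grp R a.2.out • e' a.1 (grp R a.2.out⁻¹ • x) := by
      refine Subtype.ext ?_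
      rw [AddSubmonoidClass.coe_finsetSum]
      exact ht
    rw [this]
    exact sum_mem fun a _ => Submodule.subset_span ⟨a.1, _, _, rfl⟩
  · intro j
    obtain ⟨i, r, h⟩ := hretract j
    have := F.range_finite j
    exact Module.Finite.of_surjective r fun x => ⟨i x, LinearMap.congr_fun h x⟩
  · intro j
    obtain ⟨i, r, h⟩ := hretract j
    have := F.range_projective j
    exact Module.Projective.of_split i r h

end InducedFromFinite

/-- A permutation module with finitely many orbits and finite stabilisers has type `FP_n` for
all `n`. -/
lemma moduleFP_of_permutation {X : Type u} [MulAction N X] (b : Module.Basis X R V)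
    (hb : ∀ (g : N) (x : X), grp R g • b x = b (g • x))
    (hfin : Finite (MulAction.orbitRel.Quotient N X))
    (hstab : ∀ x : X, Finite (MulAction.stabilizer N x)) (n : ℕ) :
    ModuleFP (MonoidAlgebra R N) n V := by
  classical
  obtain ⟨k, ⟨ε⟩⟩ := Finite.exists_equiv_fin (MulAction.orbitRel.Quotient N X)
  let x : Fin k → X := fun j => (ε.symm j).out
  have hx : ∀ i j g, g • x j = x i → i = j := fun i j g h => by
    apply ε.symm.injective
    rw [← Quotient.out_eq (ε.symm i), ← Quotient.out_eq (ε.symm j)]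
    exact Quotient.sound ⟨g, h⟩
  let e : Fin k → V →ₗ[R] V := fun j => b.constr R fun y => if y = x j then b y else 0
  have he : ∀ j y, e j (b y) = if y = x j then b y else 0 := fun j y => b.constr_basis R _ _
  have hrange : ∀ j, LinearMap.range (e j) = Submodule.span R {b (x j)} := fun j => by
    rw [Module.Basis.constr_range]
    refine le_antisymm (Submodule.span_le.2 ?_) (Submodule.span_le.2 ?_)
    · rintro _ ⟨y, rfl⟩
      by_cases h : y = x j
      · simp [h]
      · simp [h]
    · rintro _ rfl
      exact Submodule.subset_span ⟨x j, by simp⟩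
  have hcoord : ∀ j v, e j v = b.coord (x j) v • b (x j) := fun j v => by
    suffices h : e j = (b.coord (x j)).smulRight (b (x j)) from LinearMap.congr_fun h v
    refine b.ext fun y => ?_
    rw [he, LinearMap.smulRight_apply, Module.Basis.coord_apply, Module.Basis.repr_self,
      Finsupp.single_apply]
    split_ifs with h
    · rw [one_smul, h]
    · rw [zero_smul]
  have hcomm : ∀ (g : N) (r : R) (v : V), grp R g • r • v = r • grp R g • v :=
    fun g r v => smul_comm _ _ _
  refine InducedFromFinite.moduleFP (S := fun j => MulAction.stabilizer N (x j)) (e := e) n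
    ⟨fun j => hstab _, ?_, ?_, ?_, ?_, ?_, ?_⟩
  · intro j v
    rw [hcoord j v, map_smul, he, if_pos rfl]
  · intro j s hs v
    suffices h : e j ∘ₗ Algebra.lsmul R R V (grp R s) = Algebra.lsmul R R V (grp R s) ∘ₗ e j from
      LinearMap.congr_fun h v
    refine b.ext fun y => ?_
    have hs : s • x j = x j := hs
    simp only [LinearMap.comp_apply, Algebra.lsmul_coe, hb, he]
    by_cases h : y = x j
    · rw [if_pos h, h, hs, if_pos rfl, hb, hs]
    · rw [if_neg h, smul_zero, if_neg]
      intro h'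
      exact h (MulAction.injective s (h'.trans hs.symm))
  · intro j i g v h
    rw [hcoord j v, hcomm, map_smul, hb, he, if_neg, smul_zero]
    intro h'
    obtain rfl := hx i j g h'
    exact h rfl h'
  · intro v
    refine Submodule.span_mono ?_ (b.mem_span v)
    rintro _ ⟨y, rfl⟩
    obtain ⟨g, hg⟩ := Quotient.mk_out (s := MulAction.orbitRel N X) y
    refine ⟨ε ⟦y⟧, g⁻¹, b (x (ε ⟦y⟧)), ?_⟩
    have hg : g • y = x (ε ⟦y⟧) := by
      simp only [x, Equiv.symm_apply_apply]
      exact hg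
    rw [he, if_pos rfl, hb, ← hg, inv_smul_smul]
  · intro j
    rw [hrange]
    exact Module.Finite.span_singleton R _
  · intro j
    have : Module.Projective R V := Module.Projective.of_basis b
    refine Module.Projective.of_split (LinearMap.range (e j)).subtype (e j).rangeRestrict ?_
    refine LinearMap.ext fun y => Subtype.ext ?_
    obtain ⟨_, v, rfl⟩ := y
    change e j (e j v) = e j v
    rw [hcoord j v, map_smul, he, if_pos rfl]

end Induced

/-! ### Modules over a preadditive category, elementwise -/

namespace CatModule

variable {R : Type u} [CommRing R] {C : Type u} [Category.{u} C] [Preadditive C]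

/-- The value of a module at an object. -/
abbrev val (M : CatModule R C) (x : C) : Type u := M.obj.obj (op x)

/-- The action of a morphism of the category on the values of a module. -/
def act (M : CatModule R C) {x y : C} (f : x ⟶ y) : M.val y →ₗ[R] M.val x :=
  (M.obj.map f.op).hom

/-- The components of a homomorphism of modules. -/
def app {M N : CatModule R C} (φ : M ⟶ N) (x : C) : M.val x →ₗ[R] N.val x :=
  (φ.hom.app (op x)).hom

section Basic

variable (M : CatModule R C) {N : CatModule R C} {x y z : C}

lemma act_id (m : M.val x) : M.act (𝟙 x) m = m := by
  change (M.obj.map (𝟙 (op x))).hom m = m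
  rw [M.obj.map_id]
  rfl

lemma act_comp (f : x ⟶ y) (g : y ⟶ z) (m : M.val z) :
    M.act (f ≫ g) m = M.act f (M.act g m) := by
  change (M.obj.map (g.op ≫ f.op)).hom m = _
  rw [M.obj.map_comp]
  rfl

lemma act_add (f g : x ⟶ y) : M.act (f + g) = M.act f + M.act g := by
  change (M.obj.map (f.op + g.op)).hom = _
  rw [M.obj.map_add]
  rfl

lemma act_zero : M.act (0 : x ⟶ y) = 0 := by
  have h := M.act_add (0 : x ⟶ y) 0
  rw [add_zero] at h
  exact left_eq_add.1 h

/-- The action as an additive map on the group of morphisms. -/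
def actHom (x y : C) : (x ⟶ y) →+ (M.val y →ₗ[R] M.val x) where
  toFun := M.act
  map_zero' := M.act_zero
  map_add' := M.act_add

lemma act_zsmul (r : ℤ) (f : x ⟶ y) : M.act (r • f) = r • M.act f :=
  map_zsmul (M.actHom x y) r f

variable {M}

lemma app_act (φ : M ⟶ N) (f : x ⟶ y) (m : M.val y) :
    app φ x (M.act f m) = N.act f (app φ y m) :=
  LinearMap.congr_fun (congrArg ModuleCat.Hom.hom (φ.hom.naturality f.op)) m

lemma app_comp {K : CatModule R C} (φ : M ⟶ N) (ψ : N ⟶ K) (m : M.val x) :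
    app (φ ≫ ψ) x m = app ψ x (app φ x m) := rfl

lemma app_id (m : M.val x) : app (𝟙 M) x m = m := rfl

lemma app_zero (m : M.val x) : app (0 : M ⟶ N) x m = 0 := rfl

lemma app_add (φ ψ : M ⟶ N) (m : M.val x) : app (φ + ψ) x m = app φ x m + app ψ x m := rfl

lemma hom_ext {φ ψ : M ⟶ N} (h : ∀ x m, app φ x m = app ψ x m) : φ = ψ := by
  refine ObjectProperty.hom_ext _ (NatTrans.ext (funext fun x => ModuleCat.hom_ext ?_))
  exact LinearMap.ext (h x.unop)

/-- A homomorphism of modules from its components. -/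
def homOf (f : ∀ x, M.val x →ₗ[R] N.val x)
    (hf : ∀ {x y : C} (g : x ⟶ y) m, f x (M.act g m) = N.act g (f y m)) : M ⟶ N :=
  ObjectProperty.homMk
    { app := fun x => ModuleCat.ofHom (f x.unop)
      naturality := fun _ _ g => ModuleCat.hom_ext (LinearMap.ext (hf g.unop)) }

end Basic

/-- A module from its values and the action of morphisms. -/
def ofData (V : C → Type u) [∀ x, AddCommGroup (V x)] [∀ x, Module R (V x)]
    (a : ∀ {x y : C}, (x ⟶ y) → V y →ₗ[R] V x) (hid : ∀ x m, a (𝟙 x) m = m)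
    (hcomp : ∀ {x y z : C} (f : x ⟶ y) (g : y ⟶ z) m, a (f ≫ g) m = a f (a g m))
    (hadd : ∀ {x y : C} (f g : x ⟶ y) m, a (f + g) m = a f m + a g m) : CatModule R C where
  obj :=
    { obj := fun x => ModuleCat.of R (V x.unop)
      map := fun f => ModuleCat.ofHom (a f.unop)
      map_id := fun x => ModuleCat.hom_ext (LinearMap.ext (hid x.unop))
      map_comp := fun f g => ModuleCat.hom_ext (LinearMap.ext (hcomp g.unop f.unop)) }
  property := ⟨fun {_ _ f g} => ModuleCat.hom_ext (LinearMap.ext (hadd f.unop g.unop))⟩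

/-! ### Submodules, quotients and direct sums -/

section Sub

variable (M : CatModule R C) (S : ∀ x, Submodule R (M.val x))
  (hS : ∀ {x y : C} (f : x ⟶ y), ∀ m ∈ S y, M.act f m ∈ S x)

/-- The submodule with given values. -/
def sub : CatModule R C :=
  ofData (fun x => S x) (fun f => (M.act f).restrict (hS f))
    (fun _ m => Subtype.ext (M.act_id m.1)) (fun f g m => Subtype.ext (M.act_comp f g m.1))
    (fun f g m => Subtype.ext (LinearMap.congr_fun (M.act_add f g) m.1))

/-- The quotient by the submodule with given values. -/
def quot : CatModule R C :=
  ofData (fun x => M.val x ⧸ S x) (fun f => (S _).mapQ (S _) (M.act f) (hS f))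
    (fun x m => by
      obtain ⟨m, rfl⟩ := (S x).mkQ_surjective m
      exact congrArg _ (M.act_id m))
    (fun {_ _ z} f g m => by
      obtain ⟨m, rfl⟩ := (S z).mkQ_surjective m
      exact congrArg _ (M.act_comp f g m))
    (fun {_ y} f g m => by
      obtain ⟨m, rfl⟩ := (S y).mkQ_surjective m
      exact congrArg _ (LinearMap.congr_fun (M.act_add f g) m))

/-- The projection to a quotient module. -/
def quotMk : M ⟶ quot M S hS :=
  homOf (fun x => (S x).mkQ) fun _ _ => rfl

lemma quotMk_eq_zero_iff {x : C} (m : M.val x) : app (quotMk M S hS) x m = 0 ↔ m ∈ S x :=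
  Submodule.Quotient.mk_eq_zero _

end Sub

section Kernel

variable {M N : CatModule R C} (φ : M ⟶ N)

/-- The kernel of a homomorphism of modules. -/
def ker : CatModule R C :=
  sub M (fun x => LinearMap.ker (app φ x)) fun f m hm => by
    rw [LinearMap.mem_ker, app_act, LinearMap.mem_ker.1 hm, map_zero]

/-- The inclusion of the kernel. -/
def kerIncl : ker φ ⟶ M :=
  homOf (fun x => (LinearMap.ker (app φ x)).subtype) fun _ _ => rfl

lemma kerIncl_injective (x : C) : Function.Injective (app (kerIncl φ) x) :=
  Subtype.val_injective

lemma app_kerIncl {x : C} (m : (ker φ).val x) : app φ x (app (kerIncl φ) x m) = 0 :=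
  LinearMap.mem_ker.1 m.2

lemma exists_kerIncl {x : C} (m : M.val x) (hm : app φ x m = 0) :
    ∃ k, app (kerIncl φ) x k = m := ⟨⟨m, hm⟩, rfl⟩

/-- The factorisation through the kernel. -/
def kerLift {K : CatModule R C} (ψ : K ⟶ M) (h : ∀ x m, app φ x (app ψ x m) = 0) : K ⟶ ker φ :=
  homOf (fun x => (app ψ x).codRestrict _ (h x)) fun f m => Subtype.ext (app_act ψ f m)

lemma epi_of_surjective (h : ∀ x, Function.Surjective (app φ x)) : Epi φ where
  left_cancellation f g hfg := hom_ext fun x n => by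
    obtain ⟨m, rfl⟩ := h x n
    rw [← app_comp, hfg, app_comp]

/-- Epimorphisms are surjective, since the quotient by the image is again a module. -/
lemma surjective_of_epi [Epi φ] (x : C) : Function.Surjective (app φ x) := by
  let S : ∀ x, Submodule R (N.val x) := fun x => LinearMap.range (app φ x)
  have hS : ∀ {x y : C} (f : x ⟶ y), ∀ m ∈ S y, N.act f m ∈ S x := by
    rintro x y f _ ⟨m, rfl⟩
    exact ⟨M.act f m, app_act φ f m⟩
  have h : quotMk N S hS = 0 := by
    rw [← cancel_epi φ]
    refine hom_ext fun x m => ?_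
    rw [comp_zero, app_zero, app_comp, quotMk_eq_zero_iff]
    exact ⟨m, rfl⟩
  intro n
  have hn : app (quotMk N S hS) x n = 0 := by rw [h, app_zero]
  exact (quotMk_eq_zero_iff N S hS n).1 hn

end Kernel

section DirectSum

variable {I : Type u} (M : I → CatModule R C)

open DirectSum in
/-- The direct sum of modules. -/
def directSum : CatModule R C :=
  ofData (fun x => ⨁ i, (M i).val x)
    (fun f => DFinsupp.mapRange.linearMap fun i => (M i).act f)
    (fun _ _ => DFinsupp.ext fun i => (M i).act_id _)
    (fun f g _ => DFinsupp.ext fun i => (M i).act_comp f g _)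
    (fun f g _ => DFinsupp.ext fun i => LinearMap.congr_fun ((M i).act_add f g) _)

open Classical in
/-- The inclusion of a summand. -/
def directSumIncl (i : I) : M i ⟶ directSum M :=
  homOf (fun x => DirectSum.lof R I (fun i => (M i).val x) i) fun f _ =>
    (DFinsupp.mapRange_single (f := fun i => (M i).act f) (hf := fun _ => map_zero _)).symm

/-- The projection to a summand. -/
def directSumProj (i : I) : directSum M ⟶ M i :=
  homOf (fun x => DirectSum.component R I (fun i => (M i).val x) i) fun _ _ => rfl

variable {M}

open Classical in
/-- A linear map from a value of the direct sum, given by linear maps on the summands. -/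
def directSumElim {x : C} {V : Type u} [AddCommGroup V] [Module R V]
    (f : ∀ i, (M i).val x →ₗ[R] V) : (directSum M).val x →ₗ[R] V :=
  DirectSum.toModule R I V f

lemma directSumElim_incl {x : C} {V : Type u} [AddCommGroup V] [Module R V]
    (f : ∀ i, (M i).val x →ₗ[R] V) (i : I) (m : (M i).val x) :
    directSumElim f (app (directSumIncl M i) x m) = f i m := by
  classical
  exact DirectSum.toModule_lof (M := fun i => (M i).val x) (φ := f) R i m

lemma directSum_linearMap_ext {x : C} {V : Type u} [AddCommGroup V] [Module R V]
    {f g : (directSum M).val x →ₗ[R] V}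
    (h : ∀ i m, f (app (directSumIncl M i) x m) = g (app (directSumIncl M i) x m)) : f = g := by
  classical
  exact DirectSum.linearMap_ext R fun i => LinearMap.ext (h i)

/-- The homomorphism from a direct sum given by homomorphisms on the summands. -/
def directSumDesc {N : CatModule R C} (φ : ∀ i, M i ⟶ N) : directSum M ⟶ N :=
  homOf (fun x => directSumElim fun i => app (φ i) x) fun {x y} f m => by
    suffices h : (directSumElim fun i => app (φ i) x) ∘ₗ (directSum M).act f =
        N.act f ∘ₗ directSumElim fun i => app (φ i) y from LinearMap.congr_fun h m
    refine directSum_linearMap_ext fun i m => ?_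
    rw [LinearMap.comp_apply, LinearMap.comp_apply, ← app_act, directSumElim_incl,
      directSumElim_incl, app_act]

lemma incl_directSumDesc {N : CatModule R C} (φ : ∀ i, M i ⟶ N) (i : I) :
    directSumIncl M i ≫ directSumDesc φ = φ i :=
  hom_ext fun x m => directSumElim_incl (fun i => app (φ i) x) i m

lemma sum_proj_incl [Fintype I] : ∑ i, directSumProj M i ≫ directSumIncl M i = 𝟙 _ := by
  classical
  refine hom_ext fun x m => ?_
  have h : ∀ s : Finset I, app (∑ i ∈ s, directSumProj M i ≫ directSumIncl M i) x m =
      ∑ i ∈ s, app (directSumProj M i ≫ directSumIncl M i) x m := fun s => by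
    induction s using Finset.induction_on with
    | empty => exact app_zero m
    | insert i s hi ih => rw [Finset.sum_insert hi, Finset.sum_insert hi, app_add, ih]
  rw [h]
  exact DirectSum.sum_univ_of m

end DirectSum

/-! ### Free modules and finite generation -/

section Free

variable (R)

/-- The free module `R[-, x]`, as an additive functor. -/
def freeModule (x : C) : CatModule R C where
  obj := freeFunctor R x
  property := ⟨fun {y z f g} => by
    have h : (Preadditive.leftComp x (f + g).unop).toIntLinearMap =
        (Preadditive.leftComp x f.unop).toIntLinearMap +
          (Preadditive.leftComp x g.unop).toIntLinearMap :=
      LinearMap.ext fun φ => Preadditive.add_comp _ _ _ f.unop g.unop φ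
    refine ModuleCat.hom_ext ?_
    change LinearMap.baseChange R (Preadditive.leftComp x (f + g).unop).toIntLinearMap = _
    rw [h, LinearMap.baseChange_add]
    rfl⟩

variable {R}

/-- The element of the free module `R[-, x]` given by a morphism to `x`. -/
def freeElt {x y : C} (f : y ⟶ x) : (freeModule R x).val y := (1 ⊗ₜ[ℤ] f : R ⊗[ℤ] (y ⟶ x))

lemma act_freeElt {x y z : C} (g : z ⟶ y) (f : y ⟶ x) :
    (freeModule R x).act g (freeElt f) = freeElt (g ≫ f) :=
  rfl

lemma freeElt_eq_act {x y : C} (f : y ⟶ x) :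
    (freeElt f : (freeModule R x).val y) = (freeModule R x).act f (freeElt (𝟙 x)) := by
  rw [act_freeElt, Category.comp_id]

lemma freeModule_linearMap_ext {x y : C} {V : Type u} [AddCommGroup V] [Module R V]
    {φ ψ : (freeModule R x).val y →ₗ[R] V}
    (h : ∀ f : y ⟶ x, φ (freeElt f) = ψ (freeElt f)) : φ = ψ :=
  TensorProduct.AlgebraTensorModule.curry_injective (LinearMap.ext_ring (LinearMap.ext h))

/-- The linear map from a value of a free module given by an additive map on morphisms. -/
def freeElim {x y : C} {V : Type u} [AddCommGroup V] [Module R V] (a : (y ⟶ x) →+ V) :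
    (freeModule R x).val y →ₗ[R] V :=
  LinearMap.liftBaseChange R a.toIntLinearMap

lemma freeElim_elt {x y : C} {V : Type u} [AddCommGroup V] [Module R V] (a : (y ⟶ x) →+ V)
    (f : y ⟶ x) : freeElim a (freeElt f : (freeModule R x).val y) = a f :=
  (LinearMap.liftBaseChange_tmul R a.toIntLinearMap 1 f).trans (one_smul R _)

/-- The homomorphism from a free module that sends the generator to a given element. -/
def freeDesc {M : CatModule R C} {x : C} (m : M.val x) : freeModule R x ⟶ M :=
  homOf (fun y => freeElim ((LinearMap.applyₗ m).toAddMonoidHom.comp (M.actHom y x)))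
    fun {y z} g n => by
    suffices h : freeElim ((LinearMap.applyₗ m).toAddMonoidHom.comp (M.actHom y x)) ∘ₗ
        (freeModule R x).act g = M.act g ∘ₗ
          freeElim ((LinearMap.applyₗ m).toAddMonoidHom.comp (M.actHom z x)) from
      LinearMap.congr_fun h n
    refine freeModule_linearMap_ext fun f => ?_
    rw [LinearMap.comp_apply, LinearMap.comp_apply, act_freeElt, freeElim_elt, freeElim_elt]
    exact M.act_comp g f m

lemma app_freeDesc {M : CatModule R C} {x y : C} (m : M.val x) (f : y ⟶ x) :
    app (freeDesc m) y (freeElt f) = M.act f m :=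
  freeElim_elt _ f

lemma app_freeDesc_gen {M : CatModule R C} {x : C} (m : M.val x) :
    app (freeDesc m) x (freeElt (𝟙 x)) = m := by
  rw [app_freeDesc, act_id]

lemma freeModule_hom_ext {M : CatModule R C} {x : C} {φ ψ : freeModule R x ⟶ M}
    (h : app φ x (freeElt (𝟙 x)) = app ψ x (freeElt (𝟙 x))) : φ = ψ := by
  refine hom_ext fun y n => LinearMap.congr_fun (freeModule_linearMap_ext fun f => ?_) n
  rw [freeElt_eq_act, app_act, app_act, h]

lemma projective_directSum_freeModule {I : Type u} (x : I → C) :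
    Projective (directSum fun i => freeModule R (x i)) where
  factors {E X} f e _ := by
    choose a ha using fun i => surjective_of_epi e (x i)
      (app (directSumIncl _ i ≫ f) (x i) (freeElt (𝟙 (x i))))
    refine ⟨directSumDesc fun i => freeDesc (a i), hom_ext fun y n => ?_⟩
    refine LinearMap.congr_fun (directSum_linearMap_ext
      (f := app (directSumDesc (fun i => freeDesc (a i)) ≫ e) y) (g := app f y) fun i m => ?_) n
    rw [← app_comp, ← app_comp, ← Category.assoc, incl_directSumDesc]
    congr 2
    exact freeModule_hom_ext (by rw [app_comp, app_freeDesc_gen, ha])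

/-- A family of elements generates a module if every value is spanned over the ground ring by the
images of these elements under the action of morphisms. -/
def Generates (M : CatModule R C) {I : Type*} (x : I → C) (m : ∀ i, M.val (x i)) : Prop :=
  ∀ y (n : M.val y), n ∈ Submodule.span R {n | ∃ i, ∃ f : y ⟶ x i, n = M.act f (m i)}

lemma isFG_iff (M : CatModule R C) : M.IsFG ↔
    ∃ (k : ℕ) (x : Fin k → C) (m : ∀ i, M.val (x i)), M.Generates x m := by
  constructor
  · rintro ⟨I, _, x, p, _⟩
    obtain ⟨k, ⟨ε⟩⟩ := Finite.exists_equiv_fin I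
    -- The quotient of `M` by the span of the images of the generators vanishes, as its projection
    -- is zero after precomposition with the epimorphism `p`.
    let m : ∀ i, M.val (x i) := fun i =>
      ((Sigma.ι (fun i => freeFunctor R (x i)) i ≫ p).app (op (x i))).hom
        (freeElt (R := R) (𝟙 (x i)))
    let S : ∀ y, Submodule R (M.val y) := fun y =>
      Submodule.span R {n | ∃ i, ∃ f : y ⟶ x i, n = M.act f (m i)}
    have hS : ∀ {x y : C} (f : x ⟶ y), ∀ m ∈ S y, M.act f m ∈ S x := by
      intro x y f n hn
      have hle : S y ≤ (S x).comap (M.act f) := by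
        rw [Submodule.span_le]
        rintro _ ⟨i, g, rfl⟩
        refine Submodule.subset_span ⟨i, f ≫ g, ?_⟩
        rw [act_comp]
      exact hle hn
    have h : (quotMk M S hS).hom = 0 := by
      rw [← cancel_epi p]
      refine Sigma.hom_ext _ _ fun i => ?_
      let q : freeModule R (x i) ⟶ M :=
        ObjectProperty.homMk (Sigma.ι (fun i => freeFunctor R (x i)) i ≫ p)
      have : q ≫ quotMk M S hS = 0 := freeModule_hom_ext (by
        rw [app_zero, app_comp, quotMk_eq_zero_iff]
        exact Submodule.subset_span ⟨i, 𝟙 _, (M.act_id _).symm⟩)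
      rw [comp_zero, comp_zero, ← Category.assoc]
      exact congrArg (fun φ => φ.hom) this
    refine ⟨k, fun j => x (ε.symm j), fun j => m _, fun y n => ?_⟩
    have hn : app (quotMk M S hS) y n = 0 := by
      change ((quotMk M S hS).hom.app (op y)).hom n = 0
      rw [h]
      rfl
    refine Submodule.span_mono ?_ ((quotMk_eq_zero_iff M S hS n).1 hn)
    rintro _ ⟨i, f, rfl⟩
    obtain ⟨j, rfl⟩ := ε.symm.surjective i
    exact ⟨j, f, rfl⟩
  · rintro ⟨k, x, m, h⟩
    refine ⟨Fin k, inferInstance, x, Sigma.desc fun i => (freeDesc (m i)).hom, ?_⟩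
    let p : (∐ fun i => freeFunctor R (x i)) ⟶ M.obj := Sigma.desc fun i => (freeDesc (m i)).hom
    have : ∀ y : Cᵒᵖ, Epi (p.app y) := fun y => by
      rw [ModuleCat.epi_iff_surjective, ← LinearMap.range_eq_top, eq_top_iff]
      rintro n -
      refine Submodule.span_le.2 ?_ (h y.unop n)
      rintro _ ⟨i, f, rfl⟩
      refine ⟨((Sigma.ι (fun i => freeFunctor R (x i)) i).app y).hom
        (freeElt (R := R) f), ?_⟩
      rw [← app_freeDesc (m i) f]
      exact LinearMap.congr_fun (congrArg ModuleCat.Hom.hom (congrArg (fun φ => φ.app y)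
        (Sigma.ι_desc (fun i => (freeDesc (m i)).hom) i))) _
    exact NatTrans.epi_of_epi_app p

lemma Generates.surjective {M : CatModule R C} {I : Type u} {x : I → C} {m : ∀ i, M.val (x i)}
    (h : M.Generates x m) (y : C) :
    Function.Surjective (app (directSumDesc fun i => freeDesc (m i)) y) := by
  rw [← LinearMap.range_eq_top, eq_top_iff]
  rintro n -
  refine Submodule.span_le.2 ?_ (h y n)
  rintro _ ⟨i, f, rfl⟩
  refine ⟨app (directSumIncl _ i) y (freeElt f), ?_⟩
  rw [← app_comp, incl_directSumDesc, app_freeDesc]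

lemma IsFG.of_surjective {M N : CatModule R C} (hM : M.IsFG) (φ : M ⟶ N)
    (hφ : ∀ x, Function.Surjective (app φ x)) : N.IsFG := by
  rw [isFG_iff] at hM ⊢
  obtain ⟨k, x, m, h⟩ := hM
  refine ⟨k, x, fun i => app φ _ (m i), fun y n => ?_⟩
  obtain ⟨n, rfl⟩ := hφ y n
  suffices hle : Submodule.span R {n | ∃ i, ∃ f : y ⟶ x i, n = M.act f (m i)} ≤
      (Submodule.span R _).comap (app φ y) from hle (h y n)
  rw [Submodule.span_le]
  rintro _ ⟨i, f, rfl⟩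
  exact Submodule.subset_span ⟨i, f, app_act φ f _⟩

lemma isFG_directSum_freeModule {I : Type u} [Finite I] (x : I → C) :
    (directSum fun i => freeModule R (x i)).IsFG := by
  obtain ⟨k, ⟨ε⟩⟩ := Finite.exists_equiv_fin I
  refine (isFG_iff _).2 ⟨k, fun j => x (ε.symm j),
    fun j => app (directSumIncl _ (ε.symm j)) _ (freeElt (𝟙 _)), fun y n => ?_⟩
  suffices h : (Submodule.span R _).mkQ = 0 from
    (Submodule.Quotient.mk_eq_zero _).1 (LinearMap.congr_fun h n)
  refine directSum_linearMap_ext fun i m => ?_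
  refine LinearMap.congr_fun
    (f := (Submodule.span R _).mkQ ∘ₗ app (directSumIncl (fun i => freeModule R (x i)) i) y)
    (g := 0) (freeModule_linearMap_ext fun f => ?_) m
  refine (Submodule.Quotient.mk_eq_zero _).2 (Submodule.subset_span ?_)
  obtain ⟨j, rfl⟩ := ε.symm.surjective i
  refine ⟨j, f, ?_⟩
  rw [← app_act, ← freeElt_eq_act]

/-- Every module is a quotient of a direct sum of free modules. -/
lemma exists_free_cover (M : CatModule R C) : ∃ (I : Type u) (x : I → C)
    (p : (directSum fun i => freeModule R (x i)) ⟶ M), ∀ y, Function.Surjective (app p y) := by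
  have h : M.Generates (fun i : (x : C) × M.val x => i.1) (fun i => i.2) := fun y n =>
    Submodule.subset_span ⟨⟨y, n⟩, 𝟙 y, (M.act_id n).symm⟩
  exact ⟨_, _, _, h.surjective⟩

/-- Every module is a quotient of a projective module, which can be chosen to be finitely generated
if the given module is. -/
lemma exists_cover (M : CatModule R C) : ∃ (P : CatModule R C) (p : P ⟶ M), Projective P ∧
    (∀ x, Function.Surjective (app p x)) ∧ (M.IsFG → P.IsFG) := by
  by_cases hM : M.IsFG
  · obtain ⟨k, x, m, h⟩ := (isFG_iff M).1 hM
    have h' : M.Generates (fun i : ULift.{u} (Fin k) => x i.down) (fun i => m i.down) :=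
      fun y n => by
        refine Submodule.span_mono ?_ (h y n)
        rintro _ ⟨i, f, rfl⟩
        exact ⟨⟨i⟩, f, rfl⟩
    exact ⟨_, _, projective_directSum_freeModule _, h'.surjective,
      fun _ => isFG_directSum_freeModule _⟩
  · obtain ⟨I, x, p, hp⟩ := M.exists_free_cover
    exact ⟨_, p, projective_directSum_freeModule _, hp, fun h => absurd h hM⟩

/-- A projective cover of a module, in the weak sense of a projective module that surjects onto it;
it is finitely generated if the module is. -/
def cover (M : CatModule R C) : CatModule R C := M.exists_cover.choose

/-- The projection of the cover. -/
def coverMap (M : CatModule R C) : M.cover ⟶ M := M.exists_cover.choose_spec.choose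

lemma projective_cover (M : CatModule R C) : Projective M.cover :=
  M.exists_cover.choose_spec.choose_spec.1

lemma coverMap_surjective (M : CatModule R C) (x : C) : Function.Surjective (app M.coverMap x) :=
  M.exists_cover.choose_spec.choose_spec.2.1 x

lemma isFG_cover {M : CatModule R C} (hM : M.IsFG) : M.cover.IsFG :=
  M.exists_cover.choose_spec.choose_spec.2.2 hM

/-- The iterated syzygies of a module with respect to the chosen covers. -/
def syzygy (M : CatModule R C) : ℕ → CatModule R C
  | 0 => M
  | i + 1 => ker (syzygy M i).coverMap

lemma isFP_of_syzygy {M : CatModule R C} {n : ℕ∞}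
    (h : ∀ i : ℕ, (i : ℕ∞) ≤ n → (M.syzygy i).IsFG) : M.IsFP n := by
  refine ⟨fun i => (M.syzygy i).cover,
    fun i => (M.syzygy (i + 1)).coverMap ≫ kerIncl (M.syzygy i).coverMap, (M.syzygy 0).coverMap,
    fun i => projective_cover _, fun i hi => isFG_cover (h i hi),
    fun x => coverMap_surjective _ x.unop, fun x => ?_, fun i x => ?_⟩
  · intro n
    constructor
    · intro hn
      obtain ⟨k, hk⟩ := coverMap_surjective (M.syzygy 1) x.unop
        (show (M.syzygy 1).val x.unop from ⟨n, hn⟩)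
      exact ⟨k, congrArg Subtype.val hk⟩
    · rintro ⟨k, rfl⟩
      exact (app (M.syzygy 1).coverMap x.unop k).2
  · intro n
    constructor
    · intro hn
      have hn : app (M.syzygy (i + 1)).coverMap x.unop n = 0 := Subtype.ext hn
      obtain ⟨k, hk⟩ := coverMap_surjective (M.syzygy (i + 2)) x.unop
        (show (M.syzygy (i + 2)).val x.unop from ⟨n, hn⟩)
      exact ⟨k, congrArg Subtype.val hk⟩
    · rintro ⟨k, rfl⟩
      exact congrArg Subtype.val (app (M.syzygy (i + 2)).coverMap x.unop k).2

lemma IsFP.mono {M : CatModule R C} {m n : ℕ∞} (h : M.IsFP n) (hmn : m ≤ n) : M.IsFP m := by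
  obtain ⟨P, d, ε, h₁, h₂, h₃⟩ := h
  exact ⟨P, d, ε, h₁, fun i hi => h₂ i (hi.trans hmn), h₃⟩

lemma IsFP.isFG {M : CatModule R C} {n : ℕ∞} (h : M.IsFP n) : M.IsFG := by
  obtain ⟨P, d, ε, h₁, h₂, h₃, -⟩ := h
  exact (h₂ 0 (by simp)).of_surjective ε fun x => h₃ (op x)

lemma IsFP.exists_ker {M : CatModule R C} {k : ℕ} (h : M.IsFP (k + 1 : ℕ)) :
    ∃ (P : CatModule R C) (p : P ⟶ M), Projective P ∧ P.IsFG ∧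
      (∀ x, Function.Surjective (app p x)) ∧ (ker p).IsFP k := by
  obtain ⟨P, d, ε, h₁, h₂, h₃, h₄, h₅⟩ := h
  refine ⟨P 0, ε, h₁ 0, h₂ 0 (by simp), fun x => h₃ (op x), fun i => P (i + 1),
    fun i => d (i + 1), kerLift ε (d 0) fun x m => (h₄ (op x) _).2 ⟨m, rfl⟩, fun i => h₁ _,
    fun i hi => h₂ _ (by exact_mod_cast Nat.succ_le_succ (by exact_mod_cast hi)), fun x => ?_,
    fun x n => ?_, fun i x => h₅ _ x⟩
  · rintro ⟨m, hm⟩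
    obtain ⟨k, hk⟩ := (h₄ x m).1 hm
    exact ⟨k, Subtype.ext hk⟩
  · rw [← h₅ 0 x n]
    exact ⟨fun h => congrArg Subtype.val h, fun h => Subtype.ext h⟩

lemma isFP_of_subsingleton {M : CatModule R C} (h : ∀ x, Subsingleton (M.val x)) (n : ℕ∞) :
    M.IsFP n := by
  have hM : M.IsFG := (isFG_iff M).2 ⟨0, Fin.elim0, fun i => i.elim0, fun y n => by
    rw [Subsingleton.elim n 0]
    exact zero_mem _⟩
  have hP : Projective M :=
    ⟨fun f _ _ => ⟨0, hom_ext fun x m => by rw [Subsingleton.elim m 0, map_zero, map_zero]⟩⟩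
  exact ⟨fun _ => M, fun _ => 𝟙 M, 𝟙 M, fun _ => hP, fun _ _ => hM, fun _ m => ⟨m, rfl⟩,
    fun x m => ⟨fun _ => ⟨m, rfl⟩, fun _ => (h x.unop).elim _ _⟩,
    fun _ x m => ⟨fun _ => ⟨m, rfl⟩, fun _ => (h x.unop).elim _ _⟩⟩

end Free

end CatModule

/-! ### Detecting finiteness properties by functors to modules over rings -/

namespace CatModule

variable {R : Type u} [CommRing R] {C : Type u} [Category.{u} C] [Preadditive C]

/-- A finitely generated projective module is a retract of a finite direct sum of free modules. -/
lemma exists_retract_of_projective {P : CatModule R C} (hP : Projective P) (h : P.IsFG) :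
    ∃ (k : ℕ) (x : Fin k → C) (s : ∀ i, P ⟶ freeModule R (x i)) (r : ∀ i, freeModule R (x i) ⟶ P),
      ∑ i, s i ≫ r i = 𝟙 P := by
  obtain ⟨k, x, m, hm⟩ := (isFG_iff P).1 h
  let I := ULift.{u} (Fin k)
  have h' : P.Generates (fun i : I => x i.down) (fun i => m i.down) := fun y n => by
    refine Submodule.span_mono ?_ (hm y n)
    rintro _ ⟨i, f, rfl⟩
    exact ⟨⟨i⟩, f, rfl⟩
  let p := directSumDesc fun i : I => freeDesc (m i.down)
  have : Epi p := epi_of_surjective p h'.surjective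
  have hs : Projective.factorThru (𝟙 P) p ≫ p = 𝟙 P := Projective.factorThru_comp _ _
  refine ⟨k, x, fun i => Projective.factorThru (𝟙 P) p ≫ directSumProj _ (ULift.up i : I),
    fun i => freeDesc (m i), ?_⟩
  have hsum : ∑ i : I, (Projective.factorThru (𝟙 P) p ≫ directSumProj _ i) ≫
      freeDesc (m i.down) = 𝟙 P := by
    calc _ = ∑ i : I, Projective.factorThru (𝟙 P) p ≫ (directSumProj _ i ≫
        directSumIncl (fun i : I => freeModule R (x i.down)) i) ≫ p :=
        Finset.sum_congr rfl fun i _ => by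
          rw [Category.assoc, Category.assoc, incl_directSumDesc fun i : I => freeDesc (m i.down)]
      _ = 𝟙 P := by
        rw [← Preadditive.comp_sum, ← Preadditive.sum_comp, sum_proj_incl, Category.id_comp, hs]
  refine Eq.trans ?_ hsum
  exact Fintype.sum_equiv Equiv.ulift.symm _ _ fun i => by rw [Category.assoc]; rfl

/-- The finiteness properties of a module over a preadditive category are detected by a family of
additive functors `Φ i` to modules over rings, if free modules are sent to modules of type `FP_n`
for all `n`, finite generation is detected by the functors, and the functors are exact on short
exact sequences with middle and right term in a class of modules that contains the projective
modules and is closed under kernels of surjections. -/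
theorem isFP_iff_moduleFP {ι : Type u} (A : ι → Type u) [∀ i, Ring (A i)]
    (Φ : ∀ i, CatModule R C ⥤ ModuleCat.{u} (A i)) [∀ i, (Φ i).Additive]
    (good : CatModule R C → Prop) (good_of_projective : ∀ P, Projective P → good P)
    (good_ker : ∀ {P M : CatModule R C} (p : P ⟶ M), (∀ x, Function.Surjective (app p x)) →
      good P → good M → good (ker p))
    (injective : ∀ {P M : CatModule R C} (p : P ⟶ M), (∀ x, Function.Surjective (app p x)) →
      good P → good M → ∀ i, Function.Injective ((Φ i).map (kerIncl p)).hom)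
    (exact : ∀ {P M : CatModule R C} (p : P ⟶ M), (∀ x, Function.Surjective (app p x)) →
      ∀ i, Function.Exact ((Φ i).map (kerIncl p)).hom ((Φ i).map p).hom)
    (surjective : ∀ {P M : CatModule R C} (p : P ⟶ M), (∀ x, Function.Surjective (app p x)) →
      ∀ i, Function.Surjective ((Φ i).map p).hom)
    (free : ∀ i x n, ModuleFP (A i) n ((Φ i).obj (freeModule R x)))
    (detect : ∀ M : CatModule R C, (∀ i, Module.Finite (A i) ((Φ i).obj M)) → M.IsFG)
    {M : CatModule R C} (hM : good M) (n : ℕ∞) :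
    M.IsFP n ↔ ∀ i, ∀ k : ℕ, (k : ℕ∞) ≤ n → ModuleFP (A i) k ((Φ i).obj M) := by
  have hproj : ∀ {P : CatModule R C}, Projective P → P.IsFG → ∀ i k,
      ModuleFP (A i) k ((Φ i).obj P) := by
    intro P hP h i k
    obtain ⟨l, x, s, r, hsr⟩ := exists_retract_of_projective hP h
    refine ModuleFP.of_retract (Y := ∀ j, (Φ i).obj (freeModule R (x j)))
      (LinearMap.pi fun j => ((Φ i).map (s j)).hom)
      (∑ j, ((Φ i).map (r j)).hom ∘ₗ LinearMap.proj j) (fun v => ?_)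
      (ModuleFP.pi fun j => free i (x j) k)
    have h := congrArg (fun φ => ((Φ i).map φ).hom v) hsr
    simp only [Functor.map_sum, Functor.map_comp, CategoryTheory.Functor.map_id,
      ModuleCat.hom_sum, LinearMap.sum_apply] at h
    simpa [LinearMap.sum_apply] using h
  constructor
  · intro h i k hk
    replace h := h.mono hk
    clear hk
    induction k generalizing M with
    | zero =>
      have hc := isFG_cover h.isFG
      have := (hproj (projective_cover M) hc i 0).finite
      exact Module.Finite.of_surjective _ (surjective M.coverMap (coverMap_surjective M) i)
    | succ k ih =>
      obtain ⟨P, p, hP, hfg, hp, hker⟩ := h.exists_ker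
      have hP' := good_of_projective P hP
      exact ModuleFP.of_quotient (injective p hp hP' hM i) (exact p hp i) (surjective p hp i)
        (ih (good_ker p hp hP' hM) hker) (hproj hP hfg i _)
  · intro h
    refine isFP_of_syzygy fun j hj => ?_
    suffices H : ∀ j : ℕ, (j : ℕ∞) ≤ n → good (M.syzygy j) ∧
        ∀ i, ∀ k : ℕ, ((j + k : ℕ) : ℕ∞) ≤ n → ModuleFP (A i) k ((Φ i).obj (M.syzygy j)) from
      detect _ fun i => ((H j hj).2 i 0 hj).finite
    intro j
    induction j with
    | zero =>
      intro _
      refine ⟨hM, fun i k hk => h i k ?_⟩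
      rwa [zero_add] at hk
    | succ j ih =>
      intro hj
      have hj' : (j : ℕ∞) ≤ n := le_trans (by exact_mod_cast Nat.le_succ j) hj
      obtain ⟨h₁, h₂⟩ := ih hj'
      have hfg : (M.syzygy j).IsFG := detect _ fun i => (h₂ i 0 hj').finite
      have hP := projective_cover (M.syzygy j)
      have hp := coverMap_surjective (M.syzygy j)
      have hP' := good_of_projective _ hP
      refine ⟨good_ker _ hp hP' h₁, fun i k hk => ?_⟩
      refine ModuleFP.of_kernel (injective _ hp hP' h₁ i) (exact _ hp i) (surjective _ hp i)
        (hproj hP (isFG_cover hfg) i k) (h₂ i (k + 1) ?_)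
      rwa [← add_assoc, add_right_comm]

end CatModule

/-! ### Functors to representations -/

section RepFunctor

variable {R : Type u} [CommRing R] {W : Type u} [Group W]

/-- A functor to `R`-modules whose values carry a natural action of a group `W`, as a functor to
modules over the group algebra. -/
def repFunctor {𝒜 : Type*} [Category 𝒜] (T : 𝒜 ⥤ ModuleCat.{u} R)
    (ρ : ∀ M, Representation R W (T.obj M))
    (hρ : ∀ {M N : 𝒜} (φ : M ⟶ N) (w : W) (v : T.obj M),
      (T.map φ).hom (ρ M w v) = ρ N w ((T.map φ).hom v)) :
    𝒜 ⥤ ModuleCat.{u} (MonoidAlgebra R W) where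
  obj M := ModuleCat.of _ (ρ M).asModule
  map {M N} φ := ModuleCat.ofHom (Representation.IntertwiningMap.equivLinearMapAsModule (ρ M) (ρ N)
    ⟨(T.map φ).hom, fun w => LinearMap.ext fun v => hρ φ w v⟩)
  map_id M := ModuleCat.hom_ext (LinearMap.ext fun v =>
    LinearMap.congr_fun (congrArg ModuleCat.Hom.hom (T.map_id M)) v)
  map_comp φ ψ := ModuleCat.hom_ext (LinearMap.ext fun v =>
    LinearMap.congr_fun (congrArg ModuleCat.Hom.hom (T.map_comp φ ψ)) v)

lemma repFunctor_additive {𝒜 : Type*} [Category 𝒜] [Preadditive 𝒜] (T : 𝒜 ⥤ ModuleCat.{u} R)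
    [T.Additive] (ρ : ∀ M, Representation R W (T.obj M))
    (hρ : ∀ {M N : 𝒜} (φ : M ⟶ N) (w : W) (v : T.obj M),
      (T.map φ).hom (ρ M w v) = ρ N w ((T.map φ).hom v)) : (repFunctor T ρ hρ).Additive where
  map_add {_ _ φ ψ} := ModuleCat.hom_ext (LinearMap.ext fun v =>
    LinearMap.congr_fun (congrArg ModuleCat.Hom.hom (T.map_add (f := φ) (g := ψ))) v)

variable {V V' : Type u} [AddCommGroup V] [Module R V] [AddCommGroup V'] [Module R V']
  (ρ : Representation R W V) (ρ' : Representation R W V')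

lemma grp_smul_asModule (w : W) (v : ρ.asModule) : grp R w • v = ρ w v := by
  rw [grp, Representation.single_smul, one_smul]
  rfl

/-- A permutation representation with finitely many orbits and finite stabilisers has type `FP_n`
for all `n`. -/
lemma moduleFP_asModule {X : Type u} [MulAction W X] (b : Module.Basis X R V)
    (hb : ∀ (g : W) (x : X), ρ g (b x) = b (g • x))
    (hfin : Finite (MulAction.orbitRel.Quotient W X))
    (hstab : ∀ x : X, Finite (MulAction.stabilizer W x)) (n : ℕ) :
    ModuleFP (MonoidAlgebra R W) n ρ.asModule :=
  moduleFP_of_permutation (V := ρ.asModule) (b.map ρ.asModuleEquiv.symm)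
    (fun g x => (grp_smul_asModule ρ g _).trans (hb g x)) hfin hstab n

/-- Representations with a basis of one invariant vector are isomorphic. -/
lemma moduleFP_iff_of_trivial {X X' : Type u} [Unique X] [Unique X'] (b : Module.Basis X R V)
    (b' : Module.Basis X' R V') (h : ∀ w, ρ w (b default) = b default)
    (h' : ∀ w, ρ' w (b' default) = b' default) (n : ℕ) :
    ModuleFP (MonoidAlgebra R W) n ρ.asModule ↔ ModuleFP (MonoidAlgebra R W) n ρ'.asModule := by
  let e : V ≃ₗ[R] V' := b.equiv b' (Equiv.ofUnique X X')
  have he : e (b default) = b' default := by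
    rw [Module.Basis.equiv_apply]
    congr 1
  have hcomm : ∀ w v, e (ρ w v) = ρ' w (e v) := fun w v => by
    suffices H : e.toLinearMap ∘ₗ ρ w = ρ' w ∘ₗ e.toLinearMap from LinearMap.congr_fun H v
    refine b.ext fun x => ?_
    rw [Unique.eq_default x, LinearMap.comp_apply, LinearMap.comp_apply, h,
      LinearEquiv.coe_coe, he, h']
  let f : ρ.asModule →ₗ[MonoidAlgebra R W] ρ'.asModule :=
    Representation.IntertwiningMap.equivLinearMapAsModule ρ ρ'
      ⟨e.toLinearMap, fun w => LinearMap.ext fun v => hcomm w v⟩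
  let E : ρ.asModule ≃ₗ[MonoidAlgebra R W] ρ'.asModule := LinearEquiv.ofBijective f e.bijective
  exact ⟨fun H => H.of_equiv E, fun H => H.of_equiv E.symm⟩

lemma exists_span_of_finite (h : Module.Finite (MonoidAlgebra R W) ρ.asModule) :
    ∃ (k : ℕ) (m : Fin k → V), ∀ v, v ∈ Submodule.span R {v | ∃ j w, v = ρ w (m j)} := by
  obtain ⟨k, m, hm⟩ := Module.Finite.exists_fin (R := MonoidAlgebra R W) (M := ρ.asModule)
  let S : Submodule R V := Submodule.span R {v | ∃ j w, v = ρ w (ρ.asModuleEquiv (m j))}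
  have hS : ∀ g, ∀ v ∈ S, ρ g v ∈ S := by
    intro g
    suffices hle : S ≤ S.comap (ρ g) from fun v hv => hle hv
    refine Submodule.span_le.2 ?_
    rintro _ ⟨j, w, rfl⟩
    exact Submodule.subset_span ⟨j, g * w, by rw [map_mul]; rfl⟩
  refine ⟨k, fun j => ρ.asModuleEquiv (m j), fun v => ?_⟩
  change v ∈ S
  have hv : ρ.asModuleEquiv.symm v ∈ Submodule.span (MonoidAlgebra R W) (Set.range m) := by
    rw [hm]
    trivial
  suffices H : ∀ x ∈ Submodule.span (MonoidAlgebra R W) (Set.range m), ρ.asModuleEquiv x ∈ S from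
    H _ hv
  intro x hx
  induction hx using Submodule.span_induction with
  | mem x hx =>
    obtain ⟨j, rfl⟩ := hx
    exact Submodule.subset_span ⟨j, 1, by rw [map_one]; rfl⟩
  | zero => exact zero_mem S
  | add x y _ _ hx hy => exact add_mem hx hy
  | smul a x _ hx =>
    induction a using MonoidAlgebra.induction_linear with
    | zero =>
      rw [zero_smul]
      exact zero_mem S
    | add a b ha hb =>
      rw [add_smul]
      exact add_mem ha hb
    | single g r =>
      rw [Representation.single_smul]
      exact S.smul_mem r (hS g _ hx)

end RepFunctor

lemma CatModule.isFG_of_generates {R : Type u} [CommRing R] {C : Type u} [Category.{u} C]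
    [Preadditive C] {M : CatModule R C} {I : Type*} [Finite I] {x : I → C} {m : ∀ i, M.val (x i)}
    (h : M.Generates x m) : M.IsFG := by
  obtain ⟨k, ⟨ε⟩⟩ := Finite.exists_equiv_fin I
  refine (isFG_iff M).2 ⟨k, fun j => x (ε.symm j), fun j => m (ε.symm j), fun y n => ?_⟩
  refine Submodule.span_mono ?_ (h y n)
  rintro _ ⟨i, f, rfl⟩
  obtain ⟨j, rfl⟩ := ε.symm.surjective i
  exact ⟨j, f, rfl⟩

/-! ### Maps between transitive `G`-sets -/

section GSets

variable {G : Type u} [Group G]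

lemma finite_subgroups_le (K : Subgroup G) [Finite K] : Finite {L : Subgroup G // L ≤ K} := by
  have : Finite {b : Set G // b ⊆ K} := (Set.toFinite (K : Set G)).finite_subsets
  exact Finite.of_injective (fun L => (⟨L.1, L.2⟩ : {b : Set G // b ⊆ K})) fun L L' h =>
    Subtype.ext (SetLike.coe_injective (Subtype.ext_iff.1 h))

section Transitive

variable {U T : Type u} [MulAction G U] [MulAction G T] [MulAction.IsPretransitive G U]

lemma gmap_ext {f g : U →[G] T} (u : U) (h : f u = g u) : f = g := by
  refine MulActionHom.ext fun v => ?_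
  obtain ⟨a, rfl⟩ := MulAction.exists_smul_eq G u v
  rw [map_smul, map_smul, h]

lemma exists_gmap (u : U) (t : T)
    (h : MulAction.stabilizer G u ≤ MulAction.stabilizer G t) : ∃ f : U →[G] T, f u = t := by
  choose a ha using MulAction.exists_smul_eq G u
  have key : ∀ g g' : G, g • u = g' • u → g • t = g' • t := fun g g' hg => by
    have : g'⁻¹ * g ∈ MulAction.stabilizer G u := by
      rw [MulAction.mem_stabilizer_iff, mul_smul, hg, inv_smul_smul]
    have := MulAction.mem_stabilizer_iff.1 (h this)
    rw [mul_smul, inv_smul_eq_iff] at this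
    exact this
  refine ⟨⟨fun v => a v • t, fun g v => ?_⟩, ?_⟩
  · rw [id, ← mul_smul]
    refine key _ _ ?_
    rw [ha, mul_smul, ha]
  · change a u • t = t
    rw [key (a u) 1 (by rw [ha, one_smul]), one_smul]

lemma gmap_surjective {U T : Type u} [MulAction G U] [MulAction G T]
    [MulAction.IsPretransitive G T] [Nonempty U] (f : U →[G] T) :
    Function.Surjective f := fun t => by
  obtain ⟨u⟩ := ‹Nonempty U›
  obtain ⟨g, rfl⟩ := MulAction.exists_smul_eq G (f u) t
  exact ⟨g • u, map_smul f g u⟩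

lemma stabilizer_le_of_gmap {U T : Type u} [MulAction G U] [MulAction G T] (f : U →[G] T) (u : U) :
    MulAction.stabilizer G u ≤ MulAction.stabilizer G (f u) := fun g hg => by
  rw [MulAction.mem_stabilizer_iff] at hg ⊢
  rw [← map_smul, hg]

/-- The fibres of a map from a transitive `G`-set to a `G`-set with finite stabilisers are
finite. -/
lemma finite_fiber (f : U →[G] T) (t : T) (ht : Finite (MulAction.stabilizer G t)) :
    Finite {u // f u = t} := by
  rcases isEmpty_or_nonempty {u // f u = t} with h | ⟨⟨u, rfl⟩⟩
  · infer_instance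
  refine Finite.of_surjective (fun g : MulAction.stabilizer G (f u) =>
    (⟨g.1 • u, by rw [map_smul]; exact g.2⟩ : {v // f v = f u})) ?_
  rintro ⟨v, hv⟩
  obtain ⟨g, rfl⟩ := MulAction.exists_smul_eq G u v
  exact ⟨⟨g, by rw [MulAction.mem_stabilizer_iff, ← map_smul, hv]⟩, rfl⟩

end Transitive

variable {F : FiniteSubgroupFamily G}

namespace TransitiveGSet

/-- The `G`-set underlying an object of the category of transitive `G`-sets. -/
abbrev carrier (x : TransitiveGSet F) : Type u := G ⧸ x.subgroup

/-- The `G`-map underlying a morphism. -/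
abbrev toGMap {x y : TransitiveGSet F} (f : x ⟶ y) : x.carrier →[G] y.carrier := f

/-- The morphism given by a `G`-map. -/
abbrev ofGMap {x y : TransitiveGSet F} (f : x.carrier →[G] y.carrier) : x ⟶ y := f

lemma hom_inv_apply {x y : TransitiveGSet F} (e : x ≅ y) (a : x.carrier) :
    toGMap e.inv (toGMap e.hom a) = a :=
  congrArg (fun f : x ⟶ x => toGMap f a) e.hom_inv_id

lemma inv_hom_apply {x y : TransitiveGSet F} (e : x ≅ y) (a : y.carrier) :
    toGMap e.hom (toGMap e.inv a) = a :=
  congrArg (fun f : y ⟶ y => toGMap f a) e.inv_hom_id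

lemma exists_iso {x y : TransitiveGSet F} (a : x.carrier) (b : y.carrier)
    (h : MulAction.stabilizer G a = MulAction.stabilizer G b) :
    ∃ e : x ≅ y, toGMap e.hom a = b := by
  obtain ⟨f, hf⟩ := exists_gmap a b h.le
  obtain ⟨g, hg⟩ := exists_gmap b a h.ge
  refine ⟨⟨f, g, ?_, ?_⟩, hf⟩
  · refine gmap_ext a ?_
    change g (f a) = a
    rw [hf, hg]
  · refine gmap_ext b ?_
    change f (g b) = b
    rw [hg, hf]

/-- The `G`-maps from `x` to a `G`-set. -/
def GMap (x : TransitiveGSet F) (Y : Type u) [MulAction G Y] : Type u := x.carrier →[G] Y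

instance (x : TransitiveGSet F) (Y : Type u) [MulAction G Y] : MulAction (Aut x) (x.GMap Y) where
  smul w φ := MulActionHom.comp φ (toGMap w.inv)
  one_smul _ := rfl
  mul_smul _ _ _ := rfl

variable (x : TransitiveGSet F) {Y : Type u} [MulAction G Y]

lemma finite_stabilizer_gmap (hY : ∀ y : Y, Finite (MulAction.stabilizer G y)) (φ : x.GMap Y) :
    Finite (MulAction.stabilizer (Aut x) φ) := by
  let φ' : x.carrier →[G] Y := φ
  let o : x.carrier := ((1 : G) : G ⧸ x.subgroup)
  have := finite_fiber φ' (φ' o) (hY _)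
  refine Finite.of_injective (fun w : MulAction.stabilizer (Aut x) φ =>
    (⟨toGMap w.1.inv o, ?_⟩ : {u // φ' u = φ' o})) ?_
  · have h : w.1 • φ = φ := w.2
    exact congrArg (fun ψ : x.carrier →[G] Y => ψ o) h
  · rintro ⟨w, hw⟩ ⟨v, hv⟩ h
    have h : toGMap w.inv o = toGMap v.inv o := congrArg Subtype.val h
    have h : w.inv = v.inv := gmap_ext o h
    exact Subtype.ext (Iso.ext_inv h)

/-- There are finitely many `G`-maps between transitive `G`-sets with finite stabilisers, up to
automorphisms of the source: a map is determined up to automorphism by the stabiliser of a point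
over a fixed base point. -/
lemma finite_orbits_gmap [MulAction.IsPretransitive G Y]
    (hY : ∀ y : Y, Finite (MulAction.stabilizer G y)) :
    Finite (MulAction.orbitRel.Quotient (Aut x) (x.GMap Y)) := by
  rcases isEmpty_or_nonempty Y with h | ⟨⟨y⟩⟩
  · have : IsEmpty (x.GMap Y) := ⟨fun φ => h.elim
      ((show x.carrier →[G] Y from φ) ((1 : G) : G ⧸ x.subgroup))⟩
    infer_instance
  have hsurj : ∀ φ : x.GMap Y, ∃ a, (show x.carrier →[G] Y from φ) a = y := fun φ =>
    gmap_surjective (show x.carrier →[G] Y from φ) y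
  choose a ha using hsurj
  have := hY y
  have := finite_subgroups_le (MulAction.stabilizer G y)
  refine Finite.of_injective (β := {L : Subgroup G // L ≤ MulAction.stabilizer G y})
    (fun o => ⟨MulAction.stabilizer G (a o.out), ?_⟩) ?_
  · have h := stabilizer_le_of_gmap (show x.carrier →[G] Y from o.out) (a o.out)
    rwa [ha] at h
  · intro o o' h
    obtain ⟨e, he⟩ := exists_iso (a o.out) (a o'.out) (congrArg Subtype.val h)
    rw [← Quotient.out_eq o, ← Quotient.out_eq o']
    refine Quotient.sound ⟨e.symm, ?_⟩
    refine gmap_ext (T := Y) (a o.out) ?_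
    change (show x.carrier →[G] Y from o'.out) (toGMap e.hom (a o.out)) = _
    rw [he, ha]
    exact (ha _).symm

end TransitiveGSet

variable (F) in
/-- The family contains only finitely many subgroups up to conjugation. -/
def FiniteUpToIso : Prop :=
  ∃ (k : ℕ) (t : Fin k → TransitiveGSet F), ∀ x : TransitiveGSet F, ∃ i, Nonempty (x ≅ t i)

/-- If every transitive `G`-set in the family maps to one of finitely many, then there are only
finitely many of them up to isomorphism. -/
lemma finiteUpToIso_of_hom {k : ℕ} (t : Fin k → TransitiveGSet F)
    (h : ∀ x : TransitiveGSet F, ∃ i, Nonempty (x ⟶ t i)) : FiniteUpToIso F := by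
  let I := (i : Fin k) × {L : Subgroup G // L ≤ (t i).subgroup}
  have : ∀ i, Finite {L : Subgroup G // L ≤ (t i).subgroup} := fun i => by
    have := F.finite_of_mem (t i).mem
    exact finite_subgroups_le _
  obtain ⟨l, ⟨ε⟩⟩ := Finite.exists_equiv_fin I
  let y : I → TransitiveGSet F := fun p => ⟨p.2.1, F.mem_of_le (t p.1).mem p.2.2⟩
  refine ⟨l, fun j => y (ε.symm j), fun x => ?_⟩
  obtain ⟨i, ⟨f⟩⟩ := h x
  obtain ⟨a, ha⟩ := gmap_surjective (TransitiveGSet.toGMap f) ((1 : G) : G ⧸ (t i).subgroup)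
  have hL : MulAction.stabilizer G a ≤ (t i).subgroup := by
    have h := stabilizer_le_of_gmap (TransitiveGSet.toGMap f) a
    rwa [ha, MulAction.stabilizer_quotient] at h
  obtain ⟨j, hj⟩ := ε.symm.surjective ⟨i, MulAction.stabilizer G a, hL⟩
  refine ⟨j, ?_⟩
  change Nonempty (x ≅ y (ε.symm j))
  rw [hj]
  obtain ⟨e, -⟩ := TransitiveGSet.exists_iso (x := x)
    (y := ⟨MulAction.stabilizer G a, F.mem_of_le (t i).mem hL⟩) a
    ((1 : G) : G ⧸ MulAction.stabilizer G a) (MulAction.stabilizer_quotient _).symm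
  exact ⟨e⟩

end GSets

/-! ### Bredon modules -/

section Bredon

variable {G : Type u} [Group G] {F : FiniteSubgroupFamily G} {R : Type u} [CommRing R]

namespace CatModule

variable {C : Type u} [Category.{u} C] [Preadditive C]

/-- Evaluation of modules at an object. -/
def evalFunctor (R : Type u) [CommRing R] (x : C) : CatModule R C ⥤ ModuleCat.{u} R where
  obj M := M.obj.obj (op x)
  map φ := φ.hom.app (op x)

instance (x : C) : (evalFunctor R x).Additive where

end CatModule

namespace OrbitCategory

open CatModule

/-- A transitive `G`-set as an object of the orbit category. -/
def of (x : TransitiveGSet F) : OrbitCategory F := x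

lemma of_surjective (y : OrbitCategory F) : ∃ x, of x = y := ⟨y, rfl⟩

/-- A `G`-map as a morphism of the orbit category. -/
def ofHom {x y : TransitiveGSet F} (f : x ⟶ y) : of x ⟶ of y :=
  (Finsupp.single f 1 : (x ⟶ y) →₀ ℤ)

lemma ofHom_id (x : TransitiveGSet F) : ofHom (𝟙 x) = 𝟙 (of x) := rfl

lemma ofHom_comp {x y z : TransitiveGSet F} (f : x ⟶ y) (g : y ⟶ z) :
    ofHom (f ≫ g) = ofHom f ≫ ofHom g := by
  refine Eq.symm ((Free.single_comp_single ℤ (TransitiveGSet F) f g 1 1).trans ?_)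
  rw [mul_one]
  rfl

/-- The `G`-maps form a basis of the morphisms of the orbit category. -/
def homBasis (x y : TransitiveGSet F) : Module.Basis (x.GMap y.carrier) ℤ (of x ⟶ of y) :=
  (Finsupp.basisSingleOne : Module.Basis (x ⟶ y) ℤ ((x ⟶ y) →₀ ℤ))

lemma homBasis_apply {x y : TransitiveGSet F} (f : x ⟶ y) : homBasis x y f = ofHom f :=
  congrFun (Finsupp.coe_basisSingleOne (R := ℤ) (ι := x ⟶ y)) f

variable (x : TransitiveGSet F)

/-- The action of the automorphisms of `x` on the value of a Bredon module at `x`. -/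
def rep (M : CatModule R (OrbitCategory F)) : Representation R (Aut x) (M.val (of x)) where
  toFun w := M.act (ofHom w.inv)
  map_one' := LinearMap.ext fun m => M.act_id m
  map_mul' w v := LinearMap.ext fun m => by
    have : (w * v).inv = w.inv ≫ v.inv := rfl
    rw [this, ofHom_comp, act_comp]
    rfl

lemma rep_apply (M : CatModule R (OrbitCategory F)) (w : Aut x) (m : M.val (of x)) :
    rep x M w m = M.act (ofHom w.inv) m := rfl

/-- Evaluation of Bredon modules at `x`, with the action of the automorphisms of `x`. -/
def evalRep (R : Type u) [CommRing R] (x : TransitiveGSet F) :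
    CatModule R (OrbitCategory F) ⥤ ModuleCat.{u} (MonoidAlgebra R (Aut x)) :=
  repFunctor (evalFunctor R (of x)) (fun M => rep x M) fun φ w v => app_act φ (ofHom w.inv) v

instance : (evalRep R x).Additive :=
  repFunctor_additive (evalFunctor R (of x)) (fun M => rep x M)
    fun φ w v => app_act φ (ofHom w.inv) v

lemma finite_stabilizer (y : TransitiveGSet F) (t : y.carrier) :
    Finite (MulAction.stabilizer G t) :=
  F.finite_of_mem (hasIsotropyIn_quotient y.mem t)

lemma moduleFP_freeModule (y : OrbitCategory F) (n : ℕ) :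
    ModuleFP (MonoidAlgebra R (Aut x)) n ((evalRep R x).obj (freeModule R y)) := by
  obtain ⟨y, rfl⟩ := of_surjective y
  let b : Module.Basis (x.GMap y.carrier) R ((freeModule R (of y)).val (of x)) :=
    Algebra.TensorProduct.basis R (homBasis x y)
  have hb : ∀ φ : x ⟶ y, b φ = freeElt (ofHom φ) := fun φ => by
    refine (Algebra.TensorProduct.basis_apply (homBasis x y) φ).trans ?_
    rw [homBasis_apply]
    rfl
  refine moduleFP_asModule (rep x (freeModule R (of y))) b (fun w φ => ?_)
    (x.finite_orbits_gmap (finite_stabilizer y)) (x.finite_stabilizer_gmap (finite_stabilizer y)) n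
  refine (congrArg _ (hb φ)).trans (Eq.trans ?_ (hb _).symm)
  rw [rep_apply, act_freeElt]
  exact congrArg freeElt (ofHom_comp w.inv (show x ⟶ y from φ)).symm

lemma isFG_of_finite (hF : FiniteUpToIso F) (M : CatModule R (OrbitCategory F))
    (h : ∀ x, Module.Finite (MonoidAlgebra R (Aut x)) ((evalRep R x).obj M)) : M.IsFG := by
  obtain ⟨k, t, ht⟩ := hF
  choose l m hm using fun i => exists_span_of_finite (rep (t i) M) (h (t i))
  refine isFG_of_generates (I := (i : Fin k) × Fin (l i))
    (x := fun p => of (t p.1)) (m := fun p => m p.1 p.2) fun y n => ?_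
  obtain ⟨y, rfl⟩ := of_surjective y
  obtain ⟨i, ⟨e⟩⟩ := ht y
  have hn : n = M.act (ofHom e.hom) (M.act (ofHom e.inv) n) := by
    rw [← act_comp, ← ofHom_comp, e.hom_inv_id, ofHom_id, act_id]
  rw [hn]
  suffices hle : Submodule.span R {v | ∃ j w, v = rep (t i) M w (m i j)} ≤
      (Submodule.span R _).comap (M.act (ofHom e.hom)) from hle (hm i _)
  refine Submodule.span_le.2 ?_
  rintro _ ⟨j, w, rfl⟩
  refine Submodule.subset_span ⟨⟨i, j⟩, ofHom e.hom ≫ ofHom w.inv, ?_⟩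
  rw [act_comp]
  rfl

/-- A Bredon module has type `FP_n` if and only if its values do, as modules over the group algebras
of the automorphism groups. -/
lemma isFP_iff (hF : FiniteUpToIso F) (M : CatModule R (OrbitCategory F)) (n : ℕ∞) :
    M.IsFP n ↔ ∀ (x : TransitiveGSet F) (k : ℕ), (k : ℕ∞) ≤ n →
      ModuleFP (MonoidAlgebra R (Aut x)) k ((evalRep R x).obj M) :=
  isFP_iff_moduleFP (fun x : TransitiveGSet F => MonoidAlgebra R (Aut x)) (fun x => evalRep R x)
    (fun _ => True) (fun _ _ => trivial) (fun _ _ _ _ => trivial)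
    (fun p _ _ _ x => kerIncl_injective p _)
    (fun p _ x m => ⟨fun h => exists_kerIncl p m h, by rintro ⟨k, rfl⟩; exact app_kerIncl p k⟩)
    (fun p hp x => hp _) moduleFP_freeModule (isFG_of_finite hF) trivial n

lemma finiteUpToIso_of_isFG {M : CatModule R (OrbitCategory F)} (h : M.IsFG)
    (hM : ∀ x, Nontrivial (M.val x)) : FiniteUpToIso F := by
  obtain ⟨k, t, m, hm⟩ := (isFG_iff M).1 h
  choose s hs using fun i => of_surjective (t i)
  obtain rfl : (fun i => of (s i)) = t := funext hs
  refine finiteUpToIso_of_hom s fun x => ?_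
  by_contra! hx
  have := hM (of x)
  obtain ⟨n, hn⟩ := exists_ne (0 : M.val (of x))
  refine hn ?_
  suffices hle : Submodule.span R {n | ∃ i, ∃ f : of x ⟶ of (s i), n = M.act f (m i)} ≤ ⊥ from
    hle (hm (of x) n)
  refine Submodule.span_le.2 ?_
  rintro _ ⟨i, f, rfl⟩
  have : IsEmpty (x.GMap (s i).carrier) := hx i
  have hf : f = 0 := (homBasis x (s i)).ext_elem fun φ => this.elim φ
  rw [hf, act_zero]
  rfl

lemma constant_act {x y : TransitiveGSet F} (f : x ⟶ y) (r : R) :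
    (constantBredonModule F R).act (ofHom f) r = r := by
  have h : OrbitCategory.augmentation F (of x) (of y) (ofHom f) = 1 :=
    Finsupp.liftAddHom_apply_single _ _ _
  change ((OrbitCategory.augmentation F (of x) (of y) (ofHom f)) • 𝟙 (ModuleCat.of R R)).hom r = r
  rw [h, one_smul]
  rfl

end OrbitCategory

end Bredon

/-! ### Restrictions and transfers -/

section Spans

variable {G : Type u} [Group G] {F : FiniteSubgroupFamily G}

section

variable {X Y Z : Type u} [MulAction G X] [MulAction G Y] [MulAction G Z]

/-- A basic span, as an element of the free abelian group on the basic morphisms. -/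
abbrev BasicSpan.cls (A : BasicSpan F X Y) : SpanHom F X Y :=
  Finsupp.single (⟦A⟧ : BasicMorphism F X Y) 1

lemma BasicSpan.cls_congr {A B : BasicSpan F X Y} (h : A ≈ B) : A.cls = B.cls := by
  rw [BasicSpan.cls, BasicSpan.cls, Quotient.sound h]

lemma SpanHom.induction {p : SpanHom F X Y → Prop} (f : SpanHom F X Y) (h0 : p 0)
    (hadd : ∀ f g, p f → p g → p (f + g))
    (hs : ∀ (r : ℤ) (A : BasicSpan F X Y), p (r • A.cls)) : p f := by
  refine Finsupp.induction_linear f h0 hadd fun a r => ?_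
  induction a using Quotient.inductionOn with | _ A
  have h : (Finsupp.single (⟦A⟧ : BasicMorphism F X Y) r : SpanHom F X Y) = r • A.cls := by
    rw [Finsupp.smul_single, smul_eq_mul, mul_one]
  rw [h]
  exact hs r A

/-- The transitive `G`-set at the apex of a basic span. -/
abbrev BasicSpan.apexObj (A : BasicSpan F X Y) : TransitiveGSet F := ⟨A.apex, A.mem⟩

/-- The composite of two basic spans is a basic span if the pullback is transitive. -/
lemma BasicSpan.spanComp_cls_of_bijective (A : BasicSpan F X Y) (B : BasicSpan F Y Z)
    (C : BasicSpan F X Z) (e : (G ⧸ C.apex) →[G] FiberProd A.right B.left)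
    (he : Function.Bijective e) (hl : ∀ t, A.left (FiberProd.fst A.right B.left (e t)) = C.left t)
    (hr : ∀ t, B.right (FiberProd.snd A.right B.left (e t)) = C.right t) :
    spanComp A.cls B.cls = C.cls :=
  (spanComp_single A B).trans
    ((spanClass_congr _ _ e he _ _ _ _ hl hr).symm.trans (spanClass_basic C))

/-- The composite of the transfer along `l` with a basic span. -/
lemma spanComp_transfer_left {s : TransitiveGSet F} (l : s.carrier →[G] X)
    (B : BasicSpan F s.carrier Y) :
    spanComp (BasicSpan.mk s.subgroup s.mem l (MulActionHom.id G)).cls B.cls =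
      (BasicSpan.mk B.apex B.mem (l.comp B.left) B.right).cls := by
  refine BasicSpan.spanComp_cls_of_bijective _ _ _
    ⟨fun t => ⟨(B.left t, t), rfl⟩, fun g t => Subtype.ext (Prod.ext (map_smul B.left g t) rfl)⟩
    ⟨fun t t' h => congrArg (fun p => p.1.2) h, ?_⟩ (fun _ => rfl) (fun _ => rfl)
  rintro ⟨⟨a, b⟩, h⟩
  have h : a = B.left b := h
  exact ⟨b, Subtype.ext (Prod.ext h.symm rfl)⟩

/-- The composite of a basic span with a `G`-map. -/
lemma spanComp_restriction_right {s : TransitiveGSet F} (A : BasicSpan F X s.carrier)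
    (r : s.carrier →[G] Y) :
    spanComp A.cls (BasicSpan.mk s.subgroup s.mem (MulActionHom.id G) r).cls =
      (BasicSpan.mk A.apex A.mem A.left (r.comp A.right)).cls := by
  refine BasicSpan.spanComp_cls_of_bijective _ _ _
    ⟨fun t => ⟨(t, A.right t), rfl⟩, fun g t => Subtype.ext (Prod.ext rfl (map_smul A.right g t))⟩
    ⟨fun t t' h => congrArg (fun p => p.1.1) h, ?_⟩ (fun _ => rfl) (fun _ => rfl)
  rintro ⟨⟨a, b⟩, h⟩
  have h : A.right a = b := h
  exact ⟨a, Subtype.ext (Prod.ext rfl h)⟩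

end

namespace MackeyCategory

/-- A transitive `G`-set as an object of the Mackey category. -/
def of (x : TransitiveGSet F) : MackeyCategory F := ⟨x.subgroup, x.mem⟩

lemma of_surjective (y : MackeyCategory F) : ∃ x, of x = y := ⟨⟨y.subgroup, y.mem⟩, rfl⟩

variable {x y z : TransitiveGSet F}

/-- An integral combination of basic morphisms as a morphism of the Mackey category. -/
def ofSpan (s : SpanHom F x.carrier y.carrier) : of x ⟶ of y := s

/-- A basic span as a morphism of the Mackey category. -/
def basic (A : BasicSpan F x.carrier y.carrier) : of x ⟶ of y := ofSpan A.cls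

/-- The transfer along a `G`-map. -/
def trHom (f : x ⟶ y) : of y ⟶ of x :=
  basic ⟨x.subgroup, x.mem, TransitiveGSet.toGMap f, MulActionHom.id G⟩

/-- The restriction along a `G`-map. -/
def resHom (f : x ⟶ y) : of x ⟶ of y :=
  basic ⟨x.subgroup, x.mem, MulActionHom.id G, TransitiveGSet.toGMap f⟩

lemma trHom_id : trHom (𝟙 x) = 𝟙 (of x) := rfl

lemma trHom_comp (f : x ⟶ y) (g : y ⟶ z) : trHom (f ≫ g) = trHom g ≫ trHom f :=
  (congrArg ofSpan (spanComp_transfer_left (s := y) (TransitiveGSet.toGMap g)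
    ⟨x.subgroup, x.mem, TransitiveGSet.toGMap f, MulActionHom.id G⟩)).symm

lemma basic_eq (A : BasicSpan F x.carrier y.carrier) :
    basic A = trHom (x := A.apexObj) A.left ≫ resHom (x := A.apexObj) A.right :=
  (congrArg ofSpan (spanComp_transfer_left (s := A.apexObj) A.left
    ⟨A.apex, A.mem, MulActionHom.id G, A.right⟩)).symm

lemma hom_induction {p : (of x ⟶ of y) → Prop} (f : of x ⟶ of y) (h0 : p 0)
    (hadd : ∀ f g, p f → p g → p (f + g)) (hs : ∀ (r : ℤ) A, p (r • basic A)) : p f :=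
  SpanHom.induction (p := p) (f : SpanHom F x.carrier y.carrier) h0 hadd hs

end MackeyCategory

end Spans

/-! ### Modules of spans -/

section SpanModule

variable {G : Type u} [Group G] {F : FiniteSubgroupFamily G} (R : Type u) [CommRing R]
  (Y : Type u) [MulAction G Y]

open CatModule MackeyCategory

variable (F) in
/-- The Mackey functor `R[-, Y]` of spans to an arbitrary `G`-set `Y`. For `Y = G/K` with `K` in the
family it is the free module on `G/K`, for `Y = G/G` it is the Burnside functor. -/
def spanModule : CatModule R (MackeyCategory F) where
  obj :=
    { obj := fun H => ModuleCat.of R (R ⊗[ℤ] SpanHom F (G ⧸ H.unop.subgroup) Y)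
      map := fun f => ModuleCat.ofHom ((precomp F f.unop Y).baseChange R)
      map_id := fun H => by
        rw [unop_id, precomp_id, LinearMap.baseChange_id]
        rfl
      map_comp := fun f g => by
        rw [unop_comp, precomp_comp, LinearMap.baseChange_comp]
        rfl }
  property :=
    { map_add := fun {_ _ f g} => by
        change ModuleCat.ofHom ((precomp F (f.unop + g.unop) _).baseChange R) = _
        rw [precomp_add, LinearMap.baseChange_add]
        rfl }

lemma freeModule_eq (y : TransitiveGSet F) : freeModule R (of y) = spanModule F R y.carrier := rfl

variable {R Y} {x y : TransitiveGSet F}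

/-- The element of the module of spans given by an integral combination of basic morphisms. -/
def spanElt : SpanHom F x.carrier Y →+ (spanModule F R Y).val (of x) :=
  (TensorProduct.mk ℤ R (SpanHom F x.carrier Y) 1).toAddMonoidHom

lemma act_spanElt (s : SpanHom F x.carrier y.carrier) (t : SpanHom F y.carrier Y) :
    (spanModule F R Y).act (ofSpan s) (spanElt t) = spanElt (spanComp s t) :=
  rfl

lemma spanModule_linearMap_ext {V : Type u} [AddCommGroup V] [Module R V]
    {φ ψ : (spanModule F R Y).val (of x) →ₗ[R] V}
    (h : ∀ A : BasicSpan F x.carrier Y, φ (spanElt A.cls) = ψ (spanElt A.cls)) : φ = ψ := by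
  have h' : ∀ t : SpanHom F x.carrier Y, φ (spanElt t) = ψ (spanElt t) := fun t => by
    refine SpanHom.induction (p := fun t => φ (spanElt t) = ψ (spanElt t)) t ?_ ?_ ?_
    · rw [map_zero, map_zero, map_zero]
    · intro s t hs ht
      rw [map_add, map_add, map_add, hs, ht]
    · intro r A
      rw [map_zsmul, map_zsmul, map_zsmul, h]
  exact TensorProduct.AlgebraTensorModule.curry_injective (LinearMap.ext_ring (LinearMap.ext h'))

/-- The linear map from a value of the module of spans with given values on basic morphisms. -/
def spanElim {V : Type u} [AddCommGroup V] [Module R V] (c : BasicMorphism F x.carrier Y → V) :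
    (spanModule F R Y).val (of x) →ₗ[R] V :=
  LinearMap.liftBaseChange R (Finsupp.linearCombination ℤ c)

lemma spanElim_elt {V : Type u} [AddCommGroup V] [Module R V]
    (c : BasicMorphism F x.carrier Y → V) (A : BasicSpan F x.carrier Y) :
    spanElim c (spanElt (R := R) A.cls) = c ⟦A⟧ := by
  refine (LinearMap.liftBaseChange_tmul R (Finsupp.linearCombination ℤ c) 1 A.cls).trans ?_
  rw [one_smul, Finsupp.linearCombination_single, one_smul]

lemma act_basic_spanElt (A : BasicSpan F x.carrier y.carrier) (B : BasicSpan F y.carrier Y) :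
    (spanModule F R Y).act (basic A) (spanElt B.cls) = spanElt (A.comp B) := by
  rw [basic, act_spanElt, BasicSpan.cls, BasicSpan.cls, spanComp_single]

end SpanModule

/-! ### Maps of Mackey functors over a finite subgroup -/

section Local

variable {G : Type u} [Group G] {F : FiniteSubgroupFamily G} {R : Type u} [CommRing R]

open CatModule MackeyCategory TransitiveGSet

/-- For `x = G/H`, a homomorphism between the restrictions to `H` of two Mackey functors: a family
of linear maps, indexed by the `G`-sets `s` over `G/H`, that is compatible with the basic spans
over `G/H`. -/
structure LocalHom (x : TransitiveGSet F) (M N : CatModule R (MackeyCategory F)) where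
  /-- The component at a `G`-set over `x`. -/
  toFun : ∀ {s : TransitiveGSet F} (_ : s ⟶ x), M.val (of s) →ₗ[R] N.val (of s)
  comm : ∀ {s t : TransitiveGSet F} (a : s ⟶ x) (b : t ⟶ x) (A : BasicSpan F s.carrier t.carrier),
    (∀ i, toGMap a (A.left i) = toGMap b (A.right i)) →
    ∀ m, toFun a (M.act (basic A) m) = N.act (basic A) (toFun b m)

namespace LocalHom

variable {x : TransitiveGSet F} {M N K : CatModule R (MackeyCategory F)}

/-- The restriction of a homomorphism of Mackey functors. -/
def ofHom (x : TransitiveGSet F) (φ : M ⟶ N) : LocalHom x M N where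
  toFun {s} _ := app φ (of s)
  comm _ _ A _ m := app_act φ (basic A) m

/-- The composition of local homomorphisms. -/
def comp (g : LocalHom x N K) (f : LocalHom x M N) : LocalHom x M K where
  toFun a := g.toFun a ∘ₗ f.toFun a
  comm a b A h m := by
    rw [LinearMap.comp_apply, f.comm a b A h, g.comm a b A h]
    rfl

end LocalHom

/-- Mackey functors whose restriction to every `H` in the family is projective, in the sense that
local homomorphisms lift along surjections of Mackey functors. -/
def LocallyProjective (M : CatModule R (MackeyCategory F)) : Prop :=
  ∀ (x : TransitiveGSet F) {X K : CatModule R (MackeyCategory F)} (q : X ⟶ K),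
    (∀ s, Function.Surjective (app q s)) → ∀ f : LocalHom x M K, ∃ g : LocalHom x M X,
      ∀ {s : TransitiveGSet F} (a : s ⟶ x) m, app q (of s) (g.toFun a m) = f.toFun a m

namespace LocallyProjective

variable {M P : CatModule R (MackeyCategory F)}

/-- A surjection onto a locally projective Mackey functor splits locally: there is a local
retraction onto the kernel. -/
lemma exists_retraction (hM : LocallyProjective M) (p : P ⟶ M)
    (hp : ∀ s, Function.Surjective (app p s)) (x : TransitiveGSet F) :
    ∃ r : LocalHom x P (ker p), ∀ {s : TransitiveGSet F} (a : s ⟶ x) k,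
      r.toFun a (app (kerIncl p) (of s) k) = k := by
  obtain ⟨σ, hσ⟩ := hM x p hp (LocalHom.ofHom x (𝟙 M))
  have hσ : ∀ {s : TransitiveGSet F} (a : s ⟶ x) m, app p (of s) (σ.toFun a m) = m := hσ
  let ρ : ∀ {s : TransitiveGSet F} (_ : s ⟶ x), P.val (of s) →ₗ[R] (CatModule.ker p).val (of s) :=
    fun {s} a => (LinearMap.id - σ.toFun a ∘ₗ app p (of s)).codRestrict
      (LinearMap.ker (app p (of s))) fun m => by
        rw [LinearMap.mem_ker, LinearMap.sub_apply, map_sub, LinearMap.comp_apply, hσ,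
          LinearMap.id_apply, sub_self]
  have hρ : ∀ {s : TransitiveGSet F} (a : s ⟶ x) m,
      app (kerIncl p) (of s) (ρ a m) = m - σ.toFun a (app p (of s) m) := fun _ _ => rfl
  refine ⟨⟨ρ, ?_⟩, ?_⟩
  · intro s t a b A h m
    refine kerIncl_injective p _ ?_
    rw [app_act, hρ, hρ, app_act, σ.comm a b A h, map_sub]
  · intro s a k
    refine kerIncl_injective p _ ?_
    change app (kerIncl p) (of s) (ρ a (app (kerIncl p) (of s) k)) = _
    rw [hρ, app_kerIncl, map_zero, sub_zero]

lemma ker (hM : LocallyProjective M) (hP : LocallyProjective P) (p : P ⟶ M)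
    (hp : ∀ s, Function.Surjective (app p s)) : LocallyProjective (CatModule.ker p) := by
  intro x X K q hq f
  obtain ⟨r, hr⟩ := hM.exists_retraction p hp x
  obtain ⟨g, hg⟩ := hP x q hq (f.comp r)
  refine ⟨g.comp (LocalHom.ofHom x (kerIncl p)), fun {s} a k => (hg a _).trans ?_⟩
  exact congrArg (f.toFun a) (hr a k)

lemma of_retract (hM : LocallyProjective M) (i : P ⟶ M) (r : M ⟶ P) (h : i ≫ r = 𝟙 P) :
    LocallyProjective P := by
  intro x X K q hq f
  obtain ⟨g, hg⟩ := hM x q hq (f.comp (LocalHom.ofHom x r))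
  refine ⟨g.comp (LocalHom.ofHom x i), fun {s} a m => (hg a _).trans ?_⟩
  refine congrArg (f.toFun a) ?_
  change app r (of s) (app i (of s) m) = m
  rw [← app_comp, h, app_id]

lemma directSum {I : Type u} {M : I → CatModule R (MackeyCategory F)}
    (hM : ∀ i, LocallyProjective (M i)) : LocallyProjective (CatModule.directSum M) := by
  intro x X K q hq f
  choose g hg using fun i => hM i x q hq (f.comp (LocalHom.ofHom x (directSumIncl M i)))
  refine ⟨⟨fun a => directSumElim fun i => (g i).toFun a, fun {s t} a b A h m => ?_⟩,
    fun {s} a m => ?_⟩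
  · refine LinearMap.congr_fun (directSum_linearMap_ext
      (f := (directSumElim fun i => (g i).toFun a) ∘ₗ (CatModule.directSum M).act (basic A))
      (g := X.act (basic A) ∘ₗ directSumElim fun i => (g i).toFun b) fun i m => ?_) m
    rw [LinearMap.comp_apply, LinearMap.comp_apply, ← app_act, directSumElim_incl,
      directSumElim_incl, (g i).comm a b A h]
  · refine LinearMap.congr_fun (directSum_linearMap_ext
      (f := app q (of s) ∘ₗ directSumElim fun i => (g i).toFun a) (g := f.toFun a)
      fun i m => ?_) m
    rw [LinearMap.comp_apply, directSumElim_incl]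
    exact hg i a m

section SpanModule

variable (Y : Type u) [MulAction G Y] (x : TransitiveGSet F)

lemma hasIsotropyIn_prod : HasIsotropyIn F (x.carrier × Y) :=
  (hasIsotropyIn_quotient x.mem).of_map
    (⟨Prod.fst, fun _ _ => rfl⟩ : x.carrier × Y →[G] x.carrier)

variable {Y x}

/-- The representative of an orbit of `x × Y`, as a transitive `G`-set. -/
def orbitObj (o : MulAction.orbitRel.Quotient G (x.carrier × Y)) : TransitiveGSet F :=
  ⟨MulAction.stabilizer G o.out, hasIsotropyIn_prod Y x o.out⟩

/-- The inclusion of an orbit of `x × Y`. -/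
def orbitIncl (o : MulAction.orbitRel.Quotient G (x.carrier × Y)) :
    (orbitObj o).carrier →[G] x.carrier × Y :=
  orbitMap o.out

lemma orbitIncl_injective (o : MulAction.orbitRel.Quotient G (x.carrier × Y)) :
    Function.Injective (orbitIncl o) :=
  orbitMap_injective _

/-- The first projection of an orbit of `x × Y`. -/
def orbitFst (o : MulAction.orbitRel.Quotient G (x.carrier × Y)) : orbitObj o ⟶ x :=
  ofGMap ((⟨Prod.fst, fun _ _ => rfl⟩ : x.carrier × Y →[G] x.carrier).comp (orbitIncl o))

/-- The second projection of an orbit of `x × Y`. -/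
def orbitSnd (o : MulAction.orbitRel.Quotient G (x.carrier × Y)) : (orbitObj o).carrier →[G] Y :=
  (⟨Prod.snd, fun _ _ => rfl⟩ : x.carrier × Y →[G] Y).comp (orbitIncl o)

lemma orbitIncl_eq_iff (o : MulAction.orbitRel.Quotient G (x.carrier × Y))
    (i : (orbitObj o).carrier) (p : x.carrier × Y) :
    orbitIncl o i = p ↔ toGMap (orbitFst o) i = p.1 ∧ orbitSnd o i = p.2 :=
  Prod.ext_iff

/-- A map from a transitive `G`-set to `x × Y` factors through an orbit. -/
lemma exists_orbit_lift {s : TransitiveGSet F} (u : s.carrier →[G] x.carrier × Y) :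
    ∃ (o : MulAction.orbitRel.Quotient G (x.carrier × Y))
      (v : s.carrier →[G] (orbitObj o).carrier), ∀ i, orbitIncl o (v i) = u i := by
  let i₀ : s.carrier := ((1 : G) : G ⧸ s.subgroup)
  obtain ⟨g, hg⟩ := Quotient.mk_out (s := MulAction.orbitRel G (x.carrier × Y)) (u i₀)
  have hg : g • u i₀ = (⟦u i₀⟧ : MulAction.orbitRel.Quotient G (x.carrier × Y)).out := hg
  let o : MulAction.orbitRel.Quotient G (x.carrier × Y) := ⟦u i₀⟧
  let j : (orbitObj o).carrier := ((g⁻¹ : G) : G ⧸ MulAction.stabilizer G o.out)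
  have hj : orbitIncl o j = u i₀ := by
    refine (orbitMap_mk o.out g⁻¹).trans ?_
    rw [inv_smul_eq_iff]
    exact hg.symm
  have hstab : MulAction.stabilizer G i₀ ≤ MulAction.stabilizer G j := fun k hk => by
    rw [MulAction.mem_stabilizer_iff] at hk ⊢
    refine orbitIncl_injective o ?_
    rw [map_smul, hj, ← map_smul, hk]
  obtain ⟨v, hv⟩ := exists_gmap i₀ j hstab
  have h : (orbitIncl o).comp v = u := by
    refine gmap_ext i₀ ?_
    change orbitIncl o (v i₀) = u i₀
    rw [hv, hj]
  exact ⟨o, v, fun i => congrArg (fun f : s.carrier →[G] x.carrier × Y => f i) h⟩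

/-- A factorisation of a basic span `s ⟵ G/L ⟶ Y` over `x` through an orbit of `x × Y`. -/
structure OrbitLift {s : TransitiveGSet F} (a : s ⟶ x) (A : BasicSpan F s.carrier Y) where
  /-- The orbit. -/
  orbit : MulAction.orbitRel.Quotient G (x.carrier × Y)
  /-- The map to the orbit. -/
  map : (G ⧸ A.apex) →[G] (orbitObj orbit).carrier
  fst : ∀ i, toGMap (orbitFst orbit) (map i) = toGMap a (A.left i)
  snd : ∀ i, orbitSnd orbit (map i) = A.right i

lemma nonempty_orbitLift {s : TransitiveGSet F} (a : s ⟶ x) (A : BasicSpan F s.carrier Y) :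
    Nonempty (OrbitLift a A) := by
  obtain ⟨o, v, h⟩ := exists_orbit_lift (s := A.apexObj) (x := x) (Y := Y)
    ⟨fun i => (toGMap a (A.left i), A.right i), fun g i =>
      Prod.ext (by rw [map_smul, map_smul]; rfl) (map_smul A.right g i)⟩
  exact ⟨⟨o, v, fun i => ((orbitIncl_eq_iff o _ _).1 (h i)).1,
    fun i => ((orbitIncl_eq_iff o _ _).1 (h i)).2⟩⟩

/-- The basic span from `s` to the orbit. -/
def OrbitLift.span {s : TransitiveGSet F} {a : s ⟶ x} {A : BasicSpan F s.carrier Y}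
    (L : OrbitLift a A) : BasicSpan F s.carrier (orbitObj L.orbit).carrier :=
  ⟨A.apex, A.mem, A.left, L.map⟩

variable {X : CatModule R (MackeyCategory F)}
  (ξ : ∀ o : MulAction.orbitRel.Quotient G (x.carrier × Y), X.val (of (orbitObj o)))

/-- The value attached to a basic span only depends on its class, and not on the factorisation. -/
lemma OrbitLift.act_eq {s : TransitiveGSet F} {a : s ⟶ x} {A B : BasicSpan F s.carrier Y}
    (L : OrbitLift a A) (L' : OrbitLift a B) (h : A ≈ B) :
    X.act (basic L.span) (ξ L.orbit) = X.act (basic L'.span) (ξ L'.orbit) := by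
  obtain ⟨o, v, h₁, h₂⟩ := L
  obtain ⟨o', v', h₁', h₂'⟩ := L'
  obtain ⟨σ, hσ, hl, hr⟩ := h
  have key : ∀ i, orbitIncl o' (v' (σ i)) = orbitIncl o (v i) := fun i => by
    rw [orbitIncl_eq_iff]
    exact ⟨(h₁' _).trans ((congrArg _ (hl i)).trans (h₁ i).symm),
      (h₂' _).trans ((hr i).trans (h₂ i).symm)⟩
  have horb : ∀ (o : MulAction.orbitRel.Quotient G (x.carrier × Y)) i,
      ⟦orbitIncl o i⟧ = o := fun o i => by
    obtain ⟨g, rfl⟩ := QuotientGroup.mk_surjective i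
    conv_rhs => rw [← Quotient.out_eq o]
    exact Quotient.sound ⟨g, rfl⟩
  obtain rfl : o = o' := by
    rw [← horb o (v ((1 : G) : G ⧸ A.apex)), ← key, horb]
  refine congrArg (fun f => X.act f (ξ o)) (congrArg ofSpan (BasicSpan.cls_congr ?_))
  exact ⟨σ, hσ, hl, fun i => orbitIncl_injective o (key i)⟩

/-- The component of the local homomorphism `orbitLocalHom`: a basic span is factored through an
orbit of `x × Y`, and the resulting span to the orbit acts on the element attached to that orbit. -/
def orbitElim {s : TransitiveGSet F} (a : s ⟶ x) :
    (spanModule F R Y).val (of s) →ₗ[R] X.val (of s) :=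
  spanElim (Quotient.lift
    (fun A => X.act (basic (nonempty_orbitLift a A).some.span)
      (ξ (nonempty_orbitLift a A).some.orbit))
    fun A B h => (nonempty_orbitLift a A).some.act_eq ξ (nonempty_orbitLift a B).some h)

lemma orbitElim_elt {s : TransitiveGSet F} {a : s ⟶ x} {A : BasicSpan F s.carrier Y}
    (L : OrbitLift a A) :
    orbitElim ξ a (spanElt (R := R) A.cls) = X.act (basic L.span) (ξ L.orbit) :=
  (spanElim_elt _ A).trans ((nonempty_orbitLift a A).some.act_eq ξ L (Setoid.refl A))

/-- The formula for `orbitElim` extends from basic spans to spans of `G`-sets with finitely many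
orbits, provided that these map to a single orbit of `x × Y`. -/
lemma orbitElim_spanClass {s : TransitiveGSet F} (a : s ⟶ x) {T : Type u} [MulAction G T]
    [Finite (MulAction.orbitRel.Quotient G T)] (hT : HasIsotropyIn F T) (l : T →[G] s.carrier)
    (r : T →[G] Y) (o : MulAction.orbitRel.Quotient G (x.carrier × Y))
    (r' : T →[G] (orbitObj o).carrier) (h₁ : ∀ i, toGMap (orbitFst o) (r' i) = toGMap a (l i))
    (h₂ : ∀ i, orbitSnd o (r' i) = r i) :
    orbitElim ξ a (spanElt (R := R) (spanClass hT l r)) =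
      X.act (ofSpan (spanClass hT l r')) (ξ o) := by
  have := Fintype.ofFinite (MulAction.orbitRel.Quotient G T)
  have hsum : X.act (ofSpan (spanClass hT l r')) (ξ o) =
      ∑ p, X.act (ofSpan (Finsupp.single (orbitClass hT l r' p) 1)) (ξ o) := by
    rw [spanClass, finsum_eq_sum_of_fintype]
    refine (congrArg (fun φ => φ (ξ o)) (map_sum (X.actHom (of s) (of (orbitObj o)))
      (fun p => ofSpan (Finsupp.single (orbitClass hT l r' p) 1)) Finset.univ)).trans ?_
    rw [LinearMap.sum_apply]
    rfl
  rw [hsum, spanClass, finsum_eq_sum_of_fintype, map_sum, map_sum]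
  refine Finset.sum_congr rfl fun p _ => ?_
  induction p using Quotient.inductionOn with | _ t
  exact orbitElim_elt ξ (A := BasicSpan.ofPoint hT l r t)
    ⟨o, r'.comp (orbitMap t), fun i => h₁ _, fun i => h₂ _⟩

/-- The local homomorphism from the module of spans that is given by elements attached to the orbits
of `x × Y`. -/
def orbitLocalHom : LocalHom x (spanModule F R Y) X where
  toFun a := orbitElim ξ a
  comm {s t} a b A h m := by
    refine LinearMap.congr_fun (spanModule_linearMap_ext
      (φ := orbitElim ξ a ∘ₗ (spanModule F R Y).act (basic A))
      (ψ := X.act (basic A) ∘ₗ orbitElim ξ b) fun B => ?_) m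
    obtain ⟨L⟩ := nonempty_orbitLift b B
    have := BasicSpan.finite_orbits (hasIsotropyIn_quotient t.mem) A B
    rw [LinearMap.comp_apply, LinearMap.comp_apply, act_basic_spanElt, orbitElim_elt ξ L,
      ← act_comp]
    refine (orbitElim_spanClass ξ a _ _ _ L.orbit (L.map.comp (FiberProd.snd A.right B.left))
      (fun i => ?_) fun i => L.snd _).trans ?_
    · refine (L.fst _).trans (Eq.trans ?_ (h _).symm)
      exact congrArg (toGMap b) i.2.symm
    · refine congrArg (fun f => X.act f (ξ L.orbit)) ?_
      exact congrArg ofSpan (spanComp_single A L.span).symm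

/-- The module of spans to a `G`-set `Y` is locally projective: over `G/H`, it is the sum of the
free modules on the orbits of `G/H × Y`. -/
lemma spanModule (Y : Type u) [MulAction G Y] : LocallyProjective (spanModule F R Y) := by
  intro x X K q hq f
  choose ξ hξ using fun o : MulAction.orbitRel.Quotient G (x.carrier × Y) => hq (of (orbitObj o))
    (f.toFun (orbitFst o) (spanElt (BasicSpan.mk (orbitObj o).subgroup (orbitObj o).mem
      (MulActionHom.id G) (orbitSnd o)).cls))
  refine ⟨orbitLocalHom ξ, fun {s} a m => ?_⟩
  refine LinearMap.congr_fun (spanModule_linearMap_ext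
    (φ := app q (of s) ∘ₗ orbitElim ξ a) (ψ := f.toFun a) fun B => ?_) m
  obtain ⟨L⟩ := nonempty_orbitLift a B
  rw [LinearMap.comp_apply, orbitElim_elt ξ L, app_act, hξ,
    ← f.comm a (orbitFst L.orbit) L.span fun i => (L.fst i).symm]
  congr 1
  refine (act_spanElt _ _).trans (congrArg spanElt ?_)
  refine (spanComp_restriction_right L.span (orbitSnd L.orbit)).trans ?_
  have : (orbitSnd L.orbit).comp L.span.right = B.right := MulActionHom.ext L.snd
  rw [this]
  rfl

end SpanModule

lemma of_projective (hP : Projective P) : LocallyProjective P := by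
  obtain ⟨I, y, p, hp⟩ := P.exists_free_cover
  have : Epi p := epi_of_surjective p hp
  refine (directSum fun i => ?_).of_retract (Projective.factorThru (𝟙 P) p) p
    (Projective.factorThru_comp _ _)
  obtain ⟨z, hz⟩ := of_surjective (y i)
  rw [← hz, freeModule_eq]
  exact spanModule z.carrier

end LocallyProjective

end Local

/-! ### Brauer quotients of Mackey functors -/

section Brauer

variable {G : Type u} [Group G] {F : FiniteSubgroupFamily G} {R : Type u} [CommRing R]

namespace MackeyCategory

open CatModule TransitiveGSet

/-- The submodule of the value at `x` that is generated by the proper transfers: the transfers along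
maps to `x` that are not injective. -/
def brauerSub (M : CatModule R (MackeyCategory F)) (x : TransitiveGSet F) :
    Submodule R (M.val (of x)) :=
  Submodule.span R {m | ∃ (s : TransitiveGSet F) (l : s ⟶ x) (n : M.val (of s)),
    ¬ Function.Injective (toGMap l) ∧ m = M.act (trHom l) n}

variable {M N P : CatModule R (MackeyCategory F)} {x y : TransitiveGSet F}

lemma act_trHom_mem_brauerSub {s : TransitiveGSet F} {l : s ⟶ x}
    (hl : ¬ Function.Injective (toGMap l)) (n : M.val (of s)) :
    M.act (trHom l) n ∈ brauerSub M x :=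
  Submodule.subset_span ⟨s, l, n, hl, rfl⟩

lemma brauerSub_le {S : Submodule R (M.val (of x))}
    (h : ∀ (s : TransitiveGSet F) (l : s ⟶ x) (n : M.val (of s)),
      ¬ Function.Injective (toGMap l) → M.act (trHom l) n ∈ S) : brauerSub M x ≤ S := by
  refine Submodule.span_le.2 ?_
  rintro _ ⟨s, l, n, hl, rfl⟩
  exact h s l n hl

lemma brauerSub_le_comap_app (φ : M ⟶ N) :
    brauerSub M x ≤ (brauerSub N x).comap (app φ (of x)) :=
  brauerSub_le fun s l n hl => by
    rw [Submodule.mem_comap, app_act]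
    exact act_trHom_mem_brauerSub hl _

lemma brauerSub_le_comap_act (f : x ⟶ y) :
    brauerSub M x ≤ (brauerSub M y).comap (M.act (trHom f)) :=
  brauerSub_le fun s l n hl => by
    rw [Submodule.mem_comap, ← act_comp, ← trHom_comp]
    refine act_trHom_mem_brauerSub (fun h => hl ?_) n
    exact Function.Injective.of_comp (f := toGMap f) h

/-- The Brauer quotient of a Mackey functor at `x`: the value at `x` modulo proper transfers. -/
def brauerFunctor (R : Type u) [CommRing R] (x : TransitiveGSet F) :
    CatModule R (MackeyCategory F) ⥤ ModuleCat.{u} R where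
  obj M := ModuleCat.of R (M.val (of x) ⧸ brauerSub M x)
  map φ := ModuleCat.ofHom ((brauerSub _ x).mapQ (brauerSub _ x) (app φ (of x))
    (brauerSub_le_comap_app φ))
  map_id _ := ModuleCat.hom_ext (Submodule.linearMap_qext _ rfl)
  map_comp _ _ := ModuleCat.hom_ext (Submodule.linearMap_qext _ rfl)

instance : (brauerFunctor R x).Additive where
  map_add := ModuleCat.hom_ext (Submodule.linearMap_qext _ rfl)

variable (x) in
/-- The action of the automorphisms of `x` on the Brauer quotient at `x`. -/
def brauerAction (M : CatModule R (MackeyCategory F)) :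
    Representation R (Aut x) (M.val (of x) ⧸ brauerSub M x) where
  toFun w := (brauerSub M x).mapQ (brauerSub M x) (M.act (trHom w.hom))
    (brauerSub_le_comap_act w.hom)
  map_one' := Submodule.linearMap_qext _ (LinearMap.ext fun m =>
    congrArg (brauerSub M x).mkQ (M.act_id m))
  map_mul' w v := Submodule.linearMap_qext _ (LinearMap.ext fun m => by
    refine congrArg (brauerSub M x).mkQ ?_
    have : (w * v).hom = v.hom ≫ w.hom := rfl
    rw [this, trHom_comp, act_comp])

lemma brauerAction_mk (w : Aut x) (m : M.val (of x)) :
    brauerAction x M w ((brauerSub M x).mkQ m) = (brauerSub M x).mkQ (M.act (trHom w.hom) m) :=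
  rfl

lemma brauerFunctor_map_brauerAction (φ : M ⟶ N) (w : Aut x)
    (v : (brauerFunctor R x).obj M) : ((brauerFunctor R x).map φ).hom (brauerAction x M w v) =
      brauerAction x N w (((brauerFunctor R x).map φ).hom v) := by
  obtain ⟨m, rfl⟩ := (brauerSub M x).mkQ_surjective v
  exact congrArg (brauerSub N x).mkQ (app_act φ (trHom w.hom) m)

/-- The Brauer quotient at `x`, with the action of the automorphisms of `x`. -/
def brauerRep (R : Type u) [CommRing R] (x : TransitiveGSet F) :
    CatModule R (MackeyCategory F) ⥤ ModuleCat.{u} (MonoidAlgebra R (Aut x)) :=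
  repFunctor (brauerFunctor R x) (fun M => brauerAction x M) brauerFunctor_map_brauerAction

instance : (brauerRep R x).Additive :=
  repFunctor_additive (brauerFunctor R x) (fun M => brauerAction x M) brauerFunctor_map_brauerAction

lemma brauerRep_map_mk (φ : M ⟶ N) (m : M.val (of x)) :
    ((brauerRep R x).map φ).hom ((brauerSub M x).mkQ m) = (brauerSub N x).mkQ (app φ (of x) m) :=
  rfl

lemma brauerRep_map_surjective (p : P ⟶ M) (hp : ∀ y, Function.Surjective (app p y))
    (x : TransitiveGSet F) : Function.Surjective ((brauerRep R x).map p).hom := fun v => by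
  obtain ⟨m, rfl⟩ := (brauerSub M x).mkQ_surjective v
  obtain ⟨n, rfl⟩ := hp _ m
  exact ⟨(brauerSub P x).mkQ n, rfl⟩

lemma brauerRep_map_exact (p : P ⟶ M) (hp : ∀ y, Function.Surjective (app p y))
    (x : TransitiveGSet F) :
    Function.Exact ((brauerRep R x).map (kerIncl p)).hom ((brauerRep R x).map p).hom := by
  intro v
  constructor
  · intro hv
    obtain ⟨m, rfl⟩ := (brauerSub P x).mkQ_surjective v
    have hle : brauerSub M x ≤ (brauerSub P x).map (app p (of x)) := brauerSub_le fun s l n hl => by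
      obtain ⟨n, rfl⟩ := hp _ n
      exact ⟨P.act (trHom l) n, act_trHom_mem_brauerSub hl n, app_act p (trHom l) n⟩
    obtain ⟨b, hb, hbm⟩ := hle ((Submodule.Quotient.mk_eq_zero (brauerSub M x)).1 hv)
    obtain ⟨k, hk⟩ := exists_kerIncl p (m - b) (by rw [map_sub, hbm, sub_self])
    refine ⟨(brauerSub (ker p) x).mkQ k, (brauerRep_map_mk (kerIncl p) k).trans ?_⟩
    refine (Submodule.Quotient.eq (brauerSub P x)).2 ?_
    rw [hk, sub_sub_cancel_left]
    exact neg_mem hb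
  · rintro ⟨k, rfl⟩
    obtain ⟨k, rfl⟩ := (brauerSub (ker p) x).mkQ_surjective k
    refine (congrArg (brauerSub M x).mkQ (app_kerIncl p k)).trans ?_
    rw [map_zero]
    rfl

/-- Brauer quotients preserve injectivity of the kernel of a surjection onto a locally projective
Mackey functor, since a local retraction is compatible with transfers. -/
lemma brauerRep_map_kerIncl_injective (p : P ⟶ M) (hp : ∀ y, Function.Surjective (app p y))
    (hM : LocallyProjective M) (x : TransitiveGSet F) :
    Function.Injective ((brauerRep R x).map (kerIncl p)).hom := by
  refine (injective_iff_map_eq_zero _).2 fun v hv => ?_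
  obtain ⟨k, rfl⟩ := (brauerSub (ker p) x).mkQ_surjective v
  obtain ⟨r, hr⟩ := hM.exists_retraction p hp x
  have hle : brauerSub P x ≤ (brauerSub (ker p) x).comap (r.toFun (𝟙 x)) :=
    brauerSub_le fun s l n hl => by
      have h : r.toFun (𝟙 x) (P.act (trHom l) n) = (ker p).act (trHom l) (r.toFun l n) :=
        r.comm (𝟙 x) l _ (fun _ => rfl) n
      rw [Submodule.mem_comap, h]
      exact act_trHom_mem_brauerSub hl _
  refine (Submodule.Quotient.mk_eq_zero _).2 ?_
  have h := hle ((Submodule.Quotient.mk_eq_zero (brauerSub P x)).1 hv)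
  rw [Submodule.mem_comap] at h
  exact (hr (𝟙 x) k) ▸ h

/-! ### Brauer quotients of modules of spans -/

section SpanModule

variable {Y : Type u} [MulAction G Y]

/-- A `G`-map from `x`, as a basic span. -/
def resSpan (φ : x.GMap Y) : BasicSpan F x.carrier Y := ⟨x.subgroup, x.mem, MulActionHom.id G, φ⟩

lemma resSpan_injective {φ ψ : x.GMap Y} (h : resSpan φ ≈ resSpan ψ) : φ = ψ := by
  obtain ⟨σ, -, hl, hr⟩ := h
  refine MulActionHom.ext (f := (φ : x.carrier →[G] Y)) (g := (ψ : x.carrier →[G] Y)) fun t => ?_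
  have hσ : σ t = t := hl t
  refine (hr t).symm.trans ?_
  rw [hσ]
  rfl

lemma equiv_resSpan (A : BasicSpan F x.carrier Y) (f : x.carrier →[G] (G ⧸ A.apex))
    (hf : Function.Bijective f) (h : ∀ t, A.left (f t) = t) :
    resSpan (x := x) (A.right.comp f) ≈ A :=
  ⟨f, hf, h, fun _ => rfl⟩

lemma exists_equiv_resSpan (A : BasicSpan F x.carrier Y) (h : Function.Injective A.left) :
    ∃ φ : x.GMap Y, resSpan φ ≈ A := by
  obtain ⟨τ, h₁, h₂⟩ := Function.bijective_iff_has_inverse.1 ⟨h, gmap_surjective A.left⟩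
  exact ⟨_, equiv_resSpan A (A.left.inverse τ h₁ h₂) ⟨h₂.injective, h₁.surjective⟩ h₂⟩

open Classical in
/-- The coefficients of a basic morphism at the `G`-maps from `x`. -/
def resCoeff (q : BasicMorphism F x.carrier Y) : x.GMap Y →₀ R :=
  if h : ∃ φ : x.GMap Y, ⟦resSpan φ⟧ = q then Finsupp.single h.choose 1 else 0

lemma resCoeff_resSpan (φ : x.GMap Y) : resCoeff (R := R) ⟦resSpan φ⟧ = Finsupp.single φ 1 := by
  have h : ∃ ψ : x.GMap Y, (⟦resSpan ψ⟧ : BasicMorphism F x.carrier Y) = ⟦resSpan φ⟧ := ⟨φ, rfl⟩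
  rw [resCoeff, dif_pos h, resSpan_injective (Quotient.exact h.choose_spec)]

lemma resCoeff_of_not_injective (A : BasicSpan F x.carrier Y) (hA : ¬ Function.Injective A.left) :
    resCoeff (R := R) ⟦A⟧ = 0 := by
  refine dif_neg ?_
  rintro ⟨φ, h⟩
  obtain ⟨σ, hσ, hl, -⟩ := Quotient.exact h.symm
  refine hA fun a b hab => hσ.1 ?_
  exact (hl a).trans (hab.trans (hl b).symm)

lemma act_trHom_spanElt (l : y ⟶ x) (B : BasicSpan F y.carrier Y) :
    (spanModule F R Y).act (trHom l) (spanElt B.cls) =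
      spanElt (BasicSpan.mk B.apex B.mem ((toGMap l).comp B.left) B.right).cls :=
  (act_spanElt _ _).trans (congrArg spanElt (spanComp_transfer_left (toGMap l) B))

lemma brauerSub_spanModule_le : brauerSub (spanModule F R Y) x ≤
    LinearMap.ker (spanElim (R := R) (resCoeff (F := F) (x := x) (Y := Y) (R := R))) := by
  refine brauerSub_le fun s l n hl => ?_
  rw [LinearMap.mem_ker, ← LinearMap.comp_apply]
  refine LinearMap.congr_fun (spanModule_linearMap_ext (ψ := 0) fun B => ?_) n
  rw [LinearMap.comp_apply, act_trHom_spanElt, spanElim_elt, LinearMap.zero_apply]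
  refine resCoeff_of_not_injective _ fun h => hl ?_
  exact Function.Injective.of_comp_right (g := B.left) h (gmap_surjective B.left)

lemma spanElt_mem_brauerSub (A : BasicSpan F x.carrier Y) (hA : ¬ Function.Injective A.left) :
    spanElt A.cls ∈ brauerSub (spanModule F R Y) x := by
  let l : A.apexObj ⟶ x := ofGMap A.left
  let B : BasicSpan F A.apexObj.carrier Y := ⟨A.apex, A.mem, MulActionHom.id G, A.right⟩
  have hl : ¬ Function.Injective (toGMap l) := hA
  have hB := act_trHom_mem_brauerSub (M := spanModule F R Y) hl (spanElt B.cls)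
  rwa [act_trHom_spanElt] at hB

/-- The coordinates on the Brauer quotient of a module of spans. -/
def brauerCoord : (spanModule F R Y).val (of x) ⧸ brauerSub (spanModule F R Y) x →ₗ[R]
    x.GMap Y →₀ R :=
  (brauerSub (spanModule F R Y) x).liftQ (spanElim resCoeff) brauerSub_spanModule_le

lemma brauerCoord_mk (m : (spanModule F R Y).val (of x)) :
    brauerCoord ((brauerSub (spanModule F R Y) x).mkQ m) = spanElim resCoeff m := rfl

/-- The class of a `G`-map from `x` in the Brauer quotient. -/
def brauerElt (φ : x.GMap Y) :
    (spanModule F R Y).val (of x) ⧸ brauerSub (spanModule F R Y) x :=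
  (brauerSub (spanModule F R Y) x).mkQ (spanElt (resSpan φ).cls)

lemma brauerCoord_brauerElt (φ : x.GMap Y) :
    brauerCoord (R := R) (brauerElt φ) = Finsupp.single φ 1 := by
  rw [brauerElt, brauerCoord_mk, spanElim_elt, resCoeff_resSpan]

lemma linearCombination_brauerCoord
    (v : (spanModule F R Y).val (of x) ⧸ brauerSub (spanModule F R Y) x) :
    Finsupp.linearCombination R brauerElt (brauerCoord v) = v := by
  obtain ⟨m, rfl⟩ := (brauerSub (spanModule F R Y) x).mkQ_surjective v
  rw [brauerCoord_mk]
  refine LinearMap.congr_fun (spanModule_linearMap_ext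
    (φ := Finsupp.linearCombination R brauerElt ∘ₗ spanElim resCoeff)
    (ψ := (brauerSub (spanModule F R Y) x).mkQ) fun A => ?_) m
  rw [LinearMap.comp_apply, spanElim_elt]
  by_cases hA : Function.Injective A.left
  · obtain ⟨φ, hφ⟩ := exists_equiv_resSpan A hA
    rw [← Quotient.sound hφ, resCoeff_resSpan, Finsupp.linearCombination_single, one_smul,
      ← BasicSpan.cls_congr hφ]
    rfl
  · rw [resCoeff_of_not_injective A hA, map_zero]
    exact ((Submodule.Quotient.mk_eq_zero _).2 (spanElt_mem_brauerSub A hA)).symm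

variable (x Y R) in
/-- The Brauer quotient of the module of spans to `Y` at `x` is free on the `G`-maps from `x` to
`Y`. -/
def brauerBasis : Module.Basis (x.GMap Y) R
    ((spanModule F R Y).val (of x) ⧸ brauerSub (spanModule F R Y) x) :=
  .ofRepr <| LinearEquiv.ofLinearMap brauerCoord (Finsupp.linearCombination R brauerElt)
    (Finsupp.lhom_ext' fun φ => LinearMap.ext_ring (by
      rw [LinearMap.comp_apply, LinearMap.comp_apply, Finsupp.lsingle_apply,
        Finsupp.linearCombination_single, one_smul, brauerCoord_brauerElt]
      rfl))
    (LinearMap.ext linearCombination_brauerCoord)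

lemma brauerBasis_apply (φ : x.GMap Y) : brauerBasis R x Y φ = brauerElt φ := by
  change Finsupp.linearCombination R brauerElt (Finsupp.single φ 1) = _
  rw [Finsupp.linearCombination_single, one_smul]

lemma brauerAction_brauerBasis (w : Aut x) (φ : x.GMap Y) :
    brauerAction x (spanModule F R Y) w (brauerBasis R x Y φ) = brauerBasis R x Y (w • φ) := by
  rw [brauerBasis_apply, brauerBasis_apply, brauerElt, brauerAction_mk]
  refine congrArg (brauerSub (spanModule F R Y) x).mkQ ?_
  refine (act_trHom_spanElt w.hom (resSpan φ)).trans ?_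
  refine congrArg spanElt (BasicSpan.cls_congr ?_).symm
  exact equiv_resSpan (BasicSpan.mk x.subgroup x.mem (toGMap w.hom) φ) (toGMap w.inv)
    ⟨Function.LeftInverse.injective (inv_hom_apply w),
      Function.RightInverse.surjective (hom_inv_apply w)⟩ (inv_hom_apply w)

end SpanModule

lemma moduleFP_brauerRep_freeModule (x : TransitiveGSet F) (y : MackeyCategory F) (n : ℕ) :
    ModuleFP (MonoidAlgebra R (Aut x)) n ((brauerRep R x).obj (freeModule R y)) := by
  obtain ⟨y, rfl⟩ := of_surjective y
  have hy : ∀ t : y.carrier, Finite (MulAction.stabilizer G t) := fun t =>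
    F.finite_of_mem (hasIsotropyIn_quotient y.mem t)
  exact moduleFP_asModule (brauerAction x (spanModule F R y.carrier)) (brauerBasis R x y.carrier)
    brauerAction_brauerBasis (x.finite_orbits_gmap hy) (x.finite_stabilizer_gmap hy) n

/-! ### Finiteness properties of Mackey functors -/

/-- The isotropy groups of the source of a proper transfer are smaller than those of the target. -/
lemma card_subgroup_lt {s : TransitiveGSet F} (l : s ⟶ y) (hl : ¬ Function.Injective (toGMap l)) :
    Nat.card s.subgroup < Nat.card y.subgroup := by
  obtain ⟨a, ha⟩ := gmap_surjective (toGMap l) ((1 : G) : G ⧸ y.subgroup)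
  have hy : MulAction.stabilizer G (toGMap l a) = y.subgroup := by
    rw [ha, MulAction.stabilizer_quotient]
  have hs : Nat.card (MulAction.stabilizer G a) = Nat.card s.subgroup := by
    obtain ⟨g, rfl⟩ := MulAction.exists_smul_eq G ((1 : G) : G ⧸ s.subgroup) a
    rw [MulAction.stabilizer_smul_eq_stabilizer_map_conj, MulAction.stabilizer_quotient]
    exact (Nat.card_congr (s.subgroup.equivMapOfInjective _
      (MulAut.conj g).injective).toEquiv).symm
  have hle := stabilizer_le_of_gmap (toGMap l) a
  have := F.finite_of_mem y.mem
  rw [hy] at hle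
  by_contra! h
  have heq : MulAction.stabilizer G a = y.subgroup :=
    Subgroup.eq_of_le_of_card_ge hle (h.trans hs.ge)
  refine hl fun b c hbc => ?_
  obtain ⟨g, rfl⟩ := MulAction.exists_smul_eq G a b
  obtain ⟨k, rfl⟩ := MulAction.exists_smul_eq G a c
  have hgk : k⁻¹ * g ∈ MulAction.stabilizer G (toGMap l a) := by
    rw [MulAction.mem_stabilizer_iff, mul_smul, ← map_smul, hbc, map_smul, inv_smul_smul]
  rw [hy, ← heq, MulAction.mem_stabilizer_iff, mul_smul, inv_smul_eq_iff] at hgk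
  exact hgk

/-- Finite generation of a Mackey functor is detected by its Brauer quotients, if the family is
finite up to conjugation. By induction on the order of the isotropy groups, the lifts of generators
of the Brauer quotients generate all proper transfers, and hence everything. -/
lemma isFG_of_finite_brauerRep (hF : FiniteUpToIso F) (M : CatModule R (MackeyCategory F))
    (h : ∀ x, Module.Finite (MonoidAlgebra R (Aut x)) ((brauerRep R x).obj M)) : M.IsFG := by
  obtain ⟨k, t, ht⟩ := hF
  choose l m hm using fun i => exists_span_of_finite (brauerAction (t i) M) (h (t i))
  choose m' hm' using fun i j => (brauerSub M (t i)).mkQ_surjective (m i j)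
  let I := (i : Fin k) × Fin (l i)
  let S : ∀ y, Submodule R (M.val y) := fun y =>
    Submodule.span R {v | ∃ (p : I) (f : y ⟶ of (t p.1)), v = M.act f (m' p.1 p.2)}
  have hS : ∀ {y z : MackeyCategory F} (f : y ⟶ z), S z ≤ (S y).comap (M.act f) := by
    intro y z f
    refine Submodule.span_le.2 ?_
    rintro _ ⟨p, g, rfl⟩
    refine Submodule.subset_span ⟨p, f ≫ g, ?_⟩
    rw [act_comp]
  suffices key : ∀ (c : ℕ) (y : TransitiveGSet F), Nat.card y.subgroup = c →
      ∀ n, n ∈ S (of y) by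
    refine isFG_of_generates (I := I) (x := fun p => of (t p.1)) (m := fun p => m' p.1 p.2)
      fun y n => ?_
    obtain ⟨y, rfl⟩ := of_surjective y
    exact key _ y rfl n
  intro c
  induction c using Nat.strong_induction_on with | _ c ih
  rintro y rfl n
  have hBr : brauerSub M y ≤ S (of y) := brauerSub_le fun s l n hl =>
    hS (trHom l) (ih _ (card_subgroup_lt l hl) s rfl n)
  obtain ⟨i, ⟨e⟩⟩ := ht y
  have hn : n = M.act (trHom e.inv) (M.act (trHom e.hom) n) := by
    rw [← act_comp, ← trHom_comp, e.hom_inv_id, trHom_id, act_id]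
  suffices hle : Submodule.span R {v | ∃ j w, v = brauerAction (t i) M w (m i j)} ≤
      ((S (of y)).comap (M.act (trHom e.inv))).map (brauerSub M (t i)).mkQ by
    obtain ⟨v, hv, hvn⟩ := hle (hm i ((brauerSub M (t i)).mkQ (M.act (trHom e.hom) n)))
    have hb := brauerSub_le_comap_act e.inv ((Submodule.Quotient.eq (brauerSub M (t i))).1 hvn)
    have hv : M.act (trHom e.inv) v ∈ S (of y) := hv
    rw [Submodule.mem_comap, map_sub, ← hn] at hb
    have := sub_mem hv (hBr hb)
    rwa [sub_sub_cancel] at this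
  refine Submodule.span_le.2 ?_
  rintro _ ⟨j, w, rfl⟩
  refine ⟨M.act (trHom w.hom) (m' i j), ?_, ?_⟩
  · refine Submodule.subset_span ⟨⟨i, j⟩, trHom e.inv ≫ trHom w.hom, ?_⟩
    rw [act_comp]
  · rw [← hm', brauerAction_mk]

/-- A locally projective Mackey functor has type `FP_n` if and only if its Brauer quotients do, as
modules over the group algebras of the automorphism groups. -/
lemma isFP_iff (hF : FiniteUpToIso F) (hM : LocallyProjective M) (n : ℕ∞) :
    M.IsFP n ↔ ∀ (x : TransitiveGSet F) (k : ℕ), (k : ℕ∞) ≤ n →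
      ModuleFP (MonoidAlgebra R (Aut x)) k ((brauerRep R x).obj M) :=
  isFP_iff_moduleFP (fun x : TransitiveGSet F => MonoidAlgebra R (Aut x)) (fun x => brauerRep R x)
    LocallyProjective (fun _ hP => .of_projective hP) (fun p hp hP hM => hM.ker hP p hp)
    (fun p hp _ hM x => brauerRep_map_kerIncl_injective p hp hM x)
    (fun p hp x => brauerRep_map_exact p hp x) (fun p hp x => brauerRep_map_surjective p hp x)
    moduleFP_brauerRep_freeModule (isFG_of_finite_brauerRep hF) hM n

/-- If all Brauer quotients of a finitely generated Mackey functor are nontrivial, then the family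
is finite up to conjugation: without a map from `x` to the degree of a generator, the generator
only contributes proper transfers at `x`. -/
lemma finiteUpToIso_of_isFG (h : M.IsFG)
    (hM : ∀ x, Nontrivial (M.val (of x) ⧸ brauerSub M x)) : FiniteUpToIso F := by
  obtain ⟨k, t, m, hm⟩ := (isFG_iff M).1 h
  choose s hs using fun i => of_surjective (t i)
  obtain rfl : (fun i => of (s i)) = t := funext hs
  refine finiteUpToIso_of_hom s fun x => ?_
  by_contra! hx
  refine Submodule.Quotient.nontrivial_iff.1 (hM x) (eq_top_iff.2 fun n _ => ?_)
  refine Submodule.span_le.2 ?_ (hm (of x) n)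
  rintro _ ⟨i, f, rfl⟩
  have : IsEmpty (x ⟶ s i) := hx i
  refine hom_induction (p := fun f => M.act f (m i) ∈ brauerSub M x) f ?_ ?_ ?_
  · rw [act_zero]
    exact zero_mem _
  · intro f g hf hg
    rw [act_add]
    exact add_mem hf hg
  · intro r A
    rw [act_zsmul, basic_eq]
    refine zsmul_mem ?_ r
    rw [act_comp]
    refine act_trHom_mem_brauerSub (fun hA => ?_) _
    obtain ⟨φ, -⟩ := exists_equiv_resSpan A hA
    exact this.elim φ

end MackeyCategory

end Brauer

/-! ### Trivial coefficients -/

section Trivial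

variable {G : Type u} [Group G] (F : FiniteSubgroupFamily G) (R : Type u) [CommRing R]

open CatModule TransitiveGSet

instance (x : TransitiveGSet F) : Unique (x.GMap (G ⧸ (⊤ : Subgroup G))) where
  default := ⟨fun _ => ((1 : G) : G ⧸ (⊤ : Subgroup G)), fun _ _ =>
    QuotientGroup.subsingleton_quotient_top.elim _ _⟩
  uniq _ := MulActionHom.ext fun _ => QuotientGroup.subsingleton_quotient_top.elim _ _

/-- The Brauer quotients of the Burnside functor and the values of the constant Bredon module are
both the trivial module `R`. -/
lemma moduleFP_brauerRep_burnsideFunctor_iff (x : TransitiveGSet F) (k : ℕ) :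
    ModuleFP (MonoidAlgebra R (Aut x)) k
        ((MackeyCategory.brauerRep R x).obj (burnsideFunctor F R)) ↔
      ModuleFP (MonoidAlgebra R (Aut x)) k
        ((OrbitCategory.evalRep R x).obj (constantBredonModule F R)) :=
  moduleFP_iff_of_trivial (MackeyCategory.brauerAction x (burnsideFunctor F R))
    (OrbitCategory.rep x (constantBredonModule F R))
    (MackeyCategory.brauerBasis R x (G ⧸ (⊤ : Subgroup G))) (Module.Basis.singleton PUnit.{u+1} R)
    (fun w => (MackeyCategory.brauerAction_brauerBasis w _).trans
      (congrArg _ (Subsingleton.elim _ _)))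
    (fun w => OrbitCategory.constant_act w.inv _) k

end Trivial

end

theorem mainTheorem4 (G : Type u) [Group G] (R : Type u) [CommRing R]
    (F : FiniteSubgroupFamily G) (n : ℕ∞) :
    IsMackeyFP F R n ↔ IsBredonFP F R n := by
  -- Over the zero ring both sides hold, without any condition on the family.
  rcases subsingleton_or_nontrivial R with hR | hR
  · exact iff_of_true
      (CatModule.isFP_of_subsingleton
        (fun x => Module.subsingleton R ((burnsideFunctor F R).val x)) n)
      (CatModule.isFP_of_subsingleton
        (fun x => Module.subsingleton R ((constantBredonModule F R).val x)) n)
  have hM : IsMackeyFP F R n → FiniteUpToIso F := fun h =>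
    MackeyCategory.finiteUpToIso_of_isFG (CatModule.IsFP.isFG h) fun x =>
      (MackeyCategory.brauerBasis R x (G ⧸ (⊤ : Subgroup G))).repr.toEquiv.nontrivial
  have hB : IsBredonFP F R n → FiniteUpToIso F := fun h =>
    OrbitCategory.finiteUpToIso_of_isFG (CatModule.IsFP.isFG h) fun _ => hR
  by_cases hF : FiniteUpToIso F
  · -- The Burnside functor is the module of spans to `G/G`.
    refine (MackeyCategory.isFP_iff hF
      (LocallyProjective.spanModule (G ⧸ (⊤ : Subgroup G))) n).trans
      (Iff.trans ?_ (OrbitCategory.isFP_iff hF (constantBredonModule F R) n).symm)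
    exact forall_congr' fun x => forall_congr' fun k => forall_congr' fun _ =>
      moduleFP_brauerRep_burnsideFunctor_iff F R x k
  · exact iff_of_false (fun h => hF (hM h)) fun h => hF (hB h)
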